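/- Let $n\ge 2$ be an integer and $\Omega=\mathbb R^n\times(0,\infty)$, with points $(x,z)$ and Lebesgue measure $d\mu$; let $\nabla$ and $\Delta$ be the gradient and the Laplacian in $x\in\mathbb R^n$. On the complex Hilbert space $H=L^2(\Omega,z\,d\mu)$ let $A$ be the operator with domain $C_0^\infty(\Omega)$ (complex-valued smooth functions with compact support in $\Omega$) given by $$A\varphi=-\frac1z\,\partial_z\big(z\,\partial_z\varphi\big)-\frac1{z^{1+1/n}}\,\Delta\varphi ,$$ and let the energy space be $$\mathcal E=\Big\{\varphi\in H^1_{loc}(\Omega)\cap H:\ b(\varphi,\varphi):=\int_\Omega\Big(z\,|\partial_z\varphi|^2+z^{-1/n}\,|\nabla\varphi|^2\Big)d\mu<\infty\Big\},\qquad \|\varphi\|_{\mathcal E}^2=b(\varphi,\varphi)+\|\varphi\|_H^2,$$ with derivatives in the weak sense. Then: 1. $A$ is densely defined, symmetric and nonnegative on $H$, but it is not essentially self-adjoint, i.e. its closure is not self-adjoint. 2. There is exactly one self-adjoint extension of $A$ whose domain is contained in $\mathcal E$, and it is the Friedrichs extension of $A$, i.e. the restriction of $A^*$ to the intersection of $D(A^*)$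 with the domain of the closure of the quadratic form $\varphi\mapsto\langle A\varphi,\varphi\rangle_H$, $\varphi\in C_0^\infty(\Omega)$. 3. $C_0^\infty(\Omega)$ is contained in $\mathcal E$ and dense in it for the norm $\|\cdot\|_{\mathcal E}$. -/

import Mathlib

open MeasureTheory Filter Topology TopologicalSpace
open scoped ENNReal ContDiff Distributions LinearPMap

noncomputable section

/-! ### Unbounded operators on a Hilbert space -/

namespace UnboundedOp

variable {H : Type*} [NormedAddCommGroup H] [InnerProductSpace ℂ H] [CompleteSpace H]

/-- Densely defined, symmetric and nonnegative. -/
structure IsNonnegSymmetric (A : H →ₗ.[ℂ] H) : Prop where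
  dense : Dense (A.domain : Set H)
  symmetric : A.IsFormalAdjoint A
  nonneg : ∀ x : A.domain, 0 ≤ (inner ℂ (A x) (x : H)).re

/-- A (densely defined, symmetric) operator is essentially self-adjoint if its closure is
self-adjoint. -/
def IsEssentiallySelfAdjoint (A : H →ₗ.[ℂ] H) : Prop :=
  IsSelfAdjoint A.closure

/-- `T` is a self-adjoint extension of `A`. -/
def IsSelfAdjointExtension (A T : H →ₗ.[ℂ] H) : Prop :=
  A ≤ T ∧ IsSelfAdjoint T

/-- The domain of the closure of the form `x ↦ ⟨A x, x⟩` of a nonnegative symmetric operator `A`: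
the `H`-limits of sequences in the domain of `A` that are Cauchy for the form. -/
def formDomain (A : H →ₗ.[ℂ] H) : Set H :=
  {u | ∃ x : ℕ → A.domain,
    Tendsto (fun k => (x k : H)) atTop (𝓝 u) ∧
    Tendsto (fun kl : ℕ × ℕ =>
      (inner ℂ (A (x kl.1 - x kl.2)) ((x kl.1 - x kl.2 : A.domain) : H)).re) atTop (𝓝 0)}

/-- `T` is the Friedrichs extension of the nonnegative symmetric operator `A`: the restriction of
the adjoint `A†` to the intersection of its domain with the domain of the closed form. -/
structure IsFriedrichsExtension (A T : H →ₗ.[ℂ] H) : Prop where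
  nonnegSymmetric : IsNonnegSymmetric A
  le_adjoint : T ≤ A†
  mem_domain_iff : ∀ u : H, u ∈ T.domain ↔ u ∈ A†.domain ∧ u ∈ formDomain A

end UnboundedOp

/-! ### The half space `Ω = ℝⁿ × (0, ∞)`, the Hilbert space and the wave operator -/

namespace Taub

/-- Points `(x, z)`, with `x ∈ ℝⁿ` and `z ∈ ℝ`. -/
abbrev Pt (n : ℕ) : Type := EuclideanSpace ℝ (Fin n) × ℝ

/-- `Ω = ℝⁿ × (0, ∞)`. -/
def Om (n : ℕ) : Opens (Pt n) :=
  ⟨{p | 0 < p.2}, isOpen_lt continuous_const continuous_snd⟩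

/-- The measure `z dμ` on `Ω`, where `dμ` is the Lebesgue measure. -/
def zMeasure (n : ℕ) : Measure (Pt n) :=
  ((volume : Measure (Pt n)).restrict (Om n)).withDensity (fun p => ENNReal.ofReal p.2)

/-- The complex Hilbert space `H = L²(Ω, z dμ)`. -/
abbrev Hsp (n : ℕ) : Type := Lp ℂ 2 (zMeasure n)

/-- The unit vector in the direction `x^i`. -/
def ex {n : ℕ} (i : Fin n) : Pt n := (EuclideanSpace.single i 1, 0)

/-- The unit vector in the direction `z`. -/
def ez {n : ℕ} : Pt n := (0, 1)

/-- The classical partial derivative in the direction `v`. -/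
def pd {n : ℕ} (v : Pt n) (f : Pt n → ℂ) : Pt n → ℂ := fun p => fderiv ℝ f p v

/-- `A φ = - z⁻¹ ∂_z (z ∂_z φ) - z^(-1-1/n) Δ φ`, pointwise. -/
def waveFun {n : ℕ} (f : Pt n → ℂ) : Pt n → ℂ := fun p =>
  -((p.2⁻¹ : ℝ) : ℂ) * pd ez (fun q => (q.2 : ℂ) * pd ez f q) p
    - ((p.2 ^ (-1 - 1 / (n : ℝ)) : ℝ) : ℂ) * ∑ i : Fin n, pd (ex i) (pd (ex i) f) p

section helpers

variable {n : ℕ}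

theorem pd_contDiff (v : Pt n) {f : Pt n → ℂ} (hf : ContDiff ℝ ∞ f) : ContDiff ℝ ∞ (pd v f) :=
  (hf.fderiv_right (m := ∞) (by simp)).clm_apply contDiff_const

theorem tsupport_pd_subset (v : Pt n) (f : Pt n → ℂ) : tsupport (pd v f) ⊆ tsupport f := by
  refine (closure_mono ?_).trans (tsupport_fderiv_subset ℝ (f := f))
  intro p hp h
  exact hp (by simp [pd, h])

theorem zpd_contDiff {f : Pt n → ℂ} (hf : ContDiff ℝ ∞ f) :
    ContDiff ℝ ∞ (fun q : Pt n => (q.2 : ℂ) * pd ez f q) :=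
  (Complex.ofRealCLM.contDiff.comp contDiff_snd).mul (pd_contDiff ez hf)

theorem pd_eq_zero (v : Pt n) {f : Pt n → ℂ} {p : Pt n} (hp : p ∉ tsupport f) : pd v f p = 0 :=
  image_eq_zero_of_notMem_tsupport fun h => hp (tsupport_pd_subset v f h)

theorem waveFun_eq_zero {f : Pt n → ℂ} {p : Pt n} (hp : p ∉ tsupport f) : waveFun f p = 0 := by
  have h1 : pd ez (fun q : Pt n => (q.2 : ℂ) * pd ez f q) p = 0 := by
    refine pd_eq_zero _ fun h => hp (tsupport_pd_subset ez f ?_)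
    exact tsupport_mul_subset_right h
  have h2 : ∀ i : Fin n, pd (ex i) (pd (ex i) f) p = 0 := fun i =>
    pd_eq_zero _ fun h => hp (tsupport_pd_subset _ f h)
  simp [waveFun, h1, h2]

theorem waveFun_continuous (φ : 𝓓(Om n, ℂ)) : Continuous (waveFun (φ : Pt n → ℂ)) := by
  have hf : ContDiff ℝ ∞ (φ : Pt n → ℂ) := φ.contDiff
  rw [continuous_iff_continuousAt]
  intro p
  by_cases hp : p ∈ tsupport (φ : Pt n → ℂ)
  · have hz : 0 < p.2 := φ.tsupport_subset hp
    unfold waveFun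
    refine ContinuousAt.sub (ContinuousAt.mul ?_ ?_) (ContinuousAt.mul ?_ ?_)
    · exact (Complex.continuous_ofReal.continuousAt.comp
        (continuousAt_snd.inv₀ hz.ne')).neg
    · exact (pd_contDiff ez (zpd_contDiff hf)).continuous.continuousAt
    · exact Complex.continuous_ofReal.continuousAt.comp
        (continuousAt_snd.rpow_const (Or.inl hz.ne'))
    · exact (continuous_finsetSum _ fun i _ =>
        (pd_contDiff _ (pd_contDiff _ hf)).continuous).continuousAt
  · have : waveFun (φ : Pt n → ℂ) =ᶠ[𝓝 p] fun _ => 0 := by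
      filter_upwards [(isClosed_tsupport (φ : Pt n → ℂ)).isOpen_compl.mem_nhds hp] with q hq
      exact waveFun_eq_zero hq
    exact continuousAt_const.congr this.symm

instance : IsFiniteMeasureOnCompacts (zMeasure n) :=
  ⟨fun K hK => by
    obtain ⟨C, hC⟩ := hK.exists_bound_of_continuousOn (f := fun p : Pt n => p.2)
      continuous_snd.continuousOn
    rw [zMeasure, withDensity_apply _ hK.measurableSet]
    calc ∫⁻ p in K, ENNReal.ofReal p.2 ∂((volume : Measure (Pt n)).restrict (Om n))
        ≤ ∫⁻ _ in K, ENNReal.ofReal C ∂((volume : Measure (Pt n)).restrict (Om n)) := by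
          refine setLIntegral_mono' hK.measurableSet fun p hp => ?_
          exact ENNReal.ofReal_le_ofReal ((le_abs_self _).trans (hC p hp))
      _ < (⊤ : ℝ≥0∞) := by
          rw [setLIntegral_const]
          exact ENNReal.mul_lt_top ENNReal.ofReal_lt_top hK.measure_lt_top⟩

theorem test_memLp (φ : 𝓓(Om n, ℂ)) : MemLp (φ : Pt n → ℂ) 2 (zMeasure n) :=
  φ.continuous.memLp_of_hasCompactSupport φ.hasCompactSupport

theorem waveFun_memLp (φ : 𝓓(Om n, ℂ)) : MemLp (waveFun (φ : Pt n → ℂ)) 2 (zMeasure n) :=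
  (waveFun_continuous φ).memLp_of_hasCompactSupport
    (φ.hasCompactSupport.mono' fun _ hp => by
      by_contra h
      exact hp (waveFun_eq_zero h))

theorem pd_add (v : Pt n) {f g : Pt n → ℂ} (hf : ContDiff ℝ ∞ f) (hg : ContDiff ℝ ∞ g) :
    pd v (f + g) = pd v f + pd v g := by
  funext p
  simp [pd, fderiv_add (hf.differentiable (by simp) p) (hg.differentiable (by simp) p)]

theorem pd_smul (v : Pt n) (c : ℂ) {f : Pt n → ℂ} (hf : ContDiff ℝ ∞ f) :
    pd v (c • f) = c • pd v f := by
  funext p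
  simp [pd, fderiv_const_smul (hf.differentiable (by simp) p)]

theorem waveFun_add {f g : Pt n → ℂ} (hf : ContDiff ℝ ∞ f) (hg : ContDiff ℝ ∞ g) :
    waveFun (f + g) = waveFun f + waveFun g := by
  have h : (fun q : Pt n => (q.2 : ℂ) * (pd ez f + pd ez g) q)
      = (fun q : Pt n => (q.2 : ℂ) * pd ez f q) + fun q : Pt n => (q.2 : ℂ) * pd ez g q := by
    funext q
    simp [mul_add]
  funext p
  simp only [waveFun, pd_add _ hf hg, pd_add _ (pd_contDiff _ hf) (pd_contDiff _ hg),
    Pi.add_apply, Finset.sum_add_distrib]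
  rw [show (fun q : Pt n => (q.2 : ℂ) * (pd ez f q + pd ez g q))
      = (fun q : Pt n => (q.2 : ℂ) * pd ez f q) + fun q : Pt n => (q.2 : ℂ) * pd ez g q from h,
    pd_add _ (zpd_contDiff hf) (zpd_contDiff hg), Pi.add_apply]
  ring

theorem waveFun_smul (c : ℂ) {f : Pt n → ℂ} (hf : ContDiff ℝ ∞ f) :
    waveFun (c • f) = c • waveFun f := by
  have h : (fun q : Pt n => (q.2 : ℂ) * (c * pd ez f q))
      = c • fun q : Pt n => (q.2 : ℂ) * pd ez f q := by
    funext q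
    simp only [Pi.smul_apply, smul_eq_mul]
    ring
  funext p
  simp only [waveFun, pd_smul _ c hf, pd_smul _ c (pd_contDiff _ hf), Pi.smul_apply, smul_eq_mul,
    ← Finset.mul_sum]
  rw [h, pd_smul _ c (zpd_contDiff hf), Pi.smul_apply, smul_eq_mul]
  ring

end helpers

/-- The inclusion of `C₀^∞(Ω)` in `H`. -/
def incl (n : ℕ) : 𝓓(Om n, ℂ) →ₗ[ℂ] Hsp n where
  toFun φ := (test_memLp φ).toLp _
  map_add' φ ψ := MemLp.toLp_add (test_memLp φ) (test_memLp ψ)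
  map_smul' c φ := MemLp.toLp_const_smul c (test_memLp φ)

/-- The map `φ ↦ A φ` from `C₀^∞(Ω)` to `H`. -/
def waveMap (n : ℕ) : 𝓓(Om n, ℂ) →ₗ[ℂ] Hsp n where
  toFun φ := (waveFun_memLp φ).toLp _
  map_add' φ ψ := by
    rw [← MemLp.toLp_add (waveFun_memLp φ) (waveFun_memLp ψ)]
    exact MemLp.toLp_congr _ _ (.of_forall fun p => congrFun (waveFun_add φ.contDiff ψ.contDiff) p)
  map_smul' c φ := by
    rw [RingHom.id_apply, ← MemLp.toLp_const_smul c (waveFun_memLp φ)]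
    exact MemLp.toLp_congr _ _ (.of_forall fun p => congrFun (waveFun_smul c φ.contDiff) p)

theorem incl_injective (n : ℕ) : Function.Injective (incl n) := by
  intro φ ψ h
  have h1 : (φ : Pt n → ℂ) =ᵐ[zMeasure n] ψ :=
    (MemLp.toLp_eq_toLp_iff (test_memLp φ) (test_memLp ψ)).1 h
  have h2 : (φ : Pt n → ℂ) =ᵐ[(volume : Measure (Pt n)).restrict (Om n)] ψ := by
    have hm : Measurable fun p : Pt n => ENNReal.ofReal p.2 := by fun_prop
    have h3 := (ae_withDensity_iff hm).1 h1
    filter_upwards [h3, ae_restrict_mem (Om n).isOpen.measurableSet] with p hp hp'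
    exact hp (ENNReal.ofReal_pos.2 hp').ne'
  have h4 : Set.EqOn (φ : Pt n → ℂ) ψ (Om n) :=
    Measure.eqOn_open_of_ae_eq h2 (Om n).isOpen φ.continuous.continuousOn
      ψ.continuous.continuousOn
  ext p
  by_cases hp : p ∈ Om n
  · exact h4 hp
  · rw [image_eq_zero_of_notMem_tsupport fun h => hp (φ.tsupport_subset h),
      image_eq_zero_of_notMem_tsupport fun h => hp (ψ.tsupport_subset h)]

/-- The operator `A` on `H`, with domain `C₀^∞(Ω)`. -/
def waveOp (n : ℕ) : Hsp n →ₗ.[ℂ] Hsp n where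
  domain := LinearMap.range (incl n)
  toFun := waveMap n ∘ₗ (LinearEquiv.ofInjective (incl n) (incl_injective n)).symm.toLinearMap

theorem waveOp_incl (n : ℕ) (φ : 𝓓(Om n, ℂ)) :
    waveOp n ⟨incl n φ, LinearMap.mem_range_self _ φ⟩ = waveMap n φ := by
  change waveMap n ((LinearEquiv.ofInjective (incl n) (incl_injective n)).symm
    ((LinearEquiv.ofInjective (incl n) (incl_injective n)) φ)) = _
  rw [LinearEquiv.symm_apply_apply]

/-! ### The energy space -/

/-- `g ∈ L²_loc(Ω)`. -/
def IsL2loc {n : ℕ} (g : Pt n → ℂ) : Prop :=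
  ∀ K : Set (Pt n), IsCompact K → K ⊆ Om n →
    MemLp g 2 ((volume : Measure (Pt n)).restrict K)

/-- `g ∈ L²_loc(Ω)` is the weak derivative of `u` in the direction `v` on `Ω`. -/
def HasWeakPd {n : ℕ} (v : Pt n) (u g : Pt n → ℂ) : Prop :=
  IsL2loc g ∧ ∀ ψ : 𝓓(Om n, ℂ),
    ∫ p in (Om n : Set (Pt n)), u p * pd v ψ p = -∫ p in (Om n : Set (Pt n)), g p * ψ p

/-- `u ∈ H¹_loc(Ω)`. -/
def IsH1loc {n : ℕ} (u : Pt n → ℂ) : Prop :=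
  IsL2loc u ∧ (∃ g, HasWeakPd ez u g) ∧ ∀ i : Fin n, ∃ g, HasWeakPd (ex i) u g

open Classical in
/-- The weak derivative of `u` in the direction `v` (unique almost everywhere on `Ω`), if there is
one in `L²_loc(Ω)`, and `0` otherwise. -/
def weakPd {n : ℕ} (v : Pt n) (u : Pt n → ℂ) : Pt n → ℂ :=
  if h : ∃ g, HasWeakPd v u g then h.choose else 0

/-- `b(u, u) = ∫_Ω (z |∂_z u|² + z^(-1/n) |∇ u|²) dμ ∈ [0, ∞]`, for `u ∈ H¹_loc(Ω)`. -/
def dirichlet {n : ℕ} (u : Pt n → ℂ) : ℝ≥0∞ :=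
  ∫⁻ p in (Om n : Set (Pt n)),
    (ENNReal.ofReal p.2 * ‖weakPd ez u p‖ₑ ^ 2
      + ENNReal.ofReal (p.2 ^ (-(1 / (n : ℝ)))) * ∑ i : Fin n, ‖weakPd (ex i) u p‖ₑ ^ 2)

/-- The energy space `{u ∈ H¹_loc(Ω) ∩ H : b(u, u) < ∞}`. -/
def energySpace (n : ℕ) : Set (Hsp n) :=
  {u | IsH1loc (u : Pt n → ℂ) ∧ dirichlet (u : Pt n → ℂ) < ⊤}

/-- The square `b(u, u) + ‖u‖_H²` of the energy norm. -/
def energyNormSq {n : ℕ} (u : Hsp n) : ℝ≥0∞ :=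
  dirichlet (u : Pt n → ℂ) + ‖u‖ₑ ^ 2

/-- `C₀^∞(Ω)` is contained in the energy space and dense in it for the energy norm. -/
def TestFunctionsDenseInEnergySpace (n : ℕ) : Prop :=
  (∀ φ : 𝓓(Om n, ℂ), incl n φ ∈ energySpace n) ∧
  ∀ u ∈ energySpace n, ∀ ε : ℝ≥0∞, 0 < ε →
    ∃ φ : 𝓓(Om n, ℂ), energyNormSq (u - incl n φ) < ε

end Taub

end

/-! Let `D φ = (z^(1/2) ∂_z φ, z^(-1/(2n)) ∇φ)` be the weighted gradient. Integration by parts gives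
`⟨D φ, D ψ⟩ = ⟨A φ, ψ⟩` (`inner_gradOp`), so `A` is symmetric and nonnegative, and closing its form
amounts to closing the graph of `D` in `H × K`. The first components of this closure, `formGraph D`,
are the form domain. Restricting `A†` to them gives a self-adjoint operator, by Riesz representation
in `formGraph D` (`isSelfAdjoint_friedrichs`), and a self-adjoint extension with domain in the form
domain has to coincide with it (`eq_friedrichs_of_domain_subset`). Parts 2 and 3 therefore reduce to
one fact: the graph of the weak weighted gradient, `energyGraph`, is no larger than the closure of
its test pairs `(φ, D φ)` (`energyGraph_eq_formGraph`).

For this it suffices that a pair `p = (u, k)` in `energyGraph` orthogonal to all test pairs vanishes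
(`EnergyPair.eq_zero_of_orthogonal`). One tests with `χ u`, where `χ` is a cutoff at logarithmic
scale `R` in `z` and at scale `e^(2R)` in `x`. Near the boundary `z = 0` the derivative of `χ` costs
`|u|² / (z R²)`. Hardy's inequality on a logarithmic scale (`exists_hardy`) bounds the integral of
`|u|² / z` there by `R²` times the energy `E`, so the cost is bounded by a multiple of `E`, although
it need not be small. It is, however, paired with `k` only where `χ` varies, and the energy carried
by that region tends to `0`. Young's inequality with a small parameter then gives `E ≤ E / 2`, so `E
= 0`.

If `A` were essentially self-adjoint, its form domain would contain `D(A†)`, and even every `u` for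
which `⟨u, A x⟩` is bounded in the form norm (`IsEssentiallySelfAdjoint.mem_formDomain`). A smooth
function equal to `b(x) log z` near the boundary refutes this. Its `z`-part `z⁻¹ ∂_z (z ∂_z ·)`
vanishes near `z = 0`, and its weighted `x`-gradient is square integrable because `n ≥ 2`, which
gives the boundedness. But `z |∂_z (b log z)|² = b² / z` is not integrable at `z = 0`, so the
function has infinite energy. -/

open scoped ComplexConjugate

noncomputable section

/-! ### The Friedrichs extension through the closed graph of a factor `D` of the form -/

namespace UnboundedOp

variable {H K : Type*} [NormedAddCommGroup H] [InnerProductSpace ℂ H] [CompleteSpace H]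
  [NormedAddCommGroup K] [InnerProductSpace ℂ K]

/-- A symmetric, densely defined operator `S` with `S + 1` surjective is self-adjoint. -/
theorem isSelfAdjoint_of_add_one_surjective {S : H →ₗ.[ℂ] H} (hd : Dense (S.domain : Set H))
    (hs : S.IsFormalAdjoint S) (hsurj : ∀ f : H, ∃ u : S.domain, S u + (u : H) = f) :
    IsSelfAdjoint S := by
  rw [LinearPMap.isSelfAdjoint_def]
  have hle : S ≤ S† := hs.le_adjoint hd
  refine le_antisymm ?_ hle
  have hfa := LinearPMap.adjoint_isFormalAdjoint hd
  have key : ∀ v : S†.domain, ∃ u : S.domain, (u : H) = v ∧ S u = S† v := by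
    intro v
    obtain ⟨u, hu⟩ := hsurj (S† v + (v : H))
    -- The difference `v - u` is annihilated by `S† + 1`, hence orthogonal to the range of `S + 1`,
    -- which is everything. Writing it as `S x + x` makes it orthogonal to itself.
    have hz : (v : H) - u = 0 := by
      obtain ⟨x, hx⟩ := hsurj ((v : H) - u)
      have h1 : inner ℂ ((v : H) - u) (S x + (x : H)) = 0 := by
        have e1 := hfa v x
        have e2 := hs u x
        have e3 := congrArg (fun y => inner ℂ y (x : H)) hu
        simp only [inner_add_left] at e3
        simp only [inner_sub_left, inner_add_right, ← e1, ← e2]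
        linear_combination -e3
      rw [hx] at h1
      exact inner_self_eq_zero.1 h1
    have huv : (u : H) = v := (sub_eq_zero.1 hz).symm
    refine ⟨u, huv, ?_⟩
    rw [huv] at hu
    exact add_right_cancel hu
  refine ⟨fun v hv => ?_, fun v u hvu => ?_⟩
  · obtain ⟨u, hu, -⟩ := key ⟨v, hv⟩
    change (u : H) = v at hu
    exact hu ▸ u.2
  · obtain ⟨u', hu', h'⟩ := key v
    rw [← h']
    congr 1
    exact Subtype.ext (hu'.trans hvu)

/-- A self-adjoint extension of a densely defined operator is a restriction of the adjoint. -/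
theorem IsSelfAdjointExtension.le_adjoint {A T : H →ₗ.[ℂ] H} (hd : Dense (A.domain : Set H))
    (h : IsSelfAdjointExtension A T) : T ≤ A† := by
  refine LinearPMap.IsFormalAdjoint.le_adjoint hd fun x y => ?_
  have hT : T.IsFormalAdjoint T := by
    have := LinearPMap.adjoint_isFormalAdjoint (h.2.dense_domain)
    rwa [LinearPMap.isSelfAdjoint_def.1 h.2] at this
  have := hT ⟨x, h.1.1 x.2⟩ y
  rwa [← h.1.2 (x := x) (y := ⟨x, h.1.1 x.2⟩) rfl] at this

/-- The closure of the set of pairs `(x, D x)`. -/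
def formGraph {A : H →ₗ.[ℂ] H} (D : A.domain →ₗ[ℂ] K) : Submodule ℂ (WithLp 2 (H × K)) :=
  (LinearMap.range ((WithLp.linearEquiv 2 ℂ (H × K)).symm.toLinearMap ∘ₗ
    (A.domain.subtype.prod D))).topologicalClosure

section formGraph

variable {A : H →ₗ.[ℂ] H} {D : A.domain →ₗ[ℂ] K}

omit [CompleteSpace H] in
theorem toLp_mem_formGraph (x : A.domain) : WithLp.toLp 2 ((x : H), D x) ∈ formGraph D :=
  Submodule.le_topologicalClosure _ ⟨x, rfl⟩

omit [CompleteSpace H] in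
theorem formGraph_induction {P : WithLp 2 (H × K) → Prop} (hP : IsClosed {p | P p})
    (h : ∀ x : A.domain, P (WithLp.toLp 2 ((x : H), D x))) {p : WithLp 2 (H × K)}
    (hp : p ∈ formGraph D) : P p := by
  have : (formGraph D : Set (WithLp 2 (H × K))) ⊆ {p | P p} := by
    rw [formGraph, Submodule.topologicalClosure_coe]
    refine closure_minimal ?_ hP
    rintro _ ⟨x, rfl⟩
    exact h x
  exact this hp

-- The form evaluated at `x - y` is `‖D x - D y‖²`, so being Cauchy for the form means that the
-- images under `D` are Cauchy, and completeness of `K` supplies the second component. This replaces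
-- any discussion of closability of the form.
omit [CompleteSpace H] in
theorem mem_formDomain_iff [CompleteSpace K]
    (hD : ∀ x y : A.domain, inner ℂ (D x) (D y) = inner ℂ (A x) (y : H)) (u : H) :
    u ∈ formDomain A ↔ ∃ k, WithLp.toLp 2 (u, k) ∈ formGraph D := by
  have hn : ∀ x y : A.domain,
      (inner ℂ (A (x - y)) ((x - y : A.domain) : H)).re = ‖D x - D y‖ ^ 2 := fun x y => by
    rw [← hD, map_sub]
    exact inner_self_eq_norm_sq (𝕜 := ℂ) _
  constructor
  · rintro ⟨x, hx, hc⟩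
    simp only [hn] at hc
    have hcau : CauchySeq fun m => D (x m) := by
      refine cauchySeq_iff_tendsto_dist_atTop_0.2 ?_
      have := (Real.continuous_sqrt.tendsto _).comp hc
      simpa [Function.comp_def, Real.sqrt_sq, dist_eq_norm] using this
    obtain ⟨k, hk⟩ := cauchySeq_tendsto_of_complete hcau
    refine ⟨k, (Submodule.isClosed_topologicalClosure _).mem_of_tendsto
      (f := fun m => WithLp.toLp 2 ((x m : H), D (x m))) (b := atTop) ?_
      (.of_forall fun m => toLp_mem_formGraph (x m))⟩
    exact ((WithLp.prod_continuous_toLp 2 H K).tendsto _).comp (hx.prodMk_nhds hk)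
  · rintro ⟨k, hk⟩
    rw [formGraph, ← SetLike.mem_coe, Submodule.topologicalClosure_coe,
      mem_closure_iff_seq_limit] at hk
    obtain ⟨s, hs, hlim⟩ := hk
    choose x hx using hs
    have hlim' := ((WithLp.prod_continuous_ofLp 2 H K).tendsto _).comp hlim
    rw [nhds_prod_eq, tendsto_prod_iff'] at hlim'
    have h1 : Tendsto (fun m => (x m : H)) atTop (𝓝 u) := by
      refine hlim'.1.congr fun m => ?_
      simp [← hx m]
    have h2 : Tendsto (fun m => D (x m)) atTop (𝓝 k) := by
      refine hlim'.2.congr fun m => ?_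
      simp [← hx m]
    refine ⟨x, h1, ?_⟩
    simp only [hn]
    have h3 := cauchySeq_iff_tendsto_dist_atTop_0.1 h2.cauchySeq
    simpa [dist_eq_norm] using h3.pow 2

-- Symmetry of `A` moves it onto `y`, and the resulting identity is continuous in the pair, so it
-- survives the closure.
omit [CompleteSpace H] in
theorem inner_snd_of_mem_formGraph (hA : A.IsFormalAdjoint A)
    (hD : ∀ x y : A.domain, inner ℂ (D x) (D y) = inner ℂ (A x) (y : H))
    {p : WithLp 2 (H × K)} (hp : p ∈ formGraph D) (y : A.domain) :
    inner ℂ p.snd (D y) = inner ℂ p.fst (A y) := by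
  refine formGraph_induction (P := fun p => inner ℂ p.snd (D y) = inner ℂ p.fst (A y))
    ?_ (fun x => ?_) hp
  · exact isClosed_eq (by fun_prop) (by fun_prop)
  · exact (hD x y).trans (hA x y)

/-- First representation formula for the closed form: both sides are continuous in `q`, and for `q =
(y, D y)` both equal `⟨p.fst, A y⟩`. Symmetry of the Friedrichs extension follows, since the right
side is Hermitian in `p` and `q`. -/
theorem inner_adjoint_of_mem_formGraph (hA : IsNonnegSymmetric A)
    (hD : ∀ x y : A.domain, inner ℂ (D x) (D y) = inner ℂ (A x) (y : H))
    {p q : WithLp 2 (H × K)} (hp : p ∈ formGraph D) (hq : q ∈ formGraph D) (u : A†.domain)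
    (hu : (u : H) = p.fst) : inner ℂ (A† u) q.fst = inner ℂ p.snd q.snd := by
  refine formGraph_induction (P := fun q => inner ℂ (A† u) q.fst = inner ℂ p.snd q.snd)
    ?_ (fun y => ?_) hq
  · exact isClosed_eq (by fun_prop) (by fun_prop)
  · change inner ℂ (A† u) (y : H) = inner ℂ p.snd (D y)
    rw [inner_snd_of_mem_formGraph hA.symmetric hD hp, ← hu]
    exact LinearPMap.adjoint_isFormalAdjoint hA.dense u y

/-- The first components of `formGraph D`. -/
def formDomainSubmodule (D : A.domain →ₗ[ℂ] K) : Submodule ℂ H :=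
  (formGraph D).map (LinearMap.fst ℂ H K ∘ₗ (WithLp.linearEquiv 2 ℂ (H × K)).toLinearMap)

omit [CompleteSpace H] in
theorem mem_formDomainSubmodule {u : H} :
    u ∈ formDomainSubmodule D ↔ ∃ k, WithLp.toLp 2 (u, k) ∈ formGraph D := by
  constructor
  · rintro ⟨p, hp, rfl⟩
    exact ⟨p.snd, hp⟩
  · rintro ⟨k, hk⟩
    exact ⟨_, hk, rfl⟩

/-- The restriction of the adjoint to the domain of the closed form. -/
def friedrichs (D : A.domain →ₗ[ℂ] K) : H →ₗ.[ℂ] H :=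
  (A†).domRestrict (formDomainSubmodule D)

theorem mem_friedrichs_domain {u : H} :
    u ∈ (friedrichs D).domain ↔ u ∈ A†.domain ∧ u ∈ formDomainSubmodule D :=
  and_comm

theorem friedrichs_le_adjoint : friedrichs D ≤ A† := LinearPMap.domRestrict_le

theorem le_friedrichs (hA : IsNonnegSymmetric A) : A ≤ friedrichs D := by
  have h := hA.symmetric.le_adjoint hA.dense
  refine ⟨fun x hx => mem_friedrichs_domain.2
    ⟨h.1 hx, mem_formDomainSubmodule.2 ⟨_, toLp_mem_formGraph ⟨x, hx⟩⟩⟩, fun x y hxy => ?_⟩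
  rw [friedrichs_le_adjoint.2 (x := y) (y := ⟨y, friedrichs_le_adjoint.1 y.2⟩) rfl]
  exact h.2 hxy

theorem isFriedrichsExtension_friedrichs [CompleteSpace K] (hA : IsNonnegSymmetric A)
    (hD : ∀ x y : A.domain, inner ℂ (D x) (D y) = inner ℂ (A x) (y : H)) :
    IsFriedrichsExtension A (friedrichs D) where
  nonnegSymmetric := hA
  le_adjoint := friedrichs_le_adjoint
  mem_domain_iff u := by
    rw [mem_friedrichs_domain, mem_formDomain_iff hD, mem_formDomainSubmodule]

/-- Symmetry comes from the representation formula, and `friedrichs D + 1` is onto by Riesz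
representation in the Hilbert space `formGraph D`, whose norm is the form norm. -/
theorem isSelfAdjoint_friedrichs [CompleteSpace K] (hA : IsNonnegSymmetric A)
    (hD : ∀ x y : A.domain, inner ℂ (D x) (D y) = inner ℂ (A x) (y : H)) :
    IsSelfAdjoint (friedrichs D) := by
  have hle : friedrichs D ≤ A† := friedrichs_le_adjoint
  have happ : ∀ x : (friedrichs D).domain, friedrichs D x = A† ⟨x, hle.1 x.2⟩ := fun x =>
    hle.2 rfl
  refine isSelfAdjoint_of_add_one_surjective (hA.dense.mono (le_friedrichs hA).1)
    (fun x y => ?_) fun f => ?_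
  · obtain ⟨k, hk⟩ := mem_formDomainSubmodule.1 (mem_friedrichs_domain.1 x.2).2
    obtain ⟨l, hl⟩ := mem_formDomainSubmodule.1 (mem_friedrichs_domain.1 y.2).2
    have h1 := inner_adjoint_of_mem_formGraph hA hD hk hl ⟨x, hle.1 x.2⟩ rfl
    have h2 := inner_adjoint_of_mem_formGraph hA hD hl hk ⟨y, hle.1 y.2⟩ rfl
    rw [happ, happ, ← inner_conj_symm (x : H)]
    change inner ℂ _ (y : H) = inner ℂ k l at h1
    change inner ℂ _ (x : H) = inner ℂ l k at h2
    rw [h1, h2, inner_conj_symm]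
  · have : CompleteSpace (formGraph D) :=
      (Submodule.isClosed_topologicalClosure _).completeSpace_coe
    let e : formGraph D →L[ℂ] ℂ := (innerSL ℂ f) ∘L (ContinuousLinearMap.fst ℂ H K) ∘L
      (WithLp.prodContinuousLinearEquiv 2 ℂ H K).toContinuousLinearMap ∘L (formGraph D).subtypeL
    -- Weak solution of `A† v + v = f`, with `v = p.fst`: testing `p` against `(y, D y)` gives `⟨f -
    -- v, y⟩ = ⟨v, A y⟩`, that is, `v ∈ D(A†)` and `A† v = f - v`.
    obtain ⟨p, hp⟩ : ∃ p : formGraph D, ∀ q : formGraph D, inner ℂ p q = e q :=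
      ⟨(InnerProductSpace.toDual ℂ _).symm e, fun q => InnerProductSpace.toDual_symm_apply⟩
    have hw : ∀ y : A.domain, inner ℂ (f - (p : WithLp 2 (H × K)).fst) (y : H)
        = inner ℂ (p : WithLp 2 (H × K)).fst (A y) := by
      intro y
      have h1 := hp ⟨_, toLp_mem_formGraph y⟩
      have h2 := inner_snd_of_mem_formGraph hA.symmetric hD p.2 y
      rw [Submodule.coe_inner, WithLp.prod_inner_apply] at h1
      change inner ℂ (p : WithLp 2 (H × K)).fst (y : H)
        + inner ℂ (p : WithLp 2 (H × K)).snd (D y) = inner ℂ f (y : H) at h1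
      rw [inner_sub_left, ← h1, h2]
      ring
    have hmem : (p : WithLp 2 (H × K)).fst ∈ A†.domain :=
      LinearPMap.mem_adjoint_domain_of_exists _ ⟨_, hw⟩
    refine ⟨⟨(p : WithLp 2 (H × K)).fst,
      mem_friedrichs_domain.2 ⟨hmem, mem_formDomainSubmodule.2 ⟨_, p.2⟩⟩⟩, ?_⟩
    rw [happ, LinearPMap.adjoint_apply_eq hA.dense _ hw]
    exact sub_add_cancel _ _

/-- As a restriction of `A†` with domain in the form domain, `T` lies below the Friedrichs
extension. Adjoints reverse the order and both operators equal their adjoints, so they agree. -/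
theorem eq_friedrichs_of_domain_subset [CompleteSpace K] (hA : IsNonnegSymmetric A)
    (hD : ∀ x y : A.domain, inner ℂ (D x) (D y) = inner ℂ (A x) (y : H)) {T : H →ₗ.[ℂ] H}
    (hT : IsSelfAdjointExtension A T) (hdom : (T.domain : Set H) ⊆ formDomain A) :
    T = friedrichs D := by
  have hle := hT.le_adjoint hA.dense
  have hTF : T ≤ friedrichs D := by
    refine ⟨fun u hu => mem_friedrichs_domain.2 ⟨hle.1 hu, mem_formDomainSubmodule.2
      ((mem_formDomain_iff hD u).1 (hdom hu))⟩, fun x y hxy => ?_⟩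
    rw [friedrichs_le_adjoint.2 (x := y) (y := ⟨y, friedrichs_le_adjoint.1 y.2⟩) rfl]
    exact hle.2 hxy
  have hF := isSelfAdjoint_friedrichs hA hD
  refine le_antisymm hTF ?_
  rw [← LinearPMap.isSelfAdjoint_def.1 hT.2]
  exact IsSelfAdjointExtension.le_adjoint hT.2.dense_domain ⟨hTF, hF⟩

/-- If a nonnegative symmetric operator is essentially self-adjoint then the domain of its adjoint
is contained in the domain of the closed form. -/
theorem IsEssentiallySelfAdjoint.adjoint_domain_subset (hA : IsNonnegSymmetric A)
    (h : IsEssentiallySelfAdjoint A) : (A†.domain : Set H) ⊆ formDomain A := by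
  have hcl : A.IsClosable := LinearPMap.isClosable_iff_exists_closed_extension.2
    ⟨A†, LinearPMap.adjoint_isClosed hA.dense, hA.symmetric.le_adjoint hA.dense⟩
  intro u hu
  have hsa := LinearPMap.isSelfAdjoint_def.1 h
  have hfa := LinearPMap.adjoint_isFormalAdjoint hA.dense
  -- The closure equals its own adjoint, so it is enough that `A†` is a formal adjoint of the
  -- closure. For `A` itself this is the definition, and it extends to the closed graph by
  -- continuity.
  have hle : A† ≤ A.closure := by
    rw [← hsa]
    refine LinearPMap.IsFormalAdjoint.le_adjoint h.dense_domain fun x y => ?_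
    have hx : ((x : H), A.closure x) ∈ A.closure.graph := A.closure.mem_graph x
    rw [← hcl.graph_closure_eq_closure_graph, ← SetLike.mem_coe,
      Submodule.topologicalClosure_coe] at hx
    have hc : IsClosed {q : H × H | inner ℂ q.2 (y : H) = inner ℂ q.1 (A† y)} :=
      isClosed_eq (by fun_prop) (by fun_prop)
    refine closure_minimal ?_ hc hx
    intro q hq
    obtain ⟨z, hz1, hz2⟩ := (LinearPMap.mem_graph_iff A).1 hq
    change inner ℂ q.2 (y : H) = inner ℂ q.1 (A† y)
    rw [← hz1, ← hz2, ← hfa.symm z y]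
  have hu' : ((u : H), A.closure ⟨u, hle.1 hu⟩) ∈ A.closure.graph :=
    A.closure.mem_graph ⟨u, hle.1 hu⟩
  rw [← hcl.graph_closure_eq_closure_graph, ← SetLike.mem_coe,
    Submodule.topologicalClosure_coe, mem_closure_iff_seq_limit] at hu'
  obtain ⟨s, hs, hlim⟩ := hu'
  choose x hx using fun m => (LinearPMap.mem_graph_iff A).1 (hs m)
  rw [nhds_prod_eq, tendsto_prod_iff'] at hlim
  have h1 : Tendsto (fun m => (x m : H)) atTop (𝓝 u) := hlim.1.congr fun m => (hx m).1.symm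
  have h2 : Tendsto (fun m => A (x m)) atTop (𝓝 (A.closure ⟨u, hle.1 hu⟩)) :=
    hlim.2.congr fun m => (hx m).2.symm
  -- Convergence in the graph norm of `A` is stronger than convergence in the form: both arguments
  -- of `⟨A (x_k - x_l), x_k - x_l⟩` tend to `0`.
  refine ⟨x, h1, ?_⟩
  have hsub : ∀ {y : ℕ → H} {l : H}, Tendsto y atTop (𝓝 l) →
      Tendsto (fun kl : ℕ × ℕ => y kl.1 - y kl.2) atTop (𝓝 0) := fun {y l} hy => by
    rw [← prod_atTop_atTop_eq]
    simpa using (hy.comp tendsto_fst).sub (hy.comp tendsto_snd)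
  have h3 := (hsub h2).inner (𝕜 := ℂ) (hsub h1)
  rw [inner_zero_left] at h3
  have h4 := (Complex.continuous_re.tendsto _).comp h3
  refine (Complex.zero_re ▸ h4).congr fun kl => ?_
  simp only [Function.comp_apply, LinearPMap.map_sub, Submodule.coe_sub]

end formGraph

end UnboundedOp

/-! ### Mollification in `L²` on a finite-dimensional space -/

open scoped Convolution

section Mollifier

theorem eLpNorm_two_sq {α E : Type*} [MeasurableSpace α] [NormedAddCommGroup E] (f : α → E)
    (μ : Measure α) : eLpNorm f 2 μ ^ 2 = ∫⁻ x, ‖f x‖ₑ ^ 2 ∂μ := by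
  simpa using eLpNorm_nnreal_pow_eq_lintegral (μ := μ) (f := f) (p := 2) (by norm_num)

theorem sq_lintegral_le_lintegral_sq {α : Type*} [MeasurableSpace α] {ν : Measure α}
    [IsProbabilityMeasure ν] {h : α → ℝ≥0∞} (hh : AEMeasurable h ν) :
    (∫⁻ x, h x ∂ν) ^ 2 ≤ ∫⁻ x, h x ^ 2 ∂ν := by
  have h1 := ENNReal.lintegral_mul_le_Lp_mul_Lq ν Real.HolderConjugate.two_two hh
    (aemeasurable_const (b := (1 : ℝ≥0∞)))
  have h2 : ∫⁻ x, h x ∂ν ≤ (∫⁻ x, h x ^ 2 ∂ν) ^ (1 / 2 : ℝ) := by simpa using h1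
  calc (∫⁻ x, h x ∂ν) ^ 2 ≤ ((∫⁻ x, h x ^ 2 ∂ν) ^ (1 / 2 : ℝ)) ^ 2 := by gcongr
    _ = ∫⁻ x, h x ^ 2 ∂ν := by
      rw [← ENNReal.rpow_natCast, ← ENNReal.rpow_mul]
      norm_num

variable {G : Type*} [NormedAddCommGroup G] [NormedSpace ℝ G] [FiniteDimensional ℝ G]
  [MeasurableSpace G] [BorelSpace G] {μ : Measure G} [μ.IsAddHaarMeasure]

/-- Young's inequality for the convolution with a normalized kernel. -/
theorem eLpNorm_convolution_le {ρ : G → ℝ} (hρ : Continuous ρ) (h1 : ∫⁻ x, ‖ρ x‖ₑ ∂μ = 1)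
    {f : G → ℂ} (hf : AEStronglyMeasurable f μ) :
    eLpNorm (ρ ⋆[ContinuousLinearMap.lsmul ℝ ℝ, μ] f) 2 μ ≤ eLpNorm f 2 μ := by
  -- A measurable representative makes `(x, t) ↦ g (x - t)` jointly measurable, as Tonelli's theorem
  -- below requires.
  rw [convolution_congr _ (ae_eq_refl ρ) hf.ae_eq_mk, eLpNorm_congr_ae hf.ae_eq_mk]
  set g := hf.mk f
  have hg : Measurable g := hf.stronglyMeasurable_mk.measurable
  have hρm : Measurable fun x => ‖ρ x‖ₑ := hρ.measurable.enorm
  -- With respect to this probability measure the convolution is dominated by an average of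
  -- translates of `|g|`; its square is at most the average of the squares, and translation
  -- invariance of `μ` finishes.
  set ν : Measure G := μ.withDensity fun x => ‖ρ x‖ₑ
  have : IsProbabilityMeasure ν := ⟨by rw [withDensity_apply _ .univ, Measure.restrict_univ, h1]⟩
  have hpt : ∀ x, ‖(ρ ⋆[ContinuousLinearMap.lsmul ℝ ℝ, μ] g) x‖ₑ ^ 2
      ≤ ∫⁻ t, ‖g (x - t)‖ₑ ^ 2 ∂ν := fun x => by
    have hm : Measurable fun t => ‖g (x - t)‖ₑ := (hg.comp (by fun_prop)).enorm
    refine le_trans ?_ (sq_lintegral_le_lintegral_sq hm.aemeasurable)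
    gcongr
    rw [convolution_def, lintegral_withDensity_eq_lintegral_mul _ hρm hm]
    refine (enorm_integral_le_lintegral_enorm _).trans (le_of_eq ?_)
    exact lintegral_congr fun t => enorm_smul (ρ t) (g (x - t))
  have hsq : eLpNorm (ρ ⋆[ContinuousLinearMap.lsmul ℝ ℝ, μ] g) 2 μ ^ 2 ≤ eLpNorm g 2 μ ^ 2 := by
    rw [eLpNorm_two_sq, eLpNorm_two_sq]
    calc ∫⁻ x, ‖(ρ ⋆[ContinuousLinearMap.lsmul ℝ ℝ, μ] g) x‖ₑ ^ 2 ∂μ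
        ≤ ∫⁻ x, ∫⁻ t, ‖g (x - t)‖ₑ ^ 2 ∂ν ∂μ := lintegral_mono hpt
      _ = ∫⁻ t, ∫⁻ x, ‖g (x - t)‖ₑ ^ 2 ∂μ ∂ν := by
        refine lintegral_lintegral_swap (Measurable.aemeasurable ?_)
        exact ((hg.comp (by fun_prop : Measurable fun p : G × G => p.1 - p.2)).enorm.pow_const 2)
      _ = ∫⁻ x, ‖g x‖ₑ ^ 2 ∂μ := by
        have : ∀ t, ∫⁻ x, ‖g (x - t)‖ₑ ^ 2 ∂μ = ∫⁻ x, ‖g x‖ₑ ^ 2 ∂μ := fun t =>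
          lintegral_sub_right_eq_self (fun x => ‖g x‖ₑ ^ 2) t
        simp [this]
  exact (ENNReal.pow_le_pow_left_iff two_ne_zero).1 hsq

/-- A sequence of bump functions shrinking to the origin. -/
def shrinkingBump (G : Type*) [NormedAddCommGroup G] (m : ℕ) : ContDiffBump (0 : G) where
  rIn := 1 / (2 * ((m : ℝ) + 1))
  rOut := 1 / ((m : ℝ) + 1)
  rIn_pos := by positivity
  rIn_lt_rOut := by
    apply one_div_lt_one_div_of_lt <;> linarith [Nat.cast_nonneg (α := ℝ) m]

theorem tendsto_shrinkingBump_rOut (G : Type*) [NormedAddCommGroup G] :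
    Tendsto (fun m => (shrinkingBump G m).rOut) atTop (𝓝 0) :=
  tendsto_one_div_add_atTop_nhds_zero_nat

variable (μ) in
/-- The mollification of `f`. -/
def mollify (f : G → ℂ) (m : ℕ) : G → ℂ :=
  (shrinkingBump G m).normed μ ⋆[ContinuousLinearMap.lsmul ℝ ℝ, μ] f

theorem eLpNorm_mollify_le {f : G → ℂ} (hf : AEStronglyMeasurable f μ) (m : ℕ) :
    eLpNorm (mollify μ f m) 2 μ ≤ eLpNorm f 2 μ := by
  refine eLpNorm_convolution_le (shrinkingBump G m).continuous_normed ?_ hf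
  have h := ofReal_integral_eq_lintegral_ofReal (shrinkingBump G m).integrable_normed
    (.of_forall fun x => (shrinkingBump G m).nonneg_normed (μ := μ) x)
  rw [(shrinkingBump G m).integral_normed, ENNReal.ofReal_one] at h
  rw [h]
  refine lintegral_congr fun x => ?_
  rw [Real.enorm_eq_ofReal ((shrinkingBump G m).nonneg_normed x)]

theorem contDiff_mollify {f : G → ℂ} (hf : LocallyIntegrable f μ) (m : ℕ) :
    ContDiff ℝ ∞ (mollify μ f m) :=
  (shrinkingBump G m).hasCompactSupport_normed.contDiff_convolution_left _
    (shrinkingBump G m).contDiff_normed hf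

theorem support_mollify_subset (f : G → ℂ) (m : ℕ) :
    Function.support (mollify μ f m) ⊆ Metric.thickening (shrinkingBump G m).rOut
      (Function.support f) := by
  refine (support_convolution_subset _).trans ?_
  rintro _ ⟨y, hy, x, hx, rfl⟩
  rw [ContDiffBump.support_normed_eq] at hy
  refine Metric.mem_thickening_iff.2 ⟨x, hx, ?_⟩
  simpa using hy

theorem mollify_sub {f g : G → ℂ} (hf : LocallyIntegrable f μ) (hg : LocallyIntegrable g μ)
    (m : ℕ) : mollify μ (f - g) m = mollify μ f m - mollify μ g m := by
  have hc : ∀ {h : G → ℂ}, LocallyIntegrable h μ → ConvolutionExists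
      ((shrinkingBump G m).normed μ) h (ContinuousLinearMap.lsmul ℝ ℝ) μ := fun hh =>
    (shrinkingBump G m).hasCompactSupport_normed.convolutionExists_left _
      (shrinkingBump G m).continuous_normed hh
  have hfg : LocallyIntegrable (f - g) μ := hf.sub hg
  have := (hc hfg).distrib_add (hc hg)
  rw [sub_add_cancel] at this
  exact eq_sub_of_add_eq this.symm

/-- Uniform continuity makes the difference uniformly small, and everything is supported in one
compact set of finite measure, the closed 1-neighbourhood of the support of `g`. -/
theorem tendsto_eLpNorm_mollify_sub_of_continuous {g : G → ℂ} (hg : Continuous g)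
    (hc : HasCompactSupport g) :
    Tendsto (fun m => eLpNorm (mollify μ g m - g) 2 μ) atTop (𝓝 0) := by
  set S := Metric.cthickening 1 (tsupport g)
  have hS : IsCompact S := hc.isCompact.cthickening
  have hr : ∀ m, (shrinkingBump G m).rOut ≤ 1 := fun m => by
    change 1 / ((m : ℝ) + 1) ≤ 1
    exact div_le_one_of_le₀ (by linarith [Nat.cast_nonneg (α := ℝ) m]) (by positivity)
  have hbd : ∀ c > 0, ∀ᶠ m in atTop,
      eLpNorm (mollify μ g m - g) 2 μ ≤ ENNReal.ofReal c * μ S ^ (1 / 2 : ℝ) := by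
    intro c hcpos
    obtain ⟨δ, hδ, hu⟩ := Metric.uniformContinuous_iff.1
      (hg.uniformContinuous_of_tendsto_cocompact hc.is_zero_at_infty) c hcpos
    filter_upwards [(tendsto_order.1 (tendsto_shrinkingBump_rOut G)).2 δ hδ] with m hm
    have := eLpNorm_sub_le_of_dist_bdd μ (p := 2) (by norm_num) hS.measurableSet hcpos.le
      (f := mollify μ g m) (g := g) (s := S) (fun x => ?_) ?_ ?_
    · simpa using this
    · refine ContDiffBump.dist_normed_convolution_le hg.aestronglyMeasurable fun y hy => ?_
      exact (hu ((Metric.mem_ball.1 hy).trans hm)).le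
    · refine (support_mollify_subset g m).trans ?_
      refine (Metric.thickening_mono (hr m) _).trans ?_
      refine (Metric.thickening_subset_cthickening _ _).trans ?_
      exact Metric.cthickening_subset_of_subset _ (subset_tsupport g)
    · exact (subset_tsupport g).trans (Metric.self_subset_cthickening _)
  have hfin : μ S ^ (1 / 2 : ℝ) ≠ ⊤ :=
    ENNReal.rpow_ne_top_of_nonneg (by norm_num) hS.measure_lt_top.ne
  refine ENNReal.tendsto_nhds_zero.2 fun ε hε => ?_
  have ht : Tendsto (fun c : ℝ => ENNReal.ofReal c * μ S ^ (1 / 2 : ℝ)) (𝓝[>] 0) (𝓝 0) := by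
    have := ENNReal.Tendsto.mul_const (b := μ S ^ (1 / 2 : ℝ))
      ((ENNReal.continuous_ofReal.tendsto 0).mono_left (nhdsWithin_le_nhds (s := Set.Ioi 0)))
      (Or.inr hfin)
    simpa using this
  obtain ⟨c, hcε, hc0⟩ := ((ht.eventually (ge_mem_nhds hε)).and self_mem_nhdsWithin).exists
  filter_upwards [hbd c hc0] with m hm using hm.trans hcε

/-- Mollifications converge in `L²`. -/
theorem tendsto_eLpNorm_mollify_sub {f : G → ℂ} (hf : MemLp f 2 μ) :
    Tendsto (fun m => eLpNorm (mollify μ f m - f) 2 μ) atTop (𝓝 0) := by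
  have hfl := hf.locallyIntegrable (by norm_num)
  refine ENNReal.tendsto_nhds_zero.2 fun ε hε => ?_
  have hε3 : ε / 3 ≠ 0 := (ENNReal.div_pos hε.ne' (by norm_num)).ne'
  obtain ⟨g, hg1, hg2, hg3, hg4⟩ := hf.exists_hasCompactSupport_eLpNorm_sub_le (by norm_num) hε3
  have hgl := hg3.locallyIntegrable (μ := μ)
  filter_upwards [ENNReal.tendsto_nhds_zero.1
    (tendsto_eLpNorm_mollify_sub_of_continuous (μ := μ) hg3 hg1) (ε / 3) (pos_iff_ne_zero.2 hε3)]
    with m hm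
  -- Three-epsilon argument: Young's inequality bounds the first term by the `L²` distance from `f`
  -- to `g`, uniformly in `m`.
  have e : mollify μ f m - f = mollify μ (f - g) m + (mollify μ g m - g) + (g - f) := by
    rw [mollify_sub hfl hgl]
    abel
  have m1 : ∀ {h : G → ℂ}, LocallyIntegrable h μ → AEStronglyMeasurable (mollify μ h m) μ :=
    fun hh => (contDiff_mollify hh m).continuous.aestronglyMeasurable
  have hfa := hf.aestronglyMeasurable
  have hga := hg4.aestronglyMeasurable
  rw [e]
  calc _ ≤ ε / 3 + ε / 3 + ε / 3 := by
        refine (eLpNorm_add_le (((m1 (hfl.sub hgl))).add ((m1 hgl).sub hga)) (hga.sub hfa)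
          (by norm_num)).trans (add_le_add ((eLpNorm_add_le (m1 (hfl.sub hgl))
          ((m1 hgl).sub hga) (by norm_num)).trans (add_le_add ?_ hm)) ?_)
        · exact (eLpNorm_mollify_le (hfa.sub hga) m).trans hg2
        · rw [eLpNorm_sub_comm]
          exact hg2
    _ = ε := ENNReal.add_thirds ε

/-- If `g` is the weak derivative of `f` in the direction `v` on the whole space, mollification
commutes with the derivative. -/
theorem fderiv_mollify {f g : G → ℂ} (hf : LocallyIntegrable f μ) (v : G)
    (hfg : ∀ ψ : G → ℝ, ContDiff ℝ ∞ ψ → HasCompactSupport ψ →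
      ∫ y, fderiv ℝ ψ y v • f y ∂μ = -∫ y, ψ y • g y ∂μ) (m : ℕ) (x : G) :
    fderiv ℝ (mollify μ f m) x v = mollify μ g m x := by
  set ρ := (shrinkingBump G m).normed μ
  have hρ : ContDiff ℝ ∞ ρ := (shrinkingBump G m).contDiff_normed
  have hρc : HasCompactSupport ρ := (shrinkingBump G m).hasCompactSupport_normed
  have h1 := hρc.hasFDerivAt_convolution_left (ContinuousLinearMap.lsmul ℝ ℝ)
    (hρ.of_le (by simp)) hf x
  have hex : ConvolutionExistsAt (fderiv ℝ ρ) f x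
      ((ContinuousLinearMap.lsmul ℝ ℝ : ℝ →L[ℝ] ℂ →L[ℝ] ℂ).precompL G) μ :=
    (hρc.fderiv ℝ).convolutionExists_left _ (hρ.continuous_fderiv (by simp)) hf x
  rw [mollify, h1.fderiv, convolution_def, ContinuousLinearMap.integral_apply hex]
  -- The test function is the reflected kernel centred at `x`; the sign from the reflection cancels
  -- the sign in the definition of the weak derivative.
  have hψ : ContDiff ℝ ∞ fun y => ρ (x - y) := hρ.comp (contDiff_const.sub contDiff_id)
  have hψc : HasCompactSupport fun y => ρ (x - y) :=
    hρc.comp_homeomorph (Homeomorph.subLeft x)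
  have hd : ∀ y, fderiv ℝ (fun y => ρ (x - y)) y v = - fderiv ℝ ρ (x - y) v := fun y => by
    have := ((hρ.differentiable (by simp) (x - y)).hasFDerivAt).comp y
      ((hasFDerivAt_id y).const_sub x)
    have h' := DFunLike.congr_fun this.fderiv v
    refine Eq.trans ?_ (h'.trans (by simp))
    rfl
  have h2 := hfg _ hψ hψc
  simp only [hd, neg_smul, integral_neg, neg_inj] at h2
  have e1 := integral_sub_left_eq_self (fun t => fderiv ℝ ρ t v • f (x - t)) μ x
  have e2 := integral_sub_left_eq_self (fun t => ρ t • g (x - t)) μ x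
  simp only [sub_sub_cancel] at e1 e2
  exact e1.symm.trans (h2.trans e2)

end Mollifier

/-! ### The weights and the two measures on the half space -/

namespace Taub

variable {n : ℕ}

instance : Measure.IsAddHaarMeasure (volume : Measure (Pt n)) :=
  Measure.prod.instIsAddHaarMeasure (volume : Measure (EuclideanSpace ℝ (Fin n)))
    (volume : Measure ℝ)

/-- The coordinate directions: `none` is the direction of `z`, `some i` the direction of `x^i`. -/
def dir (o : Option (Fin n)) : Pt n := o.elim ez ex

/-- The square roots `z^(1/2)` and `z^(-1/(2n))` of the coefficients of the form `b`. -/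
def wt (o : Option (Fin n)) (z : ℝ) : ℝ := z ^ (o.elim (1 / 2) fun _ => -(1 / (2 * n)) : ℝ)

theorem wt_pos (o : Option (Fin n)) {z : ℝ} (hz : 0 < z) : 0 < wt o z := Real.rpow_pos_of_pos hz _

theorem wt_none_sq {z : ℝ} (hz : 0 < z) : wt (none : Option (Fin n)) z ^ 2 = z := by
  rw [wt, ← Real.rpow_natCast, ← Real.rpow_mul hz.le]
  norm_num

theorem wt_some_sq (i : Fin n) {z : ℝ} (hz : 0 < z) : wt (some i) z ^ 2 = z ^ (-(1 / (n : ℝ))) := by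
  rw [wt, ← Real.rpow_natCast, ← Real.rpow_mul hz.le]
  congr 1
  simp only [Option.elim]
  push_cast
  ring

theorem continuousOn_wt (o : Option (Fin n)) :
    ContinuousOn (fun p : Pt n => wt o p.2) (Om n) := fun _ hp =>
  (continuousAt_snd.rpow_const (Or.inl (ne_of_gt hp))).continuousWithinAt

theorem contDiffOn_wt (o : Option (Fin n)) :
    ContDiffOn ℝ ∞ (fun p : Pt n => wt o p.2) (Om n) := fun _ hp =>
  (contDiffAt_snd.rpow_const_of_ne (ne_of_gt hp)).contDiffWithinAt

theorem measurable_wt (o : Option (Fin n)) : Measurable fun p : Pt n => wt o p.2 :=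
  measurable_snd.pow_const _

/-- Lebesgue measure on `Ω`. -/
abbrev muO (n : ℕ) : Measure (Pt n) := volume.restrict (Om n : Set (Pt n))

theorem measurableSet_Om : MeasurableSet (Om n : Set (Pt n)) := (Om n).isOpen.measurableSet

theorem ae_muO_mem : ∀ᵐ p ∂muO n, p ∈ (Om n : Set (Pt n)) := ae_restrict_mem measurableSet_Om

theorem zMeasure_absolutelyContinuous : zMeasure n ≪ muO n := withDensity_absolutelyContinuous _ _

/-- The density `z` is positive on `Ω`, so `z dμ` and Lebesgue measure on `Ω` have the same null
sets and almost-everywhere statements pass freely between `H` and `L²(Ω, dμ)`. -/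
theorem absolutelyContinuous_zMeasure : muO n ≪ zMeasure n := by
  refine withDensity_absolutelyContinuous' (by fun_prop) ?_
  filter_upwards [ae_muO_mem] with p hp
  exact (ENNReal.ofReal_pos.2 hp).ne'

theorem ae_zMeasure : ae (zMeasure n) = ae (muO n) :=
  le_antisymm zMeasure_absolutelyContinuous.ae_le absolutelyContinuous_zMeasure.ae_le

theorem integral_zMeasure (f : Pt n → ℂ) :
    ∫ p, f p ∂zMeasure n = ∫ p, (p.2 : ℂ) * f p ∂muO n := by
  rw [zMeasure, integral_withDensity_eq_integral_toReal_smul (by fun_prop) (by simp)]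
  refine integral_congr_ae ?_
  filter_upwards [ae_muO_mem] with p hp
  rw [ENNReal.toReal_ofReal (le_of_lt hp)]
  simp

theorem eLpNorm_zMeasure_sq {f : Pt n → ℂ} (hf : AEStronglyMeasurable f (muO n)) :
    eLpNorm f 2 (zMeasure n) ^ 2 = ∫⁻ p, ENNReal.ofReal p.2 * ‖f p‖ₑ ^ 2 ∂muO n := by
  rw [eLpNorm_two_sq, zMeasure, lintegral_withDensity_eq_lintegral_mul₀ (by fun_prop)
    (hf.enorm.pow_const 2)]
  rfl

theorem ofReal_wt_none (p : Pt n) (hp : p ∈ (Om n : Set (Pt n))) (c : ℂ) :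
    ENNReal.ofReal p.2 * ‖c‖ₑ ^ 2 = ‖(wt (none : Option (Fin n)) p.2 : ℂ) * c‖ₑ ^ 2 := by
  rw [enorm_mul, mul_pow, ← ofReal_norm (wt _ _ : ℂ), Complex.norm_real,
    Real.norm_of_nonneg (wt_pos _ hp).le, ← ENNReal.ofReal_pow (wt_pos _ hp).le, wt_none_sq hp]

theorem ofReal_wt_some (i : Fin n) (p : Pt n) (hp : p ∈ (Om n : Set (Pt n))) (c : ℂ) :
    ENNReal.ofReal (p.2 ^ (-(1 / (n : ℝ)))) * ‖c‖ₑ ^ 2 = ‖(wt (some i) p.2 : ℂ) * c‖ₑ ^ 2 := by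
  rw [enorm_mul, mul_pow, ← ofReal_norm (wt _ _ : ℂ), Complex.norm_real,
    Real.norm_of_nonneg (wt_pos _ hp).le, ← ENNReal.ofReal_pow (wt_pos _ hp).le, wt_some_sq i hp]

/-- A function is in `L²(Ω, z dμ)` iff its product with `z^(1/2)` is in `L²(Ω, dμ)`. -/
theorem memLp_zMeasure_iff {f : Pt n → ℂ} :
    MemLp f 2 (zMeasure n) ↔
      MemLp (fun p => (wt (none : Option (Fin n)) p.2 : ℂ) * f p) 2 (muO n) := by
  have hm : AEStronglyMeasurable f (zMeasure n) ↔
      AEStronglyMeasurable (fun p => (wt (none : Option (Fin n)) p.2 : ℂ) * f p) (muO n) := by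
    constructor
    · intro h
      exact (Complex.measurable_ofReal.comp (measurable_wt none)).aestronglyMeasurable.mul
        (h.mono_ac absolutelyContinuous_zMeasure)
    · intro h
      refine AEStronglyMeasurable.mono_ac zMeasure_absolutelyContinuous ?_
      refine (((Complex.measurable_ofReal.comp
        (measurable_wt none)).inv.aestronglyMeasurable).mul h).congr ?_
      filter_upwards [ae_muO_mem] with p hp
      have : (wt (none : Option (Fin n)) p.2 : ℂ) ≠ 0 := by exact_mod_cast (wt_pos _ hp).ne'
      simp only [Pi.mul_apply, Pi.inv_apply, Function.comp_apply]
      field_simp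
  have hp2 : ∀ x : ℝ≥0∞, x < ⊤ ↔ x ^ 2 < ⊤ := fun x => by simp [lt_top_iff_ne_top]
  constructor
  · intro h
    refine ⟨hm.1 h.1, ?_⟩
    have h2 := (hp2 _).1 h.2
    rw [eLpNorm_zMeasure_sq (h.1.mono_ac absolutelyContinuous_zMeasure)] at h2
    rw [hp2, eLpNorm_two_sq]
    refine (lintegral_congr_ae ?_).trans_lt h2
    filter_upwards [ae_muO_mem] with p hp
    exact (ofReal_wt_none p hp _).symm
  · intro h
    have h1 := hm.2 h.1
    refine ⟨h1, ?_⟩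
    have h2 := (hp2 _).1 h.2
    rw [eLpNorm_two_sq] at h2
    rw [hp2, eLpNorm_zMeasure_sq (h1.mono_ac absolutelyContinuous_zMeasure)]
    refine (lintegral_congr_ae ?_).trans_lt h2
    filter_upwards [ae_muO_mem] with p hp
    exact ofReal_wt_none p hp _

/-! ### Products with test functions, integration by parts -/

/-- The test function vanishes near every point outside `Ω`, so the behaviour of `F` there is
irrelevant. This allows factors singular at `z = 0`, such as `z⁻¹` and the negative powers of the
weights. -/
theorem continuous_mul_of_tsupport_subset {F ψ : Pt n → ℂ} (hF : ContinuousOn F (Om n))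
    (hψ : Continuous ψ) (hs : tsupport ψ ⊆ Om n) : Continuous fun p => F p * ψ p :=
  (hF.mul hψ.continuousOn).continuous_of_tsupport_subset (Om n).isOpen
    ((tsupport_mul_subset_right (f := F)).trans hs)

theorem contDiff_mul_of_tsupport_subset {F ψ : Pt n → ℂ} (hF : ContDiffOn ℝ ∞ F (Om n))
    (hψ : ContDiff ℝ ∞ ψ) (hs : tsupport ψ ⊆ Om n) : ContDiff ℝ ∞ fun p => F p * ψ p := by
  rw [contDiff_iff_contDiffAt]
  intro p
  by_cases hp : p ∈ tsupport ψ
  · exact (hF.contDiffAt ((Om n).isOpen.mem_nhds (hs hp))).mul hψ.contDiffAt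
  · refine (contDiffAt_const (c := 0)).congr_of_eventuallyEq ?_
    filter_upwards [(isClosed_tsupport ψ).isOpen_compl.mem_nhds hp] with q hq
    rw [image_eq_zero_of_notMem_tsupport hq, mul_zero]

theorem memLp_mul_of_tsupport_subset {F ψ : Pt n → ℂ} (hF : ContinuousOn F (Om n))
    (hψ : Continuous ψ) (hc : HasCompactSupport ψ) (hs : tsupport ψ ⊆ Om n) (μ : Measure (Pt n))
    [IsFiniteMeasureOnCompacts μ] : MemLp (fun p => F p * ψ p) 2 μ :=
  (continuous_mul_of_tsupport_subset hF hψ hs).memLp_of_hasCompactSupport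
    (hc.mul_left (f := F))

theorem continuousOn_ofReal_wt (o : Option (Fin n)) :
    ContinuousOn (fun p : Pt n => (wt o p.2 : ℂ)) (Om n) :=
  Complex.continuous_ofReal.comp_continuousOn (continuousOn_wt o)

theorem hasCompactSupport_pd (v : Pt n) {f : Pt n → ℂ} (hf : HasCompactSupport f) :
    HasCompactSupport (pd v f) :=
  hf.mono' ((subset_tsupport _).trans (tsupport_pd_subset v f))

/-- The partial derivative of a test function, as a test function. -/
def pdTest (v : Pt n) (φ : 𝓓(Om n, ℂ)) : 𝓓(Om n, ℂ) :=
  ⟨pd v φ, pd_contDiff v φ.contDiff, hasCompactSupport_pd v φ.hasCompactSupport,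
    (tsupport_pd_subset v φ).trans φ.tsupport_subset⟩

@[simp] theorem coe_pdTest (v : Pt n) (φ : 𝓓(Om n, ℂ)) : (pdTest v φ : Pt n → ℂ) = pd v φ := rfl

/-- The product of a function smooth on `Ω` and a test function, as a test function. -/
def mulTest (F : Pt n → ℂ) (hF : ContDiffOn ℝ ∞ F (Om n)) (φ : 𝓓(Om n, ℂ)) : 𝓓(Om n, ℂ) :=
  ⟨fun p => F p * φ p, contDiff_mul_of_tsupport_subset hF φ.contDiff φ.tsupport_subset,
    φ.hasCompactSupport.mul_left, tsupport_mul_subset_right.trans φ.tsupport_subset⟩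

@[simp] theorem coe_mulTest (F : Pt n → ℂ) (hF : ContDiffOn ℝ ∞ F (Om n)) (φ : 𝓓(Om n, ℂ)) :
    (mulTest F hF φ : Pt n → ℂ) = fun p => F p * φ p := rfl

/-- The complex conjugate of a test function. -/
def conjTest (φ : 𝓓(Om n, ℂ)) : 𝓓(Om n, ℂ) :=
  ⟨fun p => conj (φ p), Complex.conjCLE.contDiff.comp φ.contDiff,
    φ.hasCompactSupport.comp_left (map_zero _),
    (tsupport_comp_subset (map_zero _) _).trans φ.tsupport_subset⟩

@[simp] theorem coe_conjTest (φ : 𝓓(Om n, ℂ)) :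
    (conjTest φ : Pt n → ℂ) = fun p => conj (φ p) := rfl

theorem pd_conj (v : Pt n) (f : Pt n → ℂ) (p : Pt n) :
    pd v (fun q => conj (f q)) p = conj (pd v f p) := by
  have := Complex.conjCLE.comp_fderiv (f := f) (x := p)
  exact DFunLike.congr_fun this v

theorem pd_mul (v : Pt n) {f g : Pt n → ℂ} {p : Pt n} (hf : DifferentiableAt ℝ f p)
    (hg : DifferentiableAt ℝ g p) :
    pd v (fun q => f q * g q) p = f p * pd v g p + pd v f p * g p := by
  have := fderiv_mul hf hg
  rw [pd, show (fun q => f q * g q) = f * g from rfl, this]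
  simp [pd, mul_comm]

theorem continuousOn_pd (v : Pt n) {f : Pt n → ℂ} (hf : ContDiffOn ℝ ∞ f (Om n)) :
    ContinuousOn (pd v f) (Om n) :=
  (hf.continuousOn_fderiv_of_isOpen (Om n).isOpen (by simp)).clm_apply continuousOn_const

theorem contDiffOn_pd (v : Pt n) {f : Pt n → ℂ} (hf : ContDiffOn ℝ ∞ f (Om n)) :
    ContDiffOn ℝ ∞ (pd v f) (Om n) :=
  (hf.fderiv_of_isOpen (Om n).isOpen (m := ∞) (by simp)).clm_apply contDiffOn_const

/-- Integration by parts against a test function. -/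
theorem integral_mul_pd (v : Pt n) {f : Pt n → ℂ} (hf : ContDiffOn ℝ ∞ f (Om n))
    (φ : 𝓓(Om n, ℂ)) : ∫ p, f p * pd v φ p ∂muO n = -∫ p, pd v f p * φ p ∂muO n := by
  have hz : ∀ p ∉ (Om n : Set (Pt n)), φ p = 0 := fun p hp =>
    image_eq_zero_of_notMem_tsupport fun h => hp (φ.tsupport_subset h)
  have hz' : ∀ p ∉ (Om n : Set (Pt n)), pd v φ p = 0 := fun p hp =>
    pd_eq_zero v fun h => hp (φ.tsupport_subset h)
  -- Both integrands vanish off `Ω`, so the integration by parts can be done on the whole space;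
  -- differentiability of `f` is needed only on the support of `φ`.
  rw [setIntegral_eq_integral_of_forall_compl_eq_zero (fun p hp => by simp [hz' p hp]),
    setIntegral_eq_integral_of_forall_compl_eq_zero (fun p hp => by simp [hz p hp])]
  have hint : ∀ {F : Pt n → ℂ} (ψ : 𝓓(Om n, ℂ)), ContinuousOn F (Om n) →
      Integrable fun p => F p * ψ p := fun {F} ψ hF =>
    (continuous_mul_of_tsupport_subset hF ψ.continuous
      ψ.tsupport_subset).integrable_of_hasCompactSupport ψ.hasCompactSupport.mul_left
  refine integral_mul_fderiv_eq_neg_fderiv_mul_of_integrable (hint φ (continuousOn_pd v hf))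
    (hint (pdTest v φ) hf.continuousOn) (hint φ hf.continuousOn) (fun p hp => ?_)
    fun p _ => φ.contDiff.differentiable (by simp) p
  exact (hf.contDiffAt ((Om n).isOpen.mem_nhds (φ.tsupport_subset hp))).differentiableAt (by simp)

theorem contDiffOn_flux (o : Option (Fin n)) {f : Pt n → ℂ} (hf : ContDiffOn ℝ ∞ f (Om n)) :
    ContDiffOn ℝ ∞ (fun q => ((wt o q.2 ^ 2 : ℝ) : ℂ) * pd (dir o) f q) (Om n) :=
  (Complex.ofRealCLM.contDiff.comp_contDiffOn ((contDiffOn_wt o).pow 2)).mul (contDiffOn_pd _ hf)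

theorem pd_congr_of_eqOn (v : Pt n) {f g : Pt n → ℂ} (h : Set.EqOn f g (Om n)) {p : Pt n}
    (hp : p ∈ (Om n : Set (Pt n))) : pd v f p = pd v g p := by
  have : f =ᶠ[𝓝 p] g := by
    filter_upwards [(Om n).isOpen.mem_nhds hp] with q hq using h hq
  rw [pd, pd, this.fderiv_eq]

theorem pd_ex_wt (i : Fin n) (h : ℝ → ℂ) (p : Pt n) (hh : DifferentiableAt ℝ h p.2) :
    pd (ex i) (fun q => h q.2) p = 0 := by
  have := (hh.hasFDerivAt.comp p hasFDerivAt_snd).fderiv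
  rw [pd, show (fun q : Pt n => h q.2) = h ∘ Prod.snd from rfl, this]
  simp [ex]

/-- The operator `A` in divergence form. -/
theorem mul_waveFun {f : Pt n → ℂ} (hf : ContDiffOn ℝ ∞ f (Om n)) {p : Pt n}
    (hp : p ∈ (Om n : Set (Pt n))) :
    (p.2 : ℂ) * waveFun f p
      = -∑ o, pd (dir o) (fun q => ((wt o q.2 ^ 2 : ℝ) : ℂ) * pd (dir o) f q) p := by
  have hz : (0 : ℝ) < p.2 := hp
  have h1 : pd (dir none) (fun q : Pt n => ((wt (none : Option (Fin n)) q.2 ^ 2 : ℝ) : ℂ)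
      * pd (dir none) f q) p = pd ez (fun q : Pt n => (q.2 : ℂ) * pd ez f q) p := by
    refine pd_congr_of_eqOn _ (fun q hq => ?_) hp
    simp only [wt_none_sq hq]
    rfl
  have h2 : ∀ i : Fin n, pd (dir (some i)) (fun q : Pt n => ((wt (some i) q.2 ^ 2 : ℝ) : ℂ)
      * pd (dir (some i)) f q) p
        = ((p.2 ^ (-(1 / (n : ℝ))) : ℝ) : ℂ) * pd (ex i) (pd (ex i) f) p := fun i => by
    have e1 : DifferentiableAt ℝ (fun z : ℝ => ((wt (some i) z ^ 2 : ℝ) : ℂ)) p.2 := by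
      refine Complex.ofRealCLM.differentiableAt.comp p.2 (DifferentiableAt.pow ?_ 2)
      exact (Real.differentiableAt_rpow_const_of_ne _ hz.ne')
    have e2 : DifferentiableAt ℝ (fun q : Pt n => ((wt (some i) q.2 ^ 2 : ℝ) : ℂ)) p :=
      e1.comp p differentiableAt_snd
    have e3 : DifferentiableAt ℝ (pd (dir (some i)) f) p :=
      ((contDiffOn_pd _ hf).contDiffAt ((Om n).isOpen.mem_nhds hp)).differentiableAt (by simp)
    rw [pd_mul _ e2 e3, ← wt_some_sq i hz]
    have := pd_ex_wt i _ p e1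
    change _ * _ + pd (ex i) _ p * _ = _
    rw [this, zero_mul, add_zero]
    rfl
  have h3 : p.2 * p.2 ^ (-1 - 1 / (n : ℝ)) = p.2 ^ (-(1 / (n : ℝ))) := by
    nth_rewrite 1 [← Real.rpow_one p.2]
    rw [← Real.rpow_add hz]
    congr 1
    ring
  rw [Fintype.sum_option, h1, Finset.sum_congr rfl fun i _ => h2 i, ← Finset.mul_sum, ← h3,
    waveFun]
  have : (p.2 : ℂ) ≠ 0 := by exact_mod_cast hz.ne'
  push_cast
  field_simp
  ring

theorem integrable_mul_test {F : Pt n → ℂ} (hF : ContinuousOn F (Om n)) (ψ : 𝓓(Om n, ℂ))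
    (μ : Measure (Pt n)) [IsFiniteMeasureOnCompacts μ] : Integrable (fun p => F p * ψ p) μ :=
  (continuous_mul_of_tsupport_subset hF ψ.continuous
    ψ.tsupport_subset).integrable_of_hasCompactSupport ψ.hasCompactSupport.mul_left

theorem inner_toLp_left {μ : Measure (Pt n)} {g : Pt n → ℂ} (hg : MemLp g 2 μ) (w : Lp ℂ 2 μ) :
    inner ℂ (hg.toLp g) w = ∫ p, w p * conj (g p) ∂μ := by
  rw [L2.inner_def]
  refine integral_congr_ae ?_
  filter_upwards [hg.coeFn_toLp] with p hp
  rw [RCLike.inner_apply, hp]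

/-! ### The gradient -/

/-- The Hilbert space of the weighted gradients. -/
abbrev Ksp (n : ℕ) : Type := PiLp 2 fun _ : Option (Fin n) => Lp ℂ 2 (muO n)

theorem grad_memLp (φ : 𝓓(Om n, ℂ)) (o : Option (Fin n)) :
    MemLp (fun p => (wt o p.2 : ℂ) * pd (dir o) φ p) 2 (muO n) :=
  memLp_mul_of_tsupport_subset (continuousOn_ofReal_wt o) (pdTest (dir o) φ).continuous
    (pdTest (dir o) φ).hasCompactSupport (pdTest (dir o) φ).tsupport_subset _

/-- The weighted gradient `(z^(1/2) ∂_z φ, z^(-1/(2n)) ∇ φ)` of a test function. -/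
def gradMap (n : ℕ) : 𝓓(Om n, ℂ) →ₗ[ℂ] Ksp n where
  toFun φ := WithLp.toLp 2 fun o => (grad_memLp φ o).toLp _
  map_add' φ ψ := by
    ext1 o
    change _ = (grad_memLp φ o).toLp _ + (grad_memLp ψ o).toLp _
    rw [← MemLp.toLp_add (grad_memLp φ o) (grad_memLp ψ o)]
    refine MemLp.toLp_congr (grad_memLp (φ + ψ) o) _ (.of_forall fun p => ?_)
    have := congrFun (pd_add (dir o) φ.contDiff ψ.contDiff) p
    change (wt o p.2 : ℂ) * pd (dir o) (φ + ψ) p = _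
    simp only [Pi.add_apply] at this ⊢
    rw [this, mul_add]
  map_smul' c φ := by
    ext1 o
    change _ = c • (grad_memLp φ o).toLp _
    rw [← MemLp.toLp_const_smul c (grad_memLp φ o)]
    refine MemLp.toLp_congr (grad_memLp (c • φ) o) _ (.of_forall fun p => ?_)
    have := congrFun (pd_smul (dir o) c φ.contDiff) p
    change (wt o p.2 : ℂ) * pd (dir o) (c • φ) p = _
    simp only [Pi.smul_apply, smul_eq_mul] at this ⊢
    rw [this, mul_left_comm]

theorem gradMap_ae (φ : 𝓓(Om n, ℂ)) (o : Option (Fin n)) :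
    gradMap n φ o =ᵐ[muO n] fun p => (wt o p.2 : ℂ) * pd (dir o) φ p :=
  (grad_memLp φ o).coeFn_toLp

theorem incl_ae (φ : 𝓓(Om n, ℂ)) : incl n φ =ᵐ[muO n] φ :=
  absolutelyContinuous_zMeasure.ae_le (test_memLp φ).coeFn_toLp

/-- The weighted gradient as an operator on the domain of `A`. -/
def gradOp (n : ℕ) : (waveOp n).domain →ₗ[ℂ] Ksp n :=
  gradMap n ∘ₗ (LinearEquiv.ofInjective (incl n) (incl_injective n)).symm.toLinearMap

theorem gradOp_incl (φ : 𝓓(Om n, ℂ)) :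
    gradOp n ⟨incl n φ, LinearMap.mem_range_self _ φ⟩ = gradMap n φ := by
  change gradMap n ((LinearEquiv.ofInjective (incl n) (incl_injective n)).symm
    ((LinearEquiv.ofInjective (incl n) (incl_injective n)) φ)) = _
  rw [LinearEquiv.symm_apply_apply]

/-- Green's formula. -/
theorem inner_incl_waveMap (φ ψ : 𝓓(Om n, ℂ)) :
    inner ℂ (incl n φ) (waveMap n ψ) = inner ℂ (gradMap n φ) (gradMap n ψ) := by
  have h1 : inner ℂ (incl n φ) (waveMap n ψ)
      = ∫ p, (p.2 : ℂ) * waveFun ψ p * conj (φ p) ∂muO n := by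
    change inner ℂ ((test_memLp φ).toLp _) _ = _
    rw [inner_toLp_left, integral_zMeasure]
    refine integral_congr_ae ?_
    filter_upwards [absolutelyContinuous_zMeasure.ae_le (waveFun_memLp ψ).coeFn_toLp] with p hp
    change (p.2 : ℂ) * (((waveFun_memLp ψ).toLp _ : Hsp n) p * _) = _
    rw [hp, mul_assoc]
  have hψ : ContDiffOn ℝ ∞ (ψ : Pt n → ℂ) (Om n) := ψ.contDiff.contDiffOn
  have h2 : ∀ o, inner ℂ (gradMap n φ o) (gradMap n ψ o)
      = ∫ p, ((wt o p.2 ^ 2 : ℝ) : ℂ) * pd (dir o) ψ p * pd (dir o) (conjTest φ) p ∂muO n := by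
    intro o
    change inner ℂ ((grad_memLp φ o).toLp _) _ = _
    rw [inner_toLp_left]
    refine integral_congr_ae ?_
    filter_upwards [gradMap_ae ψ o] with p hp
    rw [hp, coe_conjTest, pd_conj, map_mul, Complex.conj_ofReal]
    push_cast
    ring
  rw [h1, PiLp.inner_apply]
  change _ = ∑ o, inner ℂ (gradMap n φ o) (gradMap n ψ o)
  -- Integration by parts moves the derivative from the conjugate of `φ` onto the flux `wt² ∂ψ`;
  -- summed over the directions, this is the divergence form of `z A ψ`.
  simp only [h2, integral_mul_pd _ (contDiffOn_flux _ hψ)]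
  rw [Finset.sum_neg_distrib, ← integral_finsetSum, ← integral_neg]
  · refine integral_congr_ae ?_
    filter_upwards [ae_muO_mem] with p hp
    rw [mul_waveFun hψ hp, neg_mul, Finset.sum_mul]
    rfl
  · intro o _
    exact integrable_mul_test (continuousOn_pd _ (contDiffOn_flux o hψ)) (conjTest φ) _

theorem waveOp_domain_cases (x : (waveOp n).domain) :
    ∃ φ, x = ⟨incl n φ, LinearMap.mem_range_self _ φ⟩ := by
  obtain ⟨_, φ, rfl⟩ := x
  exact ⟨φ, rfl⟩

/-- Green's formula in the form the abstract theory asks for: the weighted gradient plays the role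
of `D`. -/
theorem inner_gradOp (x y : (waveOp n).domain) :
    inner ℂ (gradOp n x) (gradOp n y) = inner ℂ (waveOp n x) (y : Hsp n) := by
  obtain ⟨φ, rfl⟩ := waveOp_domain_cases x
  obtain ⟨ψ, rfl⟩ := waveOp_domain_cases y
  rw [gradOp_incl, gradOp_incl, waveOp_incl, ← inner_conj_symm, ← inner_incl_waveMap,
    inner_conj_symm]

theorem IsL2loc.locallyIntegrableOn {g : Pt n → ℂ} (hg : IsL2loc g) :
    LocallyIntegrableOn g (Om n : Set (Pt n)) volume := by
  rw [locallyIntegrableOn_iff (Om n).isOpen.isLocallyClosed]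
  intro K hK hKc
  have : IsFiniteMeasure ((volume : Measure (Pt n)).restrict K) :=
    ⟨by rw [Measure.restrict_apply_univ]; exact hKc.measure_lt_top⟩
  exact (hg K hKc hK).integrable (by norm_num)

theorem IsL2loc.aestronglyMeasurable {g : Pt n → ℂ} (hg : IsL2loc g) :
    AEStronglyMeasurable g (muO n) :=
  hg.locallyIntegrableOn.aestronglyMeasurable

/-- If `F g ∈ L²(Ω)` with `F` continuous without zeros on `Ω`, then `g ∈ L²_loc(Ω)`. -/
theorem isL2loc_of_memLp_mul {F g : Pt n → ℂ} (hF : ContinuousOn F (Om n))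
    (h0 : ∀ p ∈ (Om n : Set (Pt n)), F p ≠ 0) (hg : MemLp (fun p => F p * g p) 2 (muO n)) :
    IsL2loc g := by
  intro K hK hKO
  have hm : MemLp (fun p => F p * g p) 2 (volume.restrict K) :=
    hg.mono_measure (Measure.restrict_mono hKO le_rfl)
  have hi : ContinuousOn (fun p => (F p)⁻¹) K := (hF.mono hKO).inv₀ fun p hp => h0 p (hKO hp)
  obtain ⟨C, hC⟩ := hK.exists_bound_of_continuousOn hi
  have hae : ∀ᵐ p ∂(volume : Measure (Pt n)).restrict K, p ∈ K :=
    ae_restrict_mem hK.measurableSet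
  have heq : (fun p => (F p)⁻¹ * (F p * g p)) =ᵐ[volume.restrict K] g := by
    filter_upwards [hae] with p hp
    rw [inv_mul_cancel_left₀ (h0 p (hKO hp))]
  refine (memLp_congr_ae heq).1 (hm.of_le_mul (c := C)
    ((hi.aestronglyMeasurable hK.measurableSet).mul hm.1) ?_)
  filter_upwards [hae] with p hp
  rw [norm_mul]
  exact mul_le_mul_of_nonneg_right (hC p hp) (norm_nonneg _)

theorem ofReal_wt_ne_zero (o : Option (Fin n)) {p : Pt n} (hp : p ∈ (Om n : Set (Pt n))) :
    (wt o p.2 : ℂ) ≠ 0 := by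
  exact_mod_cast (wt_pos o hp).ne'

theorem isL2loc_Hsp (u : Hsp n) : IsL2loc (u : Pt n → ℂ) :=
  isL2loc_of_memLp_mul (continuousOn_ofReal_wt none) (fun _ => ofReal_wt_ne_zero none)
    (memLp_zMeasure_iff.1 (Lp.memLp u))

/-- A locally square integrable function that is orthogonal to the test functions vanishes. -/
theorem IsL2loc.ae_eq_zero {g : Pt n → ℂ} (hg : IsL2loc g)
    (h : ∀ ψ : 𝓓(Om n, ℂ), ∫ p, g p * ψ p ∂muO n = 0) : g =ᵐ[muO n] 0 := by
  have := (Om n).isOpen.ae_eq_zero_of_integral_contDiff_smul_eq_zero hg.locallyIntegrableOn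
    fun χ hχ hχc hχs => by
      have h1 := h ⟨fun p => (χ p : ℂ), Complex.ofRealCLM.contDiff.comp hχ,
        hχc.comp_left Complex.ofReal_zero,
        (tsupport_comp_subset Complex.ofReal_zero _).trans hχs⟩
      rw [setIntegral_eq_integral_of_forall_compl_eq_zero] at h1
      · rw [← h1]
        refine integral_congr_ae (.of_forall fun p => ?_)
        change χ p • g p = g p * (χ p : ℂ)
        rw [mul_comm, Complex.real_smul]
      · intro p hp
        change g p * (χ p : ℂ) = 0
        rw [image_eq_zero_of_notMem_tsupport fun hp' => hp (hχs hp'), Complex.ofReal_zero, mul_zero]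
  exact (ae_restrict_iff' measurableSet_Om).2 this

/-- If `w` is orthogonal to all test functions, then `z w` is locally square integrable and
integrates to zero against them, hence vanishes; the factor `z` comes from the measure and is
nonzero on `Ω`. -/
theorem dense_waveOp_domain : Dense ((waveOp n).domain : Set (Hsp n)) := by
  rw [← Submodule.dense_iff_topologicalClosure_eq_top.symm.eq,
    Submodule.topologicalClosure_eq_top_iff, Submodule.eq_bot_iff]
  intro w hw
  have h0 : IsL2loc fun p : Pt n => (p.2 : ℂ) * w p := by
    intro K hK hKO
    obtain ⟨C, hC⟩ := hK.exists_bound_of_continuousOn (f := fun p : Pt n => (p.2 : ℂ))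
      (by fun_prop)
    have hm := isL2loc_Hsp w K hK hKO
    refine hm.of_le_mul (c := C) ((Continuous.aestronglyMeasurable (by fun_prop)).mul hm.1) ?_
    filter_upwards [ae_restrict_mem hK.measurableSet] with p hp
    rw [norm_mul]
    exact mul_le_mul_of_nonneg_right (hC p hp) (norm_nonneg _)
  have h1 := h0.ae_eq_zero fun ψ => by
    have h2 := Submodule.inner_right_of_mem_orthogonal
      (LinearMap.mem_range_self (incl n) (conjTest ψ)) hw
    change inner ℂ ((test_memLp (conjTest ψ)).toLp _) w = 0 at h2
    rw [inner_toLp_left, integral_zMeasure] at h2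
    rw [← h2]
    refine integral_congr_ae (.of_forall fun p => ?_)
    simp [mul_assoc]
  refine Lp.ext ?_
  refine EventuallyEq.trans ?_ (Lp.coeFn_zero _ _ _).symm
  rw [EventuallyEq, ae_zMeasure]
  filter_upwards [h1, ae_muO_mem] with p hp hp'
  have : (p.2 : ℂ) ≠ 0 := by exact_mod_cast (ne_of_gt (show (0 : ℝ) < p.2 from hp'))
  exact (mul_eq_zero.1 hp).resolve_left this

theorem isNonnegSymmetric_waveOp : UnboundedOp.IsNonnegSymmetric (waveOp n) where
  dense := dense_waveOp_domain
  symmetric x y := by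
    rw [← inner_gradOp x y, ← inner_conj_symm (x : Hsp n), ← inner_gradOp y x, inner_conj_symm]
  nonneg x := by
    rw [← inner_gradOp x x]
    exact inner_self_nonneg (𝕜 := ℂ) (x := gradOp n x)

/-! ### The graph of the weak gradient -/

/-- The second component of `p` is the weighted weak gradient of the first one. -/
def EnergyPair (p : WithLp 2 (Hsp n × Ksp n)) : Prop :=
  ∀ (o : Option (Fin n)) (ψ : 𝓓(Om n, ℂ)),
    ∫ q, p.fst q * pd (dir o) ψ q ∂muO n = -∫ q, p.snd o q / wt o q.2 * ψ q ∂muO n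

theorem ofReal_snd_ne_zero {p : Pt n} (hp : p ∈ (Om n : Set (Pt n))) : (p.2 : ℂ) ≠ 0 := by
  exact_mod_cast (ne_of_gt (show (0 : ℝ) < p.2 from hp))

theorem continuousOn_inv_snd : ContinuousOn (fun p : Pt n => (p.2 : ℂ)⁻¹) (Om n) :=
  ContinuousOn.inv₀ (by fun_prop) fun _ => ofReal_snd_ne_zero

theorem continuousOn_inv_wt (o : Option (Fin n)) :
    ContinuousOn (fun p : Pt n => (wt o p.2 : ℂ)⁻¹) (Om n) :=
  (continuousOn_ofReal_wt o).inv₀ fun _ => ofReal_wt_ne_zero o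

theorem inv_snd_mul_memLp (ψ : 𝓓(Om n, ℂ)) :
    MemLp (fun p => (p.2 : ℂ)⁻¹ * conjTest ψ p) 2 (zMeasure n) :=
  memLp_mul_of_tsupport_subset continuousOn_inv_snd (conjTest ψ).continuous
    (conjTest ψ).hasCompactSupport (conjTest ψ).tsupport_subset _

theorem inv_wt_mul_memLp (o : Option (Fin n)) (ψ : 𝓓(Om n, ℂ)) :
    MemLp (fun p => (wt o p.2 : ℂ)⁻¹ * conjTest ψ p) 2 (muO n) :=
  memLp_mul_of_tsupport_subset (continuousOn_inv_wt o) (conjTest ψ).continuous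
    (conjTest ψ).hasCompactSupport (conjTest ψ).tsupport_subset _

/-- Exhibits the unweighted pairing as a continuous functional on `H`: the factor `z⁻¹` compensates
the density and is harmless on the support of `ψ`. -/
theorem integral_Hsp_mul_test (u : Hsp n) (ψ : 𝓓(Om n, ℂ)) :
    ∫ q, u q * ψ q ∂muO n = inner ℂ ((inv_snd_mul_memLp ψ).toLp _) u := by
  rw [inner_toLp_left, integral_zMeasure]
  refine integral_congr_ae ?_
  filter_upwards [ae_muO_mem] with p hp
  have := ofReal_snd_ne_zero hp
  simp only [coe_conjTest, map_mul, map_inv₀, Complex.conj_ofReal, Complex.conj_conj]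
  field_simp

theorem integral_div_wt_mul_test (o : Option (Fin n)) (k : Lp ℂ 2 (muO n)) (ψ : 𝓓(Om n, ℂ)) :
    ∫ q, k q / wt o q.2 * ψ q ∂muO n = inner ℂ ((inv_wt_mul_memLp o ψ).toLp _) k := by
  rw [inner_toLp_left]
  refine integral_congr_ae (.of_forall fun p => ?_)
  simp only [coe_conjTest, map_mul, map_inv₀, Complex.conj_ofReal, Complex.conj_conj]
  ring

/-- In this form the weak-derivative conditions are equalities of continuous linear functionals,
which makes `energyGraph` a closed subspace. -/
theorem energyPair_iff (p : WithLp 2 (Hsp n × Ksp n)) :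
    EnergyPair p ↔ ∀ (o : Option (Fin n)) (ψ : 𝓓(Om n, ℂ)),
      inner ℂ ((inv_snd_mul_memLp (pdTest (dir o) ψ)).toLp _) p.fst
        = -inner ℂ ((inv_wt_mul_memLp o ψ).toLp _) (p.snd o) := by
  refine forall₂_congr fun o ψ => ?_
  rw [← integral_Hsp_mul_test, ← integral_div_wt_mul_test]
  rfl

variable (n) in
/-- The pairs of a function in the energy space and its weighted weak gradient. -/
def energyGraph : Submodule ℂ (WithLp 2 (Hsp n × Ksp n)) where
  carrier := {p | EnergyPair p}
  zero_mem' := by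
    refine (energyPair_iff _).2 fun o ψ => ?_
    simp
  add_mem' {p q} hp hq := by
    refine (energyPair_iff _).2 fun o ψ => ?_
    have h1 := (energyPair_iff p).1 hp o ψ
    have h2 := (energyPair_iff q).1 hq o ψ
    simp only [WithLp.add_fst, WithLp.add_snd, PiLp.add_apply, inner_add_right, h1, h2]
    ring
  smul_mem' c p hp := by
    refine (energyPair_iff _).2 fun o ψ => ?_
    have h1 := (energyPair_iff p).1 hp o ψ
    simp only [WithLp.smul_fst, WithLp.smul_snd, PiLp.smul_apply, inner_smul_right, h1]
    ring

theorem mem_energyGraph {p : WithLp 2 (Hsp n × Ksp n)} : p ∈ energyGraph n ↔ EnergyPair p :=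
  Iff.rfl

theorem isClosed_energyGraph : IsClosed (energyGraph n : Set (WithLp 2 (Hsp n × Ksp n))) := by
  have : (energyGraph n : Set (WithLp 2 (Hsp n × Ksp n)))
      = ⋂ (o : Option (Fin n)) (ψ : 𝓓(Om n, ℂ)), {p |
        inner ℂ ((inv_snd_mul_memLp (pdTest (dir o) ψ)).toLp _) p.fst
        = -inner ℂ ((inv_wt_mul_memLp o ψ).toLp _) (p.snd o)} := by
    ext p
    simp only [Set.mem_iInter, SetLike.mem_coe, mem_energyGraph, energyPair_iff]
    rfl
  rw [this]
  refine isClosed_iInter fun o => isClosed_iInter fun ψ => isClosed_eq ?_ ?_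
  · fun_prop
  · fun_prop

theorem toLp_test_mem_energyGraph (φ : 𝓓(Om n, ℂ)) :
    WithLp.toLp 2 (incl n φ, gradMap n φ) ∈ energyGraph n := by
  intro o ψ
  have h := integral_mul_pd (dir o) (φ.contDiff.contDiffOn (s := (Om n : Set (Pt n)))) ψ
  change ∫ q, incl n φ q * pd (dir o) ψ q ∂muO n
    = -∫ q, gradMap n φ o q / wt o q.2 * ψ q ∂muO n
  refine Eq.trans ?_ (h.trans (congrArg Neg.neg ?_))
  · refine integral_congr_ae ?_
    filter_upwards [incl_ae φ] with q hq
    rw [hq]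
  · refine integral_congr_ae ?_
    filter_upwards [gradMap_ae φ o, ae_muO_mem] with q hq hq'
    have := ofReal_wt_ne_zero o hq'
    rw [hq]
    field_simp

/-- The easy inclusion: weak gradients are stable under limits. The reverse one is the density
theorem. -/
theorem formGraph_le_energyGraph :
    UnboundedOp.formGraph (gradOp n) ≤ energyGraph n := fun p hp => by
  refine UnboundedOp.formGraph_induction (D := gradOp n) (P := fun p => p ∈ energyGraph n)
    isClosed_energyGraph (fun x => ?_) hp
  obtain ⟨φ, rfl⟩ := waveOp_domain_cases x
  rw [gradOp_incl]
  exact toLp_test_mem_energyGraph φ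

theorem toLp_test_mem_formGraph (φ : 𝓓(Om n, ℂ)) :
    WithLp.toLp 2 (incl n φ, gradMap n φ) ∈ UnboundedOp.formGraph (gradOp n) := by
  rw [← gradOp_incl]
  exact UnboundedOp.toLp_mem_formGraph (D := gradOp n) ⟨incl n φ, LinearMap.mem_range_self _ φ⟩

/-! ### The energy space -/

/-- Uniqueness of weak derivatives is needed because `weakPd` is an arbitrary choice; it identifies
that choice with the second component of an energy pair. -/
theorem HasWeakPd.ae_eq {v : Pt n} {u g g' : Pt n → ℂ} (h : HasWeakPd v u g)
    (h' : HasWeakPd v u g') : g =ᵐ[muO n] g' := by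
  have hs : IsL2loc (g - g') := fun K hK hKO => (h.1 K hK hKO).sub (h'.1 K hK hKO)
  have hint : ∀ {f : Pt n → ℂ} (_ : IsL2loc f) (ψ : 𝓓(Om n, ℂ)),
      Integrable (fun p => f p * ψ p) (muO n) := fun {f} hf ψ => by
    have hK := ψ.hasCompactSupport.isCompact
    have h1 := (hf _ hK ψ.tsupport_subset).integrable_mul
      (ψ.continuous.memLp_of_hasCompactSupport (p := 2)
        (μ := (volume : Measure (Pt n)).restrict (tsupport ψ)) ψ.hasCompactSupport)
    have h2 : IntegrableOn (fun p => f p * ψ p) (tsupport ψ) := h1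
    have h3 := (integrableOn_iff_integrable_of_support_subset
      ((Function.support_mul_subset_right f ψ).trans (subset_tsupport ψ))).1 h2
    exact h3.integrableOn
  have := hs.ae_eq_zero fun ψ => by
    have e := (h.2 ψ).symm.trans (h'.2 ψ)
    simp only [Pi.sub_apply, sub_mul]
    rw [integral_sub (hint h.1 ψ) (hint h'.1 ψ)]
    exact sub_eq_zero.2 (neg_injective e)
  filter_upwards [this] with p hp using sub_eq_zero.1 hp

theorem EnergyPair.hasWeakPd {p : WithLp 2 (Hsp n × Ksp n)} (h : EnergyPair p)
    (o : Option (Fin n)) : HasWeakPd (dir o) p.fst fun q => p.snd o q / wt o q.2 := by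
  refine ⟨isL2loc_of_memLp_mul (continuousOn_ofReal_wt o) (fun _ => ofReal_wt_ne_zero o) ?_,
    h o⟩
  refine (memLp_congr_ae ?_).1 (Lp.memLp (p.snd o))
  filter_upwards [ae_muO_mem] with q hq
  have := ofReal_wt_ne_zero o hq
  field_simp

theorem EnergyPair.isH1loc {p : WithLp 2 (Hsp n × Ksp n)} (h : EnergyPair p) :
    IsH1loc (p.fst : Pt n → ℂ) :=
  ⟨isL2loc_Hsp _, ⟨_, h.hasWeakPd none⟩, fun i => ⟨_, h.hasWeakPd (some i)⟩⟩

theorem hasWeakPd_weakPd {v : Pt n} {u : Pt n → ℂ} (h : ∃ g, HasWeakPd v u g) :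
    HasWeakPd v u (weakPd v u) := by
  rw [weakPd, dif_pos h]
  exact h.choose_spec

theorem EnergyPair.weakPd_ae {p : WithLp 2 (Hsp n × Ksp n)} (h : EnergyPair p)
    (o : Option (Fin n)) :
    p.snd o =ᵐ[muO n] fun q => (wt o q.2 : ℂ) * weakPd (dir o) p.fst q := by
  filter_upwards [(hasWeakPd_weakPd ⟨_, h.hasWeakPd o⟩).ae_eq (h.hasWeakPd o), ae_muO_mem]
    with q hq hq'
  have := ofReal_wt_ne_zero o hq'
  rw [hq]
  field_simp

theorem dirichlet_eq_sum {u : Pt n → ℂ} (hu : IsH1loc u) :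
    dirichlet u = ∑ o, eLpNorm (fun q => (wt o q.2 : ℂ) * weakPd (dir o) u q) 2 (muO n) ^ 2 := by
  have hm : ∀ o : Option (Fin n),
      AEStronglyMeasurable (fun q => (wt o q.2 : ℂ) * weakPd (dir o) u q) (muO n) := fun o => by
    refine (Complex.measurable_ofReal.comp (measurable_wt o)).aestronglyMeasurable.mul ?_
    cases o with
    | none => exact (hasWeakPd_weakPd hu.2.1).1.aestronglyMeasurable
    | some i => exact (hasWeakPd_weakPd (hu.2.2 i)).1.aestronglyMeasurable
  simp only [eLpNorm_two_sq]
  rw [← lintegral_finsetSum' _ fun o _ => (hm o).enorm.pow_const 2, dirichlet]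
  refine lintegral_congr_ae ?_
  filter_upwards [ae_muO_mem] with p hp
  rw [Fintype.sum_option, Finset.mul_sum, ← ofReal_wt_none p hp]
  congr 1
  exact Finset.sum_congr rfl fun i _ => ofReal_wt_some i p hp _

theorem EnergyPair.dirichlet_eq {p : WithLp 2 (Hsp n × Ksp n)} (h : EnergyPair p) :
    dirichlet (p.fst : Pt n → ℂ) = ∑ o, ‖p.snd o‖ₑ ^ 2 := by
  rw [dirichlet_eq_sum h.isH1loc]
  refine Finset.sum_congr rfl fun o _ => ?_
  rw [Lp.enorm_def, eLpNorm_congr_ae (h.weakPd_ae o)]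

theorem EnergyPair.mem_energySpace {p : WithLp 2 (Hsp n × Ksp n)} (h : EnergyPair p) :
    p.fst ∈ energySpace n := by
  refine ⟨h.isH1loc, ?_⟩
  rw [h.dirichlet_eq]
  exact ENNReal.sum_lt_top.2 fun o _ => ENNReal.pow_lt_top enorm_lt_top

theorem EnergyPair.energyNormSq_eq {p : WithLp 2 (Hsp n × Ksp n)} (h : EnergyPair p) :
    energyNormSq p.fst = ENNReal.ofReal (‖p‖ ^ 2) := by
  rw [energyNormSq, h.dirichlet_eq, WithLp.prod_norm_sq_eq_of_L2, PiLp.norm_sq_eq_of_L2,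
    ENNReal.ofReal_add (by positivity) (by positivity), add_comm,
    ENNReal.ofReal_sum_of_nonneg fun _ _ => by positivity, ENNReal.ofReal_pow (norm_nonneg _),
    ofReal_norm]
  congr 1
  refine Finset.sum_congr rfl fun o _ => ?_
  rw [ENNReal.ofReal_pow (norm_nonneg _), ofReal_norm]

/-- Finite energy puts each weighted weak derivative in `L²(Ω)`. Together with
`EnergyPair.mem_energySpace` this says that the energy space is the projection of `energyGraph` to
`H`. -/
theorem exists_energyPair {u : Hsp n} (hu : u ∈ energySpace n) :
    ∃ k, EnergyPair (WithLp.toLp 2 (u, k)) := by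
  have hw : ∀ o : Option (Fin n), HasWeakPd (dir o) u (weakPd (dir o) u) := fun o => by
    cases o with
    | none => exact hasWeakPd_weakPd hu.1.2.1
    | some i => exact hasWeakPd_weakPd (hu.1.2.2 i)
  have hm : ∀ o : Option (Fin n),
      MemLp (fun q => (wt o q.2 : ℂ) * weakPd (dir o) u q) 2 (muO n) := fun o => by
    refine ⟨(Complex.measurable_ofReal.comp (measurable_wt o)).aestronglyMeasurable.mul
      (hw o).1.aestronglyMeasurable, ?_⟩
    have h1 := hu.2
    rw [dirichlet_eq_sum hu.1, ENNReal.sum_lt_top] at h1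
    exact (ENNReal.pow_lt_top_iff.1 (h1 o (Finset.mem_univ o))).resolve_right (by norm_num)
  refine ⟨WithLp.toLp 2 fun o => (hm o).toLp _, fun o ψ => ?_⟩
  refine ((hw o).2 ψ).trans (congrArg Neg.neg ?_)
  refine integral_congr_ae ?_
  filter_upwards [(hm o).coeFn_toLp, ae_muO_mem] with q hq hq'
  have := ofReal_wt_ne_zero o hq'
  change _ = ((hm o).toLp _ : Lp ℂ 2 (muO n)) q / wt o q.2 * ψ q
  rw [hq]
  field_simp

theorem formDomain_subset_energySpace :
    UnboundedOp.formDomain (waveOp n) ⊆ energySpace n := fun u hu => by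
  obtain ⟨k, hk⟩ := (UnboundedOp.mem_formDomain_iff inner_gradOp u).1 hu
  exact EnergyPair.mem_energySpace (formGraph_le_energyGraph hk)

/-! ### Locally square integrable functions and test functions -/

theorem isL2loc_of_memLp {g : Pt n → ℂ} (hg : MemLp g 2 (muO n)) : IsL2loc g := fun _ _ hKO =>
  hg.mono_measure (Measure.restrict_mono hKO le_rfl)

theorem IsL2loc.conj {g : Pt n → ℂ} (hg : IsL2loc g) : IsL2loc fun p => conj (g p) :=
  fun K hK hKO => (hg K hK hKO).star

theorem IsL2loc.continuousOn_mul {F g : Pt n → ℂ} (hF : ContinuousOn F (Om n)) (hg : IsL2loc g) :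
    IsL2loc fun p => F p * g p := fun K hK hKO => by
  obtain ⟨C, hC⟩ := hK.exists_bound_of_continuousOn (hF.mono hKO)
  have hm := hg K hK hKO
  refine hm.of_le_mul (c := C) (((hF.mono hKO).aestronglyMeasurable hK.measurableSet).mul hm.1) ?_
  filter_upwards [ae_restrict_mem hK.measurableSet] with p hp
  rw [norm_mul]
  exact mul_le_mul_of_nonneg_right (hC p hp) (norm_nonneg _)

theorem isL2loc_one : IsL2loc fun _ : Pt n => (1 : ℂ) := fun _ hK _ =>
  (memLp_indicator_iff_restrict hK.measurableSet).1
    (memLp_indicator_const 2 hK.measurableSet 1 (Or.inr hK.measure_lt_top.ne))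

theorem eq_zero_of_notMem_tsupport (ψ : 𝓓(Om n, ℂ)) {p : Pt n}
    (hp : p ∉ tsupport (ψ : Pt n → ℂ)) : ψ p = 0 := image_eq_zero_of_notMem_tsupport hp

theorem IsL2loc.memLp_test_mul {g : Pt n → ℂ} (hg : IsL2loc g) (ψ : 𝓓(Om n, ℂ)) :
    MemLp (fun p => ψ p * g p) 2 (volume : Measure (Pt n)) := by
  have hK := ψ.hasCompactSupport.isCompact
  have h1 := (hg.continuousOn_mul (F := ψ) ψ.continuous.continuousOn) _ hK ψ.tsupport_subset
  rw [← memLp_indicator_iff_restrict hK.measurableSet] at h1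
  rwa [(Set.indicator_eq_self (s := tsupport (ψ : Pt n → ℂ)) (f := fun p => ψ p * g p)).2] at h1
  intro p hp
  by_contra h
  exact hp (by simp [eq_zero_of_notMem_tsupport ψ h])

theorem IsL2loc.integrable_mul {F g : Pt n → ℂ} (hF : IsL2loc F) (hg : IsL2loc g)
    (ψ : 𝓓(Om n, ℂ)) : Integrable (fun p => F p * (ψ p * g p)) (muO n) := by
  have hK := ψ.hasCompactSupport.isCompact
  have h1 : IntegrableOn (fun p => F p * (ψ p * g p)) (tsupport (ψ : Pt n → ℂ)) :=
    (hF _ hK ψ.tsupport_subset).integrable_mul ((hg.memLp_test_mul ψ).restrict _)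
  refine ((integrableOn_iff_integrable_of_support_subset fun p hp => ?_).1 h1).integrableOn
  by_contra h
  exact hp (by simp [eq_zero_of_notMem_tsupport ψ h])

/-- The supports stay in a fixed compact subset of `Ω`, where `F` is square integrable, so
Cauchy–Schwarz applies although `F` is only in `L²_loc`. -/
theorem tendsto_integral_mul_of_tendsto_eLpNorm {F h : Pt n → ℂ} {f : ℕ → Pt n → ℂ}
    (hF : IsL2loc F) {K : Set (Pt n)} (hK : IsCompact K) (hKO : K ⊆ Om n)
    (hf : ∀ᶠ m in atTop, MemLp (f m) 2 volume) (hh : MemLp h 2 volume)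
    (hf0 : ∀ᶠ m in atTop, ∀ p ∉ K, f m p = 0) (hh0 : ∀ p ∉ K, h p = 0)
    (hlim : Tendsto (fun m => eLpNorm (f m - h) 2 volume) atTop (𝓝 0)) :
    Tendsto (fun m => ∫ p, F p * f m p ∂muO n) atTop (𝓝 (∫ p, F p * h p ∂muO n)) := by
  have hres : ∀ {G : Pt n → ℂ}, (∀ p ∉ K, G p = 0) →
      ∫ p, F p * G p ∂muO n = ∫ p in K, F p * G p := fun {G} hG =>
    setIntegral_eq_of_subset_of_forall_sdiff_eq_zero measurableSet_Om hKO fun p hp => by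
      rw [hG p hp.2, mul_zero]
  rw [hres hh0]
  have hFK := hF K hK hKO
  have hlim' : Tendsto (fun m => ∫ p in K, F p * f m p) atTop (𝓝 (∫ p in K, F p * h p)) := by
    refine tendsto_integral_of_L1' _ (hFK.1.mul (hh.restrict K).1)
      (hf.mono fun m hm => hFK.integrable_mul (hm.restrict K)) ?_
    have hb : Tendsto (fun m => eLpNorm F 2 ((volume : Measure (Pt n)).restrict K)
        * eLpNorm (f m - h) 2 volume) atTop (𝓝 0) := by
      simpa using ENNReal.Tendsto.const_mul hlim (Or.inr hFK.2.ne)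
    refine tendsto_of_tendsto_of_tendsto_of_le_of_le' tendsto_const_nhds hb
      (.of_forall fun _ => zero_le) (hf.mono fun m hm => ?_)
    have e : (fun p => F p * f m p) - (fun p => F p * h p) = F • (f m - h) := by
      funext p
      simp [mul_sub]
    change eLpNorm ((fun p => F p * f m p) - (fun p => F p * h p)) 1 _ ≤ _
    rw [e]
    refine (eLpNorm_smul_le_mul_eLpNorm (p := 2) (q := 2) (r := 1)
      ((hm.sub hh).restrict K).1 hFK.1).trans ?_
    gcongr
    exact Measure.restrict_le_self
  refine hlim'.congr' (hf0.mono fun m hm => (hres hm).symm)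

/-- The product of a test function and an `H¹_loc` function is a limit of test functions. -/
theorem exists_test_approx {u : Pt n → ℂ} {g : Option (Fin n) → Pt n → ℂ} (hu : IsL2loc u)
    (hg : ∀ o, HasWeakPd (dir o) u (g o)) (χ : 𝓓(Om n, ℂ)) :
    ∃ φ : ℕ → 𝓓(Om n, ℂ),
      (∀ F, IsL2loc F → Tendsto (fun m => ∫ p, F p * φ m p ∂muO n) atTop
        (𝓝 (∫ p, F p * (χ p * u p) ∂muO n))) ∧
      ∀ o F, IsL2loc F → Tendsto (fun m => ∫ p, F p * pd (dir o) (φ m) p ∂muO n) atTop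
        (𝓝 (∫ p, F p * (χ p * g o p + pd (dir o) χ p * u p) ∂muO n)) := by
  set f : Pt n → ℂ := fun p => χ p * u p
  set f' : Option (Fin n) → Pt n → ℂ := fun o p => χ p * g o p + pd (dir o) χ p * u p
  have hf : MemLp f 2 (volume : Measure (Pt n)) := hu.memLp_test_mul χ
  have hf' : ∀ o, MemLp (f' o) 2 (volume : Measure (Pt n)) := fun o =>
    ((hg o).1.memLp_test_mul χ).add (hu.memLp_test_mul (pdTest (dir o) χ))
  set S := tsupport (χ : Pt n → ℂ)
  have hS : IsCompact S := χ.hasCompactSupport.isCompact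
  have hf0 : ∀ p ∉ S, f p = 0 := fun p hp => by
    simp only [f, eq_zero_of_notMem_tsupport χ hp, zero_mul]
  have hf'0 : ∀ o, ∀ p ∉ S, f' o p = 0 := fun o p hp => by
    simp only [f', eq_zero_of_notMem_tsupport χ hp, zero_mul, pd_eq_zero _ hp, add_zero]
  have hfl : LocallyIntegrable f (volume : Measure (Pt n)) :=
    hf.locallyIntegrable (by norm_num)
  -- Product rule on the whole space: the weak derivative of `u` is tested with `ψ χ`, which is
  -- supported in `Ω` even when `ψ` is not.
  have hweak : ∀ (o : Option (Fin n)) (ψ : Pt n → ℝ), ContDiff ℝ ∞ ψ → HasCompactSupport ψ →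
      ∫ y, fderiv ℝ ψ y (dir o) • f y = -∫ y, ψ y • f' o y := by
    intro o ψ hψ _
    have hψC : ContDiff ℝ ∞ fun p => (ψ p : ℂ) := Complex.ofRealCLM.contDiff.comp hψ
    set η := mulTest _ hψC.contDiffOn χ
    have h1 := (hg o).2 η
    have hpd : ∀ p, pd (dir o) η p
        = (ψ p : ℂ) * pd (dir o) χ p + (fderiv ℝ ψ p (dir o) : ℂ) * χ p := fun p => by
      rw [coe_mulTest, pd_mul _ (hψC.differentiable (by simp) p)
        (χ.contDiff.differentiable (by simp) p)]
      congr 2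
      have := (Complex.ofRealCLM.hasFDerivAt.comp p
        (hψ.differentiable (by simp) p).hasFDerivAt).fderiv
      exact DFunLike.congr_fun this (dir o)
    have hO : ∀ {G : Pt n → ℂ}, (∀ p ∉ S, G p = 0) → ∫ p, G p = ∫ p, G p ∂muO n := fun hG =>
      (setIntegral_eq_integral_of_forall_compl_eq_zero fun p hp =>
        hG p fun h => hp (χ.tsupport_subset h)).symm
    rw [hO fun p hp => by rw [hf0 p hp, smul_zero], hO fun p hp => by rw [hf'0 o p hp, smul_zero]]
    have i1 : Integrable (fun p => u p * (((ψ p : ℂ) * pd (dir o) χ p) * 1)) (muO n) :=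
      hu.integrable_mul isL2loc_one (mulTest _ hψC.contDiffOn (pdTest (dir o) χ))
    have i2 : Integrable (fun p => u p * pd (dir o) η p) (muO n) := by
      simpa using hu.integrable_mul isL2loc_one (pdTest (dir o) η)
    have i3 : Integrable (fun p => g o p * (η p * 1)) (muO n) :=
      (hg o).1.integrable_mul isL2loc_one η
    have e1 : ∫ p, fderiv ℝ ψ p (dir o) • f p ∂muO n
        = ∫ p, u p * pd (dir o) η p ∂muO n
          - ∫ p, u p * (((ψ p : ℂ) * pd (dir o) χ p) * 1) ∂muO n := by
      rw [← integral_sub i2 i1]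
      refine integral_congr_ae (.of_forall fun p => ?_)
      simp only [hpd, f, Complex.real_smul]
      ring
    have e2 : ∫ p, ψ p • f' o p ∂muO n
        = ∫ p, g o p * (η p * 1) ∂muO n
          + ∫ p, u p * (((ψ p : ℂ) * pd (dir o) χ p) * 1) ∂muO n := by
      rw [← integral_add i3 i1]
      refine integral_congr_ae (.of_forall fun p => ?_)
      simp only [η, coe_mulTest, f', Complex.real_smul]
      ring
    rw [e1, e2, h1]
    simp only [mul_one]
    ring
  -- Once the mollification radius is below `δ`, the mollified functions are supported in a fixed
  -- compact subset of `Ω`.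
  obtain ⟨δ, hδ, hδO⟩ := hS.exists_cthickening_subset_open (Om n).isOpen χ.tsupport_subset
  set K := Metric.cthickening δ S
  have hK : IsCompact K := hS.cthickening
  have hsupp : ∀ {h : Pt n → ℂ}, (∀ p ∉ S, h p = 0) → ∀ᶠ m in atTop,
      Function.support (mollify volume h m) ⊆ K := fun {h} hh => by
    filter_upwards [(tendsto_order.1 (tendsto_shrinkingBump_rOut (Pt n))).2 δ hδ] with m hm
    refine (support_mollify_subset _ m).trans ((Metric.thickening_mono hm.le _).trans
      ((Metric.thickening_subset_cthickening _ _).trans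
        (Metric.cthickening_subset_of_subset _ fun p hp => ?_)))
    by_contra hpS
    exact hp (hh p hpS)
  have hex : ∀ m, ∃ φ : 𝓓(Om n, ℂ), Function.support (mollify volume f m) ⊆ K →
      (φ : Pt n → ℂ) = mollify volume f m := fun m => by
    by_cases h : Function.support (mollify volume f m) ⊆ K
    · have ht : tsupport (mollify volume f m) ⊆ K := closure_minimal h hK.isClosed
      exact ⟨⟨mollify volume f m, contDiff_mollify hfl m,
        hK.of_isClosed_subset (isClosed_tsupport _) ht, ht.trans hδO⟩, fun _ => rfl⟩
    · exact ⟨0, fun h' => absurd h' h⟩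
  choose φ hφ using hex
  have hz : ∀ {h : Pt n → ℂ}, (∀ p ∉ S, h p = 0) → ∀ p ∉ K, h p = 0 := fun hh p hp =>
    hh p fun h => hp (Metric.self_subset_cthickening S h)
  have hφ' : ∀ᶠ m in atTop, (φ m : Pt n → ℂ) = mollify volume f m :=
    (hsupp hf0).mono fun m hm => hφ m hm
  have hpdφ : ∀ o, ∀ᶠ m in atTop, pd (dir o) (φ m) = mollify volume (f' o) m := fun o =>
    hφ'.mono fun m hm => funext fun x => by
      rw [pd, hm]
      exact fderiv_mollify hfl (dir o) (hweak o) m x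
  have hnot : ∀ {h : Pt n → ℂ}, Function.support h ⊆ K → ∀ p ∉ K, h p = 0 := fun hh p hp => by
    by_contra h0
    exact hp (hh h0)
  refine ⟨φ, fun F hF => ?_, fun o F hF => ?_⟩
  · refine tendsto_integral_mul_of_tendsto_eLpNorm hF hK hδO
      (.of_forall fun m => (φ m).continuous.memLp_of_hasCompactSupport (φ m).hasCompactSupport)
      hf ?_ (hz hf0) ?_
    · filter_upwards [hφ', hsupp hf0] with m hm hs
      rw [hm]
      exact hnot hs
    · refine (tendsto_eLpNorm_mollify_sub hf).congr' (hφ'.mono fun m hm => ?_)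
      change _ = eLpNorm (⇑(φ m) - f) 2 volume
      rw [hm]
  · refine tendsto_integral_mul_of_tendsto_eLpNorm hF hK hδO
      (.of_forall fun m => (pdTest (dir o) (φ m)).continuous.memLp_of_hasCompactSupport
        (pdTest (dir o) (φ m)).hasCompactSupport)
      (hf' o) ?_ (hz (hf'0 o)) ?_
    · filter_upwards [hpdφ o, hsupp (hf'0 o)] with m hm hs
      rw [hm]
      exact hnot hs
    · refine (tendsto_eLpNorm_mollify_sub (hf' o)).congr' ((hpdφ o).mono fun m hm => ?_)
      change _ = eLpNorm (pd (dir o) (φ m) - f' o) 2 volume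
      rw [hm]

/-- The product rule for `|u|²`, in integrated form. -/
theorem integral_pd_normSq {u : Pt n → ℂ} {g : Option (Fin n) → Pt n → ℂ} (hu : IsL2loc u)
    (hg : ∀ o, HasWeakPd (dir o) u (g o)) (χ : 𝓓(Om n, ℂ)) (o : Option (Fin n)) :
    ∫ p, conj (u p) * (χ p * g o p + pd (dir o) χ p * u p) ∂muO n
      = -∫ p, conj (g o p) * (χ p * u p) ∂muO n := by
  -- Formally, the weak derivative of `conj u` is tested against `χ u`, which is only a limit of
  -- test functions; both sides of the identity for the approximations converge.
  obtain ⟨φ, h1, h2⟩ := exists_test_approx hu hg χ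
  refine tendsto_nhds_unique (h2 o _ hu.conj) ?_
  refine (h1 _ (hg o).1.conj).neg.congr fun m => ?_
  have h3 := congrArg conj ((hg o).2 (conjTest (φ m)))
  rw [map_neg, ← integral_conj, ← integral_conj] at h3
  simp only [coe_conjTest, pd_conj, map_mul, Complex.conj_conj] at h3
  exact h3.symm

/-! ### Cutoff functions -/

/-- A bump function in the variable `x`. -/
def bumpX (n : ℕ) : ContDiffBump (0 : EuclideanSpace ℝ (Fin n)) := ⟨1, 2, one_pos, one_lt_two⟩

/-- The function `h (log z / R) b (e^(-2R) x)`. -/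
def cutFun (h : ℝ → ℝ) (R : ℝ) (p : Pt n) : ℝ :=
  h (Real.log p.2 / R) * bumpX n (Real.exp (-2 * R) • p.1)

theorem contDiffOn_cutFun {h : ℝ → ℝ} (hh : ContDiff ℝ ∞ h) (R : ℝ) :
    ContDiffOn ℝ ∞ (cutFun h R) (Om n : Set (Pt n)) := by
  intro p hp
  have hz : p.2 ≠ 0 := ne_of_gt hp
  refine ContDiffAt.contDiffWithinAt ?_
  refine ContDiffAt.mul ?_ ?_
  · exact hh.contDiffAt.comp p ((contDiffAt_snd.log hz).div_const R)
  · exact (bumpX n).contDiff.contDiffAt.comp p (contDiffAt_fst.const_smul (Real.exp (-2 * R)))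

theorem cutFun_eq_zero {h : ℝ → ℝ} (h0 : ∀ s, 3 < |s| → h s = 0) {R : ℝ} (hR : 0 < R) {p : Pt n}
    (hp : p ∈ (Om n : Set (Pt n)))
    (hpK : p ∉ Metric.closedBall (0 : EuclideanSpace ℝ (Fin n)) (2 * Real.exp (2 * R)) ×ˢ
      Set.Icc (Real.exp (-3 * R)) (Real.exp (3 * R))) : cutFun h R p = 0 := by
  have hz : (0 : ℝ) < p.2 := hp
  by_contra hne
  obtain ⟨h1, h2⟩ := mul_ne_zero_iff.1 hne
  refine hpK ⟨?_, ?_⟩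
  · rw [mem_closedBall_zero_iff]
    by_contra hlt
    refine h2 ((bumpX n).zero_of_le_dist ?_)
    rw [dist_zero_right, norm_smul, Real.norm_of_nonneg (Real.exp_pos _).le]
    change 2 ≤ _
    have e : Real.exp (-2 * R) * Real.exp (2 * R) = 1 := by rw [← Real.exp_add]; simp
    nlinarith [Real.exp_pos (-2 * R), not_le.1 hlt]
  · have h3 : |Real.log p.2 / R| ≤ 3 := by
      by_contra hlt
      exact h1 (h0 _ (not_le.1 hlt))
    rw [abs_div, abs_of_pos hR, div_le_iff₀ hR, abs_le] at h3
    constructor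
    · rw [← Real.le_log_iff_exp_le hz]
      linarith
    · rw [← Real.log_le_iff_le_exp hz]
      linarith

/-- A cutoff function equal to `h (log z / R) b (e^(-2R) x)` on `Ω`, as a test function. -/
def cut (h : ℝ → ℝ) (hh : ContDiff ℝ ∞ h) (h0 : ∀ s, 3 < |s| → h s = 0) (R : ℝ) (hR : 0 < R) :
    𝓓(Om n, ℂ) :=
  have hK : IsCompact (Metric.closedBall (0 : EuclideanSpace ℝ (Fin n)) (2 * Real.exp (2 * R)) ×ˢ
      Set.Icc (Real.exp (-3 * R)) (Real.exp (3 * R))) :=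
    (isCompact_closedBall _ _).prod isCompact_Icc
  have hz : ∀ p ∉ Metric.closedBall (0 : EuclideanSpace ℝ (Fin n)) (2 * Real.exp (2 * R)) ×ˢ
      Set.Icc (Real.exp (-3 * R)) (Real.exp (3 * R)),
      (Om n : Set (Pt n)).indicator (fun p => (cutFun h R p : ℂ)) p = 0 := fun p hp => by
    by_cases hpO : p ∈ (Om n : Set (Pt n))
    · rw [Set.indicator_of_mem hpO, cutFun_eq_zero h0 hR hpO hp, Complex.ofReal_zero]
    · exact Set.indicator_of_notMem hpO _
  have ht : tsupport ((Om n : Set (Pt n)).indicator fun p => (cutFun h R p : ℂ)) ⊆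
      Metric.closedBall (0 : EuclideanSpace ℝ (Fin n)) (2 * Real.exp (2 * R)) ×ˢ
      Set.Icc (Real.exp (-3 * R)) (Real.exp (3 * R)) :=
    closure_minimal (fun p hp => by
      by_contra h
      exact hp (hz p h)) hK.isClosed
  { toFun := (Om n : Set (Pt n)).indicator fun p => (cutFun h R p : ℂ)
    contDiff' := by
      rw [contDiff_iff_contDiffAt]
      intro p
      by_cases hp : p ∈ (Om n : Set (Pt n))
      · refine ((Complex.ofRealCLM.contDiff.comp_contDiffOn (contDiffOn_cutFun hh R)).contDiffAt
          ((Om n).isOpen.mem_nhds hp)).congr_of_eventuallyEq ?_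
        filter_upwards [(Om n).isOpen.mem_nhds hp] with q hq
        exact Set.indicator_of_mem hq _
      · refine (contDiffAt_const (c := 0)).congr_of_eventuallyEq ?_
        have hpK : p ∉ Metric.closedBall (0 : EuclideanSpace ℝ (Fin n)) (2 * Real.exp (2 * R)) ×ˢ
            Set.Icc (Real.exp (-3 * R)) (Real.exp (3 * R)) := fun h =>
          hp ((Real.exp_pos _).trans_le h.2.1)
        filter_upwards [hK.isClosed.isOpen_compl.mem_nhds hpK] with q hq using hz q hq
    hasCompactSupport' := hK.of_isClosed_subset (isClosed_tsupport _) ht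
    tsupport_subset' := ht.trans fun p hp => (Real.exp_pos _).trans_le hp.2.1 }

theorem hasFDerivAt_cutFun {h : ℝ → ℝ} (hh : ContDiff ℝ ∞ h) (R : ℝ) {p : Pt n}
    (hp : p ∈ (Om n : Set (Pt n))) :
    HasFDerivAt (cutFun h R)
      (h (Real.log p.2 / R) • ((fderiv ℝ (bumpX n) (Real.exp (-2 * R) • p.1)).comp
        (Real.exp (-2 * R) • ContinuousLinearMap.fst ℝ (EuclideanSpace ℝ (Fin n)) ℝ))
      + bumpX n (Real.exp (-2 * R) • p.1) • ((deriv h (Real.log p.2 / R) * (p.2⁻¹ / R)) •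
        ContinuousLinearMap.snd ℝ (EuclideanSpace ℝ (Fin n)) ℝ)) p := by
  have hz : p.2 ≠ 0 := ne_of_gt hp
  have h1 : HasFDerivAt (fun q : Pt n => bumpX n (Real.exp (-2 * R) • q.1))
      ((fderiv ℝ (bumpX n) (Real.exp (-2 * R) • p.1)).comp
        (Real.exp (-2 * R) • ContinuousLinearMap.fst ℝ (EuclideanSpace ℝ (Fin n)) ℝ)) p :=
    HasFDerivAt.comp (g := bumpX n) p
      ((bumpX n).contDiff.differentiable (n := 1) (by simp) _).hasFDerivAt
      (hasFDerivAt_fst.const_smul (Real.exp (-2 * R)))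
  have h2 : HasDerivAt (fun z : ℝ => h (Real.log z / R))
      (deriv h (Real.log p.2 / R) * (p.2⁻¹ / R)) p.2 :=
    HasDerivAt.comp p.2 (hh.differentiable (by simp) _).hasDerivAt
      ((Real.hasDerivAt_log hz).div_const R)
  exact (h2.comp_hasFDerivAt p hasFDerivAt_snd).mul h1

section cut

variable {h : ℝ → ℝ} (hh : ContDiff ℝ ∞ h) (h0 : ∀ s, 3 < |s| → h s = 0) {R : ℝ} (hR : 0 < R)

theorem cut_apply {p : Pt n} (hp : p ∈ (Om n : Set (Pt n))) :
    cut h hh h0 R hR p = (cutFun h R p : ℂ) :=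
  Set.indicator_of_mem hp fun p => (cutFun h R p : ℂ)

theorem pd_cut (v : Pt n) {p : Pt n} (hp : p ∈ (Om n : Set (Pt n))) :
    pd v (cut h hh h0 R hR) p = ((fderiv ℝ (cutFun h R) p v : ℝ) : ℂ) := by
  have e : pd v (cut h hh h0 R hR) p = pd v (fun q => (cutFun h R q : ℂ)) p :=
    pd_congr_of_eqOn v (fun q hq => cut_apply hh h0 hR hq) hp
  rw [e]
  have := (Complex.ofRealCLM.hasFDerivAt.comp p (hasFDerivAt_cutFun hh R hp)).fderiv
  rw [(hasFDerivAt_cutFun hh R hp).fderiv]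
  exact DFunLike.congr_fun this v

theorem pd_none_cut {p : Pt n} (hp : p ∈ (Om n : Set (Pt n))) :
    pd (dir none) (cut h hh h0 R hR) p
      = ((bumpX n (Real.exp (-2 * R) • p.1) * (deriv h (Real.log p.2 / R) * (p.2⁻¹ / R)) : ℝ) :
        ℂ) := by
  rw [pd_cut hh h0 hR _ hp, (hasFDerivAt_cutFun hh R hp).fderiv]
  simp [dir, ez]

theorem pd_some_cut (i : Fin n) {p : Pt n} (hp : p ∈ (Om n : Set (Pt n))) :
    pd (dir (some i)) (cut h hh h0 R hR) p
      = ((h (Real.log p.2 / R) * (Real.exp (-2 * R) *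
        fderiv ℝ (bumpX n) (Real.exp (-2 * R) • p.1) (EuclideanSpace.single i 1)) : ℝ) : ℂ) := by
  rw [pd_cut hh h0 hR _ hp, (hasFDerivAt_cutFun hh R hp).fderiv]
  simp [dir, ex]

end cut

theorem exists_fderiv_bumpX_le (n : ℕ) : ∃ C : ℝ, ∀ (x : EuclideanSpace ℝ (Fin n)) (i : Fin n),
    |fderiv ℝ (bumpX n) x (EuclideanSpace.single i 1)| ≤ C := by
  have hc : Continuous (fderiv ℝ (bumpX n)) :=
    (bumpX n).contDiff.continuous_fderiv (n := 1) (by simp)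
  obtain ⟨C, hC⟩ := hc.bounded_above_of_compact_support
    ((bumpX n).hasCompactSupport.fderiv ℝ)
  refine ⟨C, fun x i => ?_⟩
  have := (fderiv ℝ (bumpX n) x).le_opNorm (EuclideanSpace.single i (1 : ℝ))
  rw [PiLp.norm_single, norm_one, mul_one] at this
  exact this.trans (hC x)

theorem fderiv_bumpX_eq_zero {x : EuclideanSpace ℝ (Fin n)} (hx : ‖x‖ < 1) :
    fderiv ℝ (bumpX n) x = 0 := by
  have : bumpX n =ᶠ[𝓝 x] fun _ => (1 : ℝ) := by
    filter_upwards [Metric.isOpen_ball.mem_nhds (mem_ball_zero_iff.2 hx)] with y hy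
    exact (bumpX n).one_of_mem_closedBall (Metric.ball_subset_closedBall hy)
  rw [this.fderiv_eq, fderiv_fun_const]
  rfl

/-- The profile of the main cutoff: `1` on `[-1, 1]` and `0` outside `[-2, 2]`. -/
def plateau (s : ℝ) : ℝ := Real.smoothTransition (s + 2) * Real.smoothTransition (2 - s)

/-- The profile of the cutoff in Hardy's inequality: `1` on `[-2, 0]`, `0` outside `[-3, 1]`. -/
def hardyCut (s : ℝ) : ℝ := Real.smoothTransition (s + 3) * Real.smoothTransition (1 - s)

/-- The profile of the weight in Hardy's inequality. -/
def hardyWeight (s : ℝ) : ℝ := hardyCut s ^ 2 * (s + 3)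

theorem contDiff_plateau : ContDiff ℝ ∞ plateau :=
  (Real.smoothTransition.contDiff.comp (contDiff_id.add contDiff_const)).mul
    (Real.smoothTransition.contDiff.comp (contDiff_const.sub contDiff_id))

theorem contDiff_hardyCut : ContDiff ℝ ∞ hardyCut :=
  (Real.smoothTransition.contDiff.comp (contDiff_id.add contDiff_const)).mul
    (Real.smoothTransition.contDiff.comp (contDiff_const.sub contDiff_id))

theorem contDiff_hardyWeight : ContDiff ℝ ∞ hardyWeight :=
  (contDiff_hardyCut.pow 2).mul (contDiff_id.add contDiff_const)

theorem plateau_nonneg (s : ℝ) : 0 ≤ plateau s :=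
  mul_nonneg (Real.smoothTransition.nonneg _) (Real.smoothTransition.nonneg _)

theorem plateau_le_one (s : ℝ) : plateau s ≤ 1 :=
  mul_le_one₀ (Real.smoothTransition.le_one _) (Real.smoothTransition.nonneg _)
    (Real.smoothTransition.le_one _)

theorem plateau_eq_one {s : ℝ} (hs : |s| ≤ 1) : plateau s = 1 := by
  obtain ⟨h1, h2⟩ := abs_le.1 hs
  rw [plateau, Real.smoothTransition.one_of_one_le (by linarith),
    Real.smoothTransition.one_of_one_le (by linarith), one_mul]

theorem plateau_eq_zero {s : ℝ} (hs : 2 ≤ |s|) : plateau s = 0 := by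
  rcases le_abs'.1 hs with h | h
  · rw [plateau, Real.smoothTransition.zero_of_nonpos (by linarith), zero_mul]
  · rw [plateau, Real.smoothTransition.zero_of_nonpos (x := 2 - s) (by linarith), mul_zero]

theorem deriv_plateau_eq_zero {s : ℝ} (hs : |s| < 1 ∨ 2 < |s|) : deriv plateau s = 0 := by
  rcases hs with hs | hs
  · have : plateau =ᶠ[𝓝 s] fun _ => (1 : ℝ) := by
      filter_upwards [(isOpen_lt continuous_abs continuous_const).mem_nhds hs] with y hy
      exact plateau_eq_one (le_of_lt hy)
    rw [this.deriv_eq, deriv_const]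
  · have : plateau =ᶠ[𝓝 s] fun _ => (0 : ℝ) := by
      filter_upwards [(isOpen_lt continuous_const continuous_abs).mem_nhds hs] with y hy
      exact plateau_eq_zero (le_of_lt hy)
    rw [this.deriv_eq, deriv_const]

theorem hardyCut_nonneg (s : ℝ) : 0 ≤ hardyCut s :=
  mul_nonneg (Real.smoothTransition.nonneg _) (Real.smoothTransition.nonneg _)

theorem hardyCut_le_one (s : ℝ) : hardyCut s ≤ 1 :=
  mul_le_one₀ (Real.smoothTransition.le_one _) (Real.smoothTransition.nonneg _)
    (Real.smoothTransition.le_one _)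

theorem hardyCut_eq_one {s : ℝ} (h1 : -2 ≤ s) (h2 : s ≤ 0) : hardyCut s = 1 := by
  rw [hardyCut, Real.smoothTransition.one_of_one_le (by linarith),
    Real.smoothTransition.one_of_one_le (by linarith), one_mul]

theorem hardyCut_eq_zero {s : ℝ} (hs : s ≤ -3 ∨ 1 ≤ s) : hardyCut s = 0 := by
  rcases hs with h | h
  · rw [hardyCut, Real.smoothTransition.zero_of_nonpos (by linarith), zero_mul]
  · rw [hardyCut, Real.smoothTransition.zero_of_nonpos (x := 1 - s) (by linarith), mul_zero]

theorem hardyCut_eq_zero' {s : ℝ} (hs : 3 < |s|) : hardyCut s = 0 :=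
  hardyCut_eq_zero ((le_abs'.1 hs.le).imp id fun h => by linarith)

/-- On the support, `s` lies between `-3` and `1`, so the linear factor `s + 3` is at most `4`. -/
theorem abs_hardyWeight_le (s : ℝ) : |hardyWeight s| ≤ 4 * hardyCut s ^ 2 := by
  by_cases hs : s ≤ -3 ∨ 1 ≤ s
  · simp [hardyWeight, hardyCut_eq_zero hs]
  · push Not at hs
    rw [hardyWeight, abs_mul, abs_of_nonneg (sq_nonneg _), abs_of_pos (by linarith), mul_comm]
    gcongr
    linarith

/-- Differentiating the factor `s + 3` gives exactly `hardyCut²`; the remaining term is nonnegative,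
since for `s < 0` the cutoff is nondecreasing and it vanishes for `s ≤ -3`. This is the coercive
term in Hardy's inequality. -/
theorem sq_hardyCut_le_deriv_hardyWeight {s : ℝ} (hs : s < 0) :
    hardyCut s ^ 2 ≤ deriv hardyWeight s := by
  have h1 : HasDerivAt hardyCut (deriv hardyCut s) s :=
    (contDiff_hardyCut.differentiable (by simp) s).hasDerivAt
  have h2 := (h1.pow 2).mul ((hasDerivAt_id s).add_const 3)
  have h3 : deriv hardyWeight s
      = 2 * hardyCut s * deriv hardyCut s * (s + 3) + hardyCut s ^ 2 := by
    have e : hardyWeight = (hardyCut ^ 2) * fun x => id x + 3 := rfl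
    rw [e, h2.deriv]
    simp
  have h4 : 0 ≤ deriv hardyCut s := by
    have : hardyCut =ᶠ[𝓝 s] fun x => Real.smoothTransition (x + 3) := by
      filter_upwards [Iio_mem_nhds hs] with y hy
      rw [hardyCut, Real.smoothTransition.one_of_one_le (x := 1 - y)
        (by linarith [Set.mem_Iio.1 hy]), mul_one]
    rw [this.deriv_eq]
    exact Monotone.deriv_nonneg fun a b hab => Real.smoothTransition.monotone (by linarith)
  rw [h3]
  by_cases hs3 : s ≤ -3
  · simp [hardyCut_eq_zero (Or.inl hs3)]
  · have := hardyCut_nonneg s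
    have : 0 < s + 3 := by linarith [not_le.1 hs3]
    have : 0 ≤ 2 * hardyCut s * deriv hardyCut s * (s + 3) := by positivity
    linarith

theorem exists_abs_deriv_le {h : ℝ → ℝ} (hh : ContDiff ℝ ∞ h) (h0 : ∀ s, 3 < |s| → h s = 0) :
    ∃ C : ℝ, 0 ≤ C ∧ ∀ s, |deriv h s| ≤ C := by
  have hc : HasCompactSupport h := by
    refine HasCompactSupport.of_support_subset_isCompact (isCompact_Icc (a := -3) (b := 3))
      fun s hs => ?_
    by_contra h'
    exact hs (h0 s (by rw [Set.mem_Icc, ← abs_le] at h'; exact not_le.1 h'))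
  obtain ⟨C, hC⟩ := (hh.continuous_deriv (by simp)).bounded_above_of_compact_support hc.deriv
  exact ⟨C, (norm_nonneg _).trans (hC 0), hC⟩

/-! ### Hardy's inequality -/

/-- The density of the square of the energy norm. -/
def energyDensity (p : WithLp 2 (Hsp n × Ksp n)) (q : Pt n) : ℝ :=
  q.2 * ‖p.fst q‖ ^ 2 + ∑ o, ‖p.snd o q‖ ^ 2

theorem norm_wt_mul_sq {q : Pt n} (hq : q ∈ (Om n : Set (Pt n))) (c : ℂ) :
    ‖(wt (none : Option (Fin n)) q.2 : ℂ) * c‖ ^ 2 = q.2 * ‖c‖ ^ 2 := by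
  rw [norm_mul, mul_pow, Complex.norm_real, Real.norm_of_nonneg (wt_pos _ hq).le, wt_none_sq hq]

theorem integrable_energyDensity (p : WithLp 2 (Hsp n × Ksp n)) :
    Integrable (energyDensity p) (muO n) := by
  refine Integrable.add ?_ (integrable_finsetSum _ fun o _ => ?_)
  · have h := memLp_zMeasure_iff.1 (Lp.memLp p.fst)
    refine ((memLp_two_iff_integrable_sq_norm h.1).1 h).congr ?_
    filter_upwards [ae_muO_mem] with q hq using norm_wt_mul_sq hq _
  · have h := Lp.memLp (p.snd o)
    exact (memLp_two_iff_integrable_sq_norm h.1).1 h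

theorem energyDensity_nonneg (p : WithLp 2 (Hsp n × Ksp n)) {q : Pt n}
    (hq : q ∈ (Om n : Set (Pt n))) : 0 ≤ energyDensity p q := by
  have : (0 : ℝ) < q.2 := hq
  unfold energyDensity
  positivity

theorem weighted_le_energyDensity (p : WithLp 2 (Hsp n × Ksp n)) (q : Pt n) :
    q.2 * ‖p.fst q‖ ^ 2 ≤ energyDensity p q :=
  le_add_of_nonneg_right (by positivity)

theorem sq_snd_le_energyDensity (p : WithLp 2 (Hsp n × Ksp n)) {q : Pt n}
    (hq : q ∈ (Om n : Set (Pt n))) (o : Option (Fin n)) :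
    ‖p.snd o q‖ ^ 2 ≤ energyDensity p q := by
  have h0 : (0 : ℝ) < q.2 := hq
  have h1 := Finset.single_le_sum (f := fun o => ‖p.snd o q‖ ^ 2)
    (fun _ _ => by positivity) (Finset.mem_univ o)
  have h2 : 0 ≤ q.2 * ‖p.fst q‖ ^ 2 := by positivity
  unfold energyDensity
  linarith

/-- Here `U = |u|`, `k = z^(1/2) |∂_z u|`, `T = hardyCut²`, `B` is the bump in `x`, and `l`, `l'`
are the weight and its derivative at `s = log z / R`. For `s < 0` the bound `l' ≥ T` produces `T B
U² / z`; for `s ≥ 0` one has `z ≥ 1`, so `U² / z ≤ z U²` and everything goes into the last term. The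
mixed term is absorbed by completing the square: `8 R q k ≤ q² / 2 + 32 R² k²` with `q = U / w`. -/
theorem hardy_pointwise {T B R U k z w r l l' C s : ℝ} (hT0 : 0 ≤ T) (hT1 : T ≤ 1) (hB0 : 0 ≤ B)
    (hB1 : B ≤ 1) (hR : 0 < R) (hU : 0 ≤ U) (hw : 0 < w) (hwz : w ^ 2 = z)
    (hr : |r| ≤ U * k) (hl : |l| ≤ 4 * T) (hl' : s < 0 → T ≤ l') (hC0 : 0 ≤ C) (hC : |l'| ≤ C)
    (hs : 0 ≤ s → 1 ≤ z) :
    1 / 2 * (T * B * (U ^ 2 / z))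
      ≤ R * (2 * (l * B) * (r / w) + B * (l' * (z⁻¹ / R)) * U ^ 2) + 32 * R ^ 2 * k ^ 2
        + (C + 1) * (z * U ^ 2) := by
  subst hwz
  set q := U / w
  have hq0 : 0 ≤ q := by positivity
  have e1 : U ^ 2 / w ^ 2 = q ^ 2 := by simp only [q]; field_simp
  have e2 : R * (2 * (l * B) * (r / w) + B * (l' * ((w ^ 2)⁻¹ / R)) * U ^ 2)
      = 2 * R * B * (l * (r / w)) + B * l' * q ^ 2 := by
    simp only [q]
    field_simp
  have hρ : |r / w| ≤ q * k := by
    rw [abs_div, abs_of_pos hw, div_le_iff₀ hw]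
    calc |r| ≤ U * k := hr
      _ = q * k * w := by simp only [q]; field_simp
  have h1 : -(4 * T * (q * k)) ≤ l * (r / w) := by
    have : |l * (r / w)| ≤ 4 * T * (q * k) := by
      rw [abs_mul]
      exact mul_le_mul hl hρ (abs_nonneg _) (by positivity)
    exact (abs_le.1 this).1
  have h2 : -(8 * R * T * B * (q * k)) ≤ 2 * R * B * (l * (r / w)) := by
    have := mul_le_mul_of_nonneg_left h1 (by positivity : 0 ≤ 2 * R * B)
    linarith
  have hTB : T * B ≤ 1 := mul_le_one₀ hT1 hB0 hB1
  have hTB0 : 0 ≤ T * B := mul_nonneg hT0 hB0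
  have h3 : 1 / 2 * (T * B * q ^ 2)
      ≤ T * B * q ^ 2 - 8 * R * T * B * (q * k) + 32 * R ^ 2 * k ^ 2 := by
    have a1 := mul_nonneg hTB0 (sq_nonneg (q - 8 * R * k))
    have a2 : 0 ≤ (1 - T * B) * (R ^ 2 * k ^ 2) :=
      mul_nonneg (by linarith) (by positivity)
    nlinarith
  rw [e1, e2]
  have hz0 : 0 ≤ w ^ 2 * U ^ 2 := by positivity
  rcases lt_or_ge s 0 with h | h
  · have h4 : T * B * q ^ 2 ≤ B * l' * q ^ 2 := by
      have := mul_le_mul_of_nonneg_right (hl' h) (by positivity : 0 ≤ B * q ^ 2)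
      linarith
    have h5 : 0 ≤ (C + 1) * (w ^ 2 * U ^ 2) := by positivity
    linarith
  · have hz := hs h
    have hq2 : q ^ 2 ≤ w ^ 2 * U ^ 2 := by
      rw [← e1, div_le_iff₀ (by positivity)]
      nlinarith [sq_nonneg U, mul_nonneg (sq_nonneg U) (by nlinarith : 0 ≤ (w ^ 2) ^ 2 - 1)]
    have h4 : -(C * (w ^ 2 * U ^ 2)) ≤ B * l' * q ^ 2 := by
      have a1 : |B * l' * q ^ 2| ≤ C * (w ^ 2 * U ^ 2) := by
        rw [abs_mul, abs_mul, abs_of_nonneg hB0, abs_of_nonneg (sq_nonneg q)]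
        refine mul_le_mul ?_ hq2 (sq_nonneg q) hC0
        calc B * |l'| ≤ 1 * |l'| := mul_le_mul_of_nonneg_right hB1 (abs_nonneg _)
          _ ≤ C := by linarith
      exact (abs_le.1 a1).1
    have h5 : T * B * q ^ 2 ≤ w ^ 2 * U ^ 2 :=
      (mul_le_of_le_one_left (sq_nonneg q) hTB).trans hq2
    linarith

theorem hardyWeight_eq_zero {s : ℝ} (hs : 3 < |s|) : hardyWeight s = 0 := by
  rw [hardyWeight, hardyCut_eq_zero' hs]
  ring

theorem bumpX_nonneg (x : EuclideanSpace ℝ (Fin n)) : 0 ≤ bumpX n x := (bumpX n).nonneg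

theorem bumpX_le_one (x : EuclideanSpace ℝ (Fin n)) : bumpX n x ≤ 1 := (bumpX n).le_one

/-- The integrand on the left of Hardy's inequality. -/
def hardyDensity (p : WithLp 2 (Hsp n × Ksp n)) (R : ℝ) (q : Pt n) : ℝ :=
  hardyCut (Real.log q.2 / R) ^ 2 * bumpX n (Real.exp (-2 * R) • q.1) * (‖p.fst q‖ ^ 2 / q.2)

theorem integrable_hardyDensity (p : WithLp 2 (Hsp n × Ksp n)) {R : ℝ} (hR : 0 < R) :
    Integrable (hardyDensity p R) (muO n) := by
  have hu := isL2loc_Hsp p.fst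
  have h := (hu.conj.integrable_mul (hu.continuousOn_mul continuousOn_inv_snd)
    (cut (fun s => hardyCut s ^ 2) (contDiff_hardyCut.pow 2)
      (fun s hs => by simp [hardyCut_eq_zero' hs]) R hR)).re
  refine h.congr ?_
  filter_upwards [ae_muO_mem] with q hq
  rw [cut_apply _ _ _ hq]
  have e : conj (p.fst q) * ((cutFun (fun s => hardyCut s ^ 2) R q : ℂ)
      * ((q.2 : ℂ)⁻¹ * p.fst q)) = ((hardyDensity p R q : ℝ) : ℂ) := by
    have := Complex.conj_mul' (p.fst q)
    rw [hardyDensity, cutFun]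
    push_cast
    rw [← this]
    ring
  rw [e]
  exact Complex.ofReal_re _

variable (n) in
/-- Hardy's inequality near `z = 0`, on a logarithmic scale. -/
theorem exists_hardy : ∃ C : ℝ, 0 ≤ C ∧ ∀ p : WithLp 2 (Hsp n × Ksp n), EnergyPair p →
    ∀ R : ℝ, 1 ≤ R →
      ∫ q, hardyDensity p R q ∂muO n ≤ C * R ^ 2 * ∫ q, energyDensity p q ∂muO n := by
  obtain ⟨C, hC0, hC⟩ := exists_abs_deriv_le contDiff_hardyWeight fun s => hardyWeight_eq_zero
  -- The pointwise bound contributes `C + 1` from the mass term and `32` from the gradient term; the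
  -- factor `2` undoes the `1/2` on its left side.
  refine ⟨2 * (C + 33), by positivity, fun p hp R hR1 => ?_⟩
  have hR : 0 < R := by linarith
  set u := p.fst
  set k := p.snd none
  set g : Option (Fin n) → Pt n → ℂ := fun o q => p.snd o q / wt o q.2
  set χ : 𝓓(Om n, ℂ) := cut hardyWeight contDiff_hardyWeight (fun _ => hardyWeight_eq_zero) R hR
  have hu := isL2loc_Hsp u
  have hg := (hp.hasWeakPd none).1
  have iA := hu.conj.integrable_mul hg χ
  have iB := hu.conj.integrable_mul hu (pdTest (dir none) χ)
  have iC := hg.conj.integrable_mul hu χ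
  have h0 := integral_pd_normSq hu hp.hasWeakPd χ none
  -- This is `∂_z (χ |u|²)` expanded by the product rule; its integral vanishes by
  -- `integral_pd_normSq`.
  set X : Pt n → ℂ := fun q => (conj (u q) * (χ q * g none q)
    + conj (u q) * (pd (dir none) χ q * u q)) + conj (g none q) * (χ q * u q)
  have iX : Integrable X (muO n) := (iA.add iB).add iC
  have hX : ∫ q, X q ∂muO n = 0 := by
    have e : ∫ q, X q ∂muO n = ∫ q, (conj (u q) * (χ q * g none q)
        + conj (u q) * (pd (dir none) χ q * u q)) ∂muO n
        + ∫ q, conj (g none q) * (χ q * u q) ∂muO n := integral_add (iA.add iB) iC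
    rw [e, ← neg_eq_iff_add_eq_zero.1 h0.symm]
    simp only [mul_add]
    ring
  have hXre : ∫ q, (X q).re ∂muO n = 0 := by
    have := integral_re iX
    rw [hX] at this
    simpa using this
  have hpt : ∀ᵐ q ∂muO n, 1 / 2 * hardyDensity p R q
      ≤ R * (X q).re + (C + 33) * R ^ 2 * energyDensity p q := by
    filter_upwards [ae_muO_mem] with q hq
    have hz : (0 : ℝ) < q.2 := hq
    have hXq : (X q).re = 2 * (hardyWeight (Real.log q.2 / R) * bumpX n (Real.exp (-2 * R) • q.1))
        * ((conj (u q) * k q).re / wt (none : Option (Fin n)) q.2)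
        + bumpX n (Real.exp (-2 * R) • q.1)
          * (deriv hardyWeight (Real.log q.2 / R) * (q.2⁻¹ / R)) * ‖u q‖ ^ 2 := by
      have e1 : X q = (χ q * ((conj (u q) * k q) / wt (none : Option (Fin n)) q.2
          + conj ((conj (u q) * k q) / wt (none : Option (Fin n)) q.2)))
          + pd (dir none) χ q * (conj (u q) * u q) := by
        simp only [X, g, map_div₀, map_mul, Complex.conj_conj, Complex.conj_ofReal]
        ring
      rw [e1, Complex.add_conj, Complex.conj_mul', pd_none_cut _ _ _ hq, cut_apply _ _ _ hq,
        Complex.div_ofReal_re, cutFun]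
      norm_cast
      ring
    have hr : |(conj (u q) * k q).re| ≤ ‖u q‖ * ‖k q‖ := by
      refine (Complex.abs_re_le_norm _).trans ?_
      rw [norm_mul, RCLike.norm_conj]
    have hmain := hardy_pointwise (T := hardyCut (Real.log q.2 / R) ^ 2)
      (B := bumpX n (Real.exp (-2 * R) • q.1)) (s := Real.log q.2 / R) (sq_nonneg _)
      (pow_le_one₀ (hardyCut_nonneg _) (hardyCut_le_one _)) (bumpX_nonneg _) (bumpX_le_one _) hR
      (w := wt (none : Option (Fin n)) q.2) (norm_nonneg (u q)) (wt_pos _ hq) (wt_none_sq hq) hr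
      (abs_hardyWeight_le _) sq_hardyCut_le_deriv_hardyWeight hC0 (hC _) fun hs => by
        have : 0 ≤ Real.log q.2 := by
          by_contra hneg
          exact absurd hs (not_le.2 (div_neg_of_neg_of_pos (not_le.1 hneg) hR))
        exact (Real.log_nonneg_iff hz).1 this
    rw [hXq]
    refine hmain.trans ?_
    have h1 := weighted_le_energyDensity p q
    have h2 := sq_snd_le_energyDensity p hq none
    have h3 := energyDensity_nonneg p hq
    have h4 : 1 ≤ R ^ 2 := one_le_pow₀ hR1
    have h5 : 32 * R ^ 2 * ‖k q‖ ^ 2 ≤ 32 * R ^ 2 * energyDensity p q := by gcongr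
    have h6 : (C + 1) * (q.2 * ‖u q‖ ^ 2) ≤ (C + 1) * energyDensity p q := by gcongr
    have h7 : (C + 1) * energyDensity p q ≤ R ^ 2 * ((C + 1) * energyDensity p q) :=
      le_mul_of_one_le_left (by positivity) h4
    linarith
  have hint : ∫ q, 1 / 2 * hardyDensity p R q ∂muO n
      ≤ ∫ q, (R * (X q).re + (C + 33) * R ^ 2 * energyDensity p q) ∂muO n :=
    integral_mono_ae ((integrable_hardyDensity p hR).const_mul (1 / 2))
      ((iX.re.const_mul R).add ((integrable_energyDensity p).const_mul ((C + 33) * R ^ 2))) hpt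
  have e3 : ∫ q, (R * (X q).re + (C + 33) * R ^ 2 * energyDensity p q) ∂muO n
      = R * ∫ q, (X q).re ∂muO n + (C + 33) * R ^ 2 * ∫ q, energyDensity p q ∂muO n := by
    rw [← integral_const_mul, ← integral_const_mul]
    exact integral_add (iX.re.const_mul R) ((integrable_energyDensity p).const_mul _)
  rw [e3, hXre, integral_const_mul] at hint
  linarith

/-! ### Density of the test functions -/

theorem plateau_eq_zero' {s : ℝ} (hs : 3 < |s|) : plateau s = 0 := plateau_eq_zero (by linarith)

/-- The cutoff function `plateau (log z / R) b (e^(-2R) x)`. -/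
def mainCut (n : ℕ) (R : ℝ) (hR : 0 < R) : 𝓓(Om n, ℂ) :=
  cut plateau contDiff_plateau (fun _ => plateau_eq_zero') R hR

-- The `z`-derivative lives on `1 ≤ |s| ≤ 2` with `s = log z / R`, and its weighted square is of
-- size `1 / (z R²)`: for `s ≤ -1` the Hardy cutoff equals `1` and controls it, for `s ≥ 1` it is at
-- most `z`. The `x`-derivative carries the factor `e^(-2R)`, which beats the singular weight
-- `z^(-1/n)` on the support of the plateau.
variable (n) in
theorem exists_wt_sq_mul_pd_mainCut_le : ∃ C : ℝ, 0 ≤ C ∧ ∀ (R : ℝ) (hR : 0 < R), 1 ≤ R →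
    ∀ q ∈ (Om n : Set (Pt n)), ∀ o : Option (Fin n),
      wt o q.2 ^ 2 * ‖pd (dir o) (mainCut n R hR) q‖ ^ 2
        ≤ C * (hardyCut (Real.log q.2 / R) ^ 2 * bumpX n (Real.exp (-2 * R) • q.1) / (q.2 * R ^ 2)
          + q.2) := by
  obtain ⟨Ca, hCa0, hCa⟩ := exists_abs_deriv_le contDiff_plateau fun s => plateau_eq_zero'
  obtain ⟨Cb, hCb⟩ := exists_fderiv_bumpX_le n
  refine ⟨Ca ^ 2 + Cb ^ 2, by positivity, fun R hR hR1 q hq o => ?_⟩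
  have hz : (0 : ℝ) < q.2 := hq
  set s := Real.log q.2 / R
  set B := bumpX n (Real.exp (-2 * R) • q.1) with hBdef
  have hB0 : 0 ≤ B := bumpX_nonneg _
  have hB1 : B ≤ 1 := bumpX_le_one _
  have hR2 : 1 ≤ R ^ 2 := one_le_pow₀ hR1
  have hnn : 0 ≤ hardyCut s ^ 2 * B / (q.2 * R ^ 2) := by positivity
  cases o with
  | none =>
    rw [mainCut, pd_none_cut _ _ _ hq, Complex.norm_real, Real.norm_eq_abs, sq_abs, wt_none_sq hz]
    have e : q.2 * (B * (deriv plateau s * (q.2⁻¹ / R))) ^ 2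
        = deriv plateau s ^ 2 * (B ^ 2 / (q.2 * R ^ 2)) := by
      field_simp
    rw [e]
    have hd : deriv plateau s ^ 2 ≤ Ca ^ 2 := by
      rw [← sq_abs]
      exact pow_le_pow_left₀ (abs_nonneg _) (hCa s) 2
    have hB2 : B ^ 2 ≤ B := by nlinarith
    by_cases hs : |s| < 1 ∨ 2 < |s|
    · rw [deriv_plateau_eq_zero hs, zero_pow two_ne_zero, zero_mul]
      positivity
    · push Not at hs
      have key : B ^ 2 / (q.2 * R ^ 2) ≤ hardyCut s ^ 2 * B / (q.2 * R ^ 2) + q.2 := by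
        rcases le_abs'.1 hs.1 with h | h
        · rw [hardyCut_eq_one (abs_le.1 hs.2).1 (by linarith), one_pow, one_mul]
          have : B ^ 2 / (q.2 * R ^ 2) ≤ B / (q.2 * R ^ 2) := by gcongr
          linarith
        · have hz1 : 1 ≤ q.2 := by
            have : R ≤ Real.log q.2 := by rwa [le_div_iff₀ hR, one_mul] at h
            exact (Real.log_nonneg_iff hz).1 (by linarith)
          have : B ^ 2 / (q.2 * R ^ 2) ≤ q.2 := by
            rw [div_le_iff₀ (by positivity)]
            have h1 : 1 ≤ q.2 * (q.2 * R ^ 2) := by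
              have := one_le_mul_of_one_le_of_one_le hz1 hR2
              exact one_le_mul_of_one_le_of_one_le hz1 this
            exact (pow_le_one₀ hB0 hB1).trans h1
          linarith
      calc deriv plateau s ^ 2 * (B ^ 2 / (q.2 * R ^ 2))
          ≤ Ca ^ 2 * (hardyCut s ^ 2 * B / (q.2 * R ^ 2) + q.2) := by
            apply mul_le_mul hd key (by positivity) (by positivity)
        _ ≤ _ := by
            refine mul_le_mul_of_nonneg_right ?_ (by positivity)
            linarith [sq_nonneg Cb]
  | some i =>
    rw [mainCut, pd_some_cut _ _ _ i hq, Complex.norm_real, Real.norm_eq_abs, sq_abs,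
      wt_some_sq i hz]
    change q.2 ^ (-(1 / (n : ℝ))) * (plateau s * _) ^ 2 ≤ _
    set d := fderiv ℝ (bumpX n) (Real.exp (-2 * R) • q.1) (EuclideanSpace.single i 1)
    have hd : d ^ 2 ≤ Cb ^ 2 := by
      rw [← sq_abs]
      exact pow_le_pow_left₀ (abs_nonneg _) (hCb _ i) 2
    by_cases hs : 2 ≤ |s|
    · rw [plateau_eq_zero hs, zero_mul, zero_pow two_ne_zero, mul_zero]
      positivity
    · have hs2 : -2 < s := (abs_lt.1 (not_le.1 hs)).1
      have hlog : -(2 * R) ≤ Real.log q.2 := by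
        have := (lt_div_iff₀ hR).1 hs2
        linarith
      have hn1 : (1 : ℝ) ≤ n := by exact_mod_cast Nat.one_le_of_lt i.2
      have hn2 : 1 / (n : ℝ) ≤ 1 := by rw [div_le_one (by linarith)]; exact hn1
      have hn3 : 0 ≤ 1 / (n : ℝ) := by positivity
      -- In logarithms this reads `(1 + 1/n) log z ≥ -4R`, which follows from `log z ≥ -2R` and `1/n
      -- ≤ 1`. The scale `e^(2R)` of the cutoff in `x` is chosen for this.
      have hzz : q.2 ^ (-(1 / (n : ℝ))) * Real.exp (-2 * R) ^ 2 ≤ q.2 := by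
        rw [Real.rpow_def_of_pos hz, ← Real.exp_nat_mul, ← Real.exp_add]
        nth_rewrite 2 [← Real.exp_log hz]
        refine Real.exp_le_exp.2 ?_
        push_cast
        nlinarith
      have hp : plateau s ^ 2 ≤ 1 := pow_le_one₀ (plateau_nonneg s) (plateau_le_one s)
      have hp0 := sq_nonneg (plateau s)
      calc q.2 ^ (-(1 / (n : ℝ))) * (plateau s * (Real.exp (-2 * R) * d)) ^ 2
          = (plateau s ^ 2 * d ^ 2) * (q.2 ^ (-(1 / (n : ℝ))) * Real.exp (-2 * R) ^ 2) := by ring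
        _ ≤ (1 * Cb ^ 2) * q.2 := by
            apply mul_le_mul (mul_le_mul hp hd (sq_nonneg _) zero_le_one) hzz (by positivity)
              (by positivity)
        _ ≤ _ := by
            rw [one_mul]
            apply mul_le_mul (by linarith [sq_nonneg Ca]) (by linarith) hz.le (by positivity)

/-- The region where the cutoff function is not locally constant. -/
def cutRegion (n : ℕ) (R : ℝ) : Set (Pt n) :=
  {q | R ≤ |Real.log q.2| ∨ Real.exp (2 * R) ≤ ‖q.1‖}

theorem measurableSet_cutRegion (R : ℝ) : MeasurableSet (cutRegion n R) :=
  (measurableSet_le measurable_const (Real.measurable_log.comp measurable_snd).norm).union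
    (measurableSet_le measurable_const measurable_fst.norm)

theorem scaled_norm_lt_one {R : ℝ} {x : EuclideanSpace ℝ (Fin n)}
    (hx : ‖x‖ < Real.exp (2 * R)) : ‖Real.exp (-2 * R) • x‖ < 1 := by
  rw [norm_smul, Real.norm_of_nonneg (Real.exp_pos _).le]
  calc Real.exp (-2 * R) * ‖x‖ < Real.exp (-2 * R) * Real.exp (2 * R) := by gcongr
    _ = 1 := by rw [← Real.exp_add]; simp

theorem pd_mainCut_eq_zero {R : ℝ} (hR : 0 < R) {q : Pt n} (hq : q ∈ (Om n : Set (Pt n)))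
    (hqR : q ∉ cutRegion n R) (o : Option (Fin n)) : pd (dir o) (mainCut n R hR) q = 0 := by
  rw [cutRegion, Set.mem_ofPred_eq, not_or, not_le, not_le] at hqR
  have hs : |Real.log q.2 / R| < 1 := by
    rw [abs_div, abs_of_pos hR, div_lt_one hR]
    exact hqR.1
  cases o with
  | none =>
    rw [mainCut, pd_none_cut _ _ _ hq, deriv_plateau_eq_zero (Or.inl hs)]
    simp
  | some i =>
    rw [mainCut, pd_some_cut _ _ _ i hq, fderiv_bumpX_eq_zero (scaled_norm_lt_one hqR.2)]
    simp

theorem mainCut_eq_one {R : ℝ} (hR : 0 < R) {q : Pt n}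
    (hqR : q ∉ cutRegion n R) : cutFun plateau R q = 1 := by
  rw [cutRegion, Set.mem_ofPred_eq, not_or, not_le, not_le] at hqR
  have hs : |Real.log q.2 / R| ≤ 1 := by
    rw [abs_div, abs_of_pos hR, div_le_one hR]
    exact hqR.1.le
  rw [cutFun, plateau_eq_one hs, one_mul]
  exact (bumpX n).one_of_mem_closedBall (mem_closedBall_zero_iff.2 (scaled_norm_lt_one hqR.2).le)

theorem eventually_notMem_cutRegion (q : Pt n) : ∀ᶠ R : ℕ in atTop, q ∉ cutRegion n R := by
  have h1 : ∀ᶠ R : ℕ in atTop, |Real.log q.2| < R :=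
    tendsto_natCast_atTop_atTop.eventually_gt_atTop _
  have h2 : ∀ᶠ R : ℕ in atTop, ‖q.1‖ < R := tendsto_natCast_atTop_atTop.eventually_gt_atTop _
  filter_upwards [h1, h2] with R hR1 hR2
  rw [cutRegion, Set.mem_ofPred_eq, not_or, not_le, not_le]
  refine ⟨hR1, hR2.trans_le ?_⟩
  have := Real.add_one_le_exp (2 * (R : ℝ))
  have : (0 : ℝ) ≤ R := Nat.cast_nonneg R
  linarith

/-- Orthogonality to the test pairs extends to the pair of `χ u` and its weighted gradient, with `u
= p.fst`, by approximating `χ u` by test functions. -/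
theorem orthogonal_identity {p : WithLp 2 (Hsp n × Ksp n)} (hp : EnergyPair p)
    (horth : ∀ φ : 𝓓(Om n, ℂ), inner ℂ p (WithLp.toLp 2 (incl n φ, gradMap n φ)) = 0)
    (χ : 𝓓(Om n, ℂ)) :
    ∫ q, (q.2 : ℂ) * conj (p.fst q) * (χ q * p.fst q) ∂muO n
      + ∑ o, ∫ q, (wt o q.2 : ℂ) * conj (p.snd o q)
        * (χ q * (p.snd o q / wt o q.2) + pd (dir o) χ q * p.fst q) ∂muO n = 0 := by
  obtain ⟨φ, h1, h2⟩ := exists_test_approx (isL2loc_Hsp p.fst) hp.hasWeakPd χ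
  have hF0 : IsL2loc fun q : Pt n => (q.2 : ℂ) * conj (p.fst q) :=
    (isL2loc_Hsp p.fst).conj.continuousOn_mul (by fun_prop)
  have hFo : ∀ o, IsL2loc fun q : Pt n => (wt o q.2 : ℂ) * conj (p.snd o q) := fun o =>
    (isL2loc_of_memLp (Lp.memLp (p.snd o))).conj.continuousOn_mul (continuousOn_ofReal_wt o)
  refine tendsto_nhds_unique ((h1 _ hF0).add (tendsto_finsetSum _ fun o _ => h2 o _ (hFo o))) ?_
  refine tendsto_const_nhds.congr fun m => ?_
  rw [← horth (φ m), WithLp.prod_inner_apply, PiLp.inner_apply]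
  congr 1
  · change inner ℂ p.fst (incl n (φ m)) = _
    rw [L2.inner_def, integral_zMeasure]
    refine integral_congr_ae ?_
    filter_upwards [incl_ae (φ m)] with q hq
    rw [RCLike.inner_apply, hq]
    ring
  · refine Finset.sum_congr rfl fun o _ => ?_
    change inner ℂ (p.snd o) (gradMap n (φ m) o) = _
    rw [L2.inner_def]
    refine integral_congr_ae ?_
    filter_upwards [gradMap_ae (φ m) o] with q hq
    rw [RCLike.inner_apply, hq]
    ring

theorem cutFun_plateau_nonneg (R : ℝ) (q : Pt n) : 0 ≤ cutFun plateau R q :=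
  mul_nonneg (plateau_nonneg _) (bumpX_nonneg _)

theorem cutFun_plateau_le_one (R : ℝ) (q : Pt n) : cutFun plateau R q ≤ 1 :=
  mul_le_one₀ (plateau_le_one _) (bumpX_nonneg _) (bumpX_le_one _)

theorem aestronglyMeasurable_cutFun_mul (p : WithLp 2 (Hsp n × Ksp n)) (R : ℝ) :
    AEStronglyMeasurable (fun q => cutFun plateau R q * energyDensity p q) (muO n) :=
  ((contDiffOn_cutFun contDiff_plateau R).continuousOn.aestronglyMeasurable measurableSet_Om).mul
    (integrable_energyDensity p).1

theorem norm_cutFun_mul_le (p : WithLp 2 (Hsp n × Ksp n)) (R : ℝ) {q : Pt n}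
    (hq : q ∈ (Om n : Set (Pt n))) :
    ‖cutFun plateau R q * energyDensity p q‖ ≤ energyDensity p q := by
  have h := energyDensity_nonneg p hq
  rw [Real.norm_of_nonneg (mul_nonneg (cutFun_plateau_nonneg R q) h)]
  exact mul_le_of_le_one_left h (cutFun_plateau_le_one R q)

theorem integrable_cutFun_mul (p : WithLp 2 (Hsp n × Ksp n)) (R : ℝ) :
    Integrable (fun q => cutFun plateau R q * energyDensity p q) (muO n) :=
  (integrable_energyDensity p).mono' (aestronglyMeasurable_cutFun_mul p R) <| by
    filter_upwards [ae_muO_mem] with q hq using norm_cutFun_mul_le p R hq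

theorem tendsto_integral_cutFun_mul (p : WithLp 2 (Hsp n × Ksp n)) :
    Tendsto (fun R : ℕ => ∫ q, cutFun plateau R q * energyDensity p q ∂muO n) atTop
      (𝓝 (∫ q, energyDensity p q ∂muO n)) := by
  refine tendsto_integral_of_dominated_convergence _
    (fun R => aestronglyMeasurable_cutFun_mul p R) (integrable_energyDensity p) (fun R => ?_) ?_
  · filter_upwards [ae_muO_mem] with q hq using norm_cutFun_mul_le p R hq
  · refine .of_forall fun q => tendsto_const_nhds.congr' ?_
    filter_upwards [eventually_notMem_cutRegion q, eventually_gt_atTop 0] with R hR hR0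
    rw [mainCut_eq_one (by exact_mod_cast hR0) hR, one_mul]

theorem tendsto_integral_cutRegion (p : WithLp 2 (Hsp n × Ksp n)) :
    Tendsto (fun R : ℕ => ∫ q, (cutRegion n R).indicator (energyDensity p) q ∂muO n) atTop
      (𝓝 0) := by
  rw [← integral_zero (Pt n) ℝ (μ := muO n)]
  refine tendsto_integral_of_dominated_convergence _
    (fun R => (integrable_energyDensity p).1.indicator (measurableSet_cutRegion R))
    (integrable_energyDensity p).norm (fun R => ?_) ?_
  · exact .of_forall fun q => norm_indicator_le_norm_self _ _
  · refine .of_forall fun q => tendsto_const_nhds.congr' ?_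
    filter_upwards [eventually_notMem_cutRegion q] with R hR
    rw [Set.indicator_of_notMem hR]

theorem mul_le_half_sq_add {δ a b : ℝ} (hδ : 0 < δ) :
    a * b ≤ δ / 2 * a ^ 2 + 1 / (2 * δ) * b ^ 2 := by
  have h : δ / 2 * a ^ 2 + 1 / (2 * δ) * b ^ 2 - a * b = 1 / (2 * δ) * (δ * a - b) ^ 2 := by
    field_simp
    ring
  have : 0 ≤ 1 / (2 * δ) * (δ * a - b) ^ 2 := by positivity
  linarith

/-- The energy estimate for the product of an orthogonal pair with a cutoff function. -/
theorem integral_cutFun_mul_le {p : WithLp 2 (Hsp n × Ksp n)} (hp : EnergyPair p)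
    (horth : ∀ φ : 𝓓(Om n, ℂ), inner ℂ p (WithLp.toLp 2 (incl n φ, gradMap n φ)) = 0)
    {C : ℝ} {R : ℝ} (hR : 0 < R)
    (hC : ∀ q ∈ (Om n : Set (Pt n)), ∀ o : Option (Fin n),
      wt o q.2 ^ 2 * ‖pd (dir o) (mainCut n R hR) q‖ ^ 2
        ≤ C * (hardyCut (Real.log q.2 / R) ^ 2 * bumpX n (Real.exp (-2 * R) • q.1) / (q.2 * R ^ 2)
          + q.2)) (hC0 : 0 ≤ C) {δ : ℝ} (hδ : 0 < δ) :
    ∫ q, cutFun plateau R q * energyDensity p q ∂muO n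
      ≤ 1 / (2 * δ) * ∫ q, (cutRegion n R).indicator (energyDensity p) q ∂muO n
        + δ / 2 * ((n + 1) * C) * (1 / R ^ 2 * ∫ q, hardyDensity p R q ∂muO n
          + ∫ q, energyDensity p q ∂muO n) := by
  set χ := mainCut n R hR
  set Y0 : Pt n → ℂ := fun q => (q.2 : ℂ) * conj (p.fst q) * (χ q * p.fst q)
  set Yo : Option (Fin n) → Pt n → ℂ := fun o q => (wt o q.2 : ℂ) * conj (p.snd o q)
        * (χ q * (p.snd o q / wt o q.2) + pd (dir o) χ q * p.fst q)
  have hu := isL2loc_Hsp p.fst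
  have i0 : Integrable Y0 (muO n) :=
    (hu.conj.continuousOn_mul (F := fun q : Pt n => (q.2 : ℂ)) (by fun_prop)).integrable_mul hu χ
  have io : ∀ o, Integrable (Yo o) (muO n) := fun o => by
    have hk := (isL2loc_of_memLp (Lp.memLp (p.snd o))).conj.continuousOn_mul
      (continuousOn_ofReal_wt o)
    refine ((hk.integrable_mul (hp.hasWeakPd o).1 χ).add
      (hk.integrable_mul hu (pdTest (dir o) χ))).congr (.of_forall fun q => ?_)
    simp only [Yo, Pi.add_apply, coe_pdTest]
    ring
  have iS : Integrable (fun q => ∑ o, Yo o q) (muO n) := integrable_finsetSum _ fun o _ => io o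
  have hY : ∫ q, (Y0 q + ∑ o, Yo o q).re ∂muO n = 0 := by
    have h1 := orthogonal_identity hp horth χ
    rw [← integral_finsetSum _ fun o _ => io o, ← integral_add i0 iS] at h1
    have h2 := integral_re (i0.add iS)
    have h3 : ∫ q, (Y0 q + ∑ o, Yo o q).re ∂muO n = (∫ q, (Y0 q + ∑ o, Yo o q) ∂muO n).re := h2
    rw [h3, h1, Complex.zero_re]
  have ie := integrable_energyDensity p
  have iQ : Integrable ((cutRegion n R).indicator (energyDensity p)) (muO n) :=
    ie.indicator (measurableSet_cutRegion R)
  have ih := integrable_hardyDensity p hR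
  have hpt : ∀ᵐ q ∂muO n, cutFun plateau R q * energyDensity p q
      ≤ (Y0 q + ∑ o, Yo o q).re
        + (1 / (2 * δ) * (cutRegion n R).indicator (energyDensity p) q
        + δ / 2 * ((n + 1) * C) * (1 / R ^ 2 * hardyDensity p R q + energyDensity p q)) := by
    filter_upwards [ae_muO_mem] with q hq
    have hz : (0 : ℝ) < q.2 := hq
    have hen := energyDensity_nonneg p hq
    set c := cutFun plateau R q
    have hχ : χ q = (c : ℂ) := cut_apply _ _ _ hq
    have e0 : (Y0 q).re = c * (q.2 * ‖p.fst q‖ ^ 2) := by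
      have : Y0 q = ((c * (q.2 * ‖p.fst q‖ ^ 2) : ℝ) : ℂ) := by
        simp only [Y0, hχ]
        push_cast
        rw [← Complex.conj_mul' (p.fst q)]
        ring
      rw [this, Complex.ofReal_re]
    -- What separates `Yo` from the cut-off energy is the commutator term, in which the derivative
    -- falls on `χ`.
    have eo : ∀ o, c * ‖p.snd o q‖ ^ 2 - (Yo o q).re
        ≤ (wt o q.2 * ‖pd (dir o) χ q‖ * ‖p.fst q‖) * ‖p.snd o q‖ := fun o => by
      have hw := ofReal_wt_ne_zero o hq
      have : Yo o q = ((c * ‖p.snd o q‖ ^ 2 : ℝ) : ℂ)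
          + (wt o q.2 : ℂ) * conj (p.snd o q) * (pd (dir o) χ q * p.fst q) := by
        simp only [Yo, hχ]
        push_cast
        rw [← Complex.conj_mul' (p.snd o q)]
        field_simp
      rw [this, Complex.add_re, Complex.ofReal_re]
      have h1 := (abs_le.1 (Complex.abs_re_le_norm
        ((wt o q.2 : ℂ) * conj (p.snd o q) * (pd (dir o) χ q * p.fst q)))).1
      rw [norm_mul, norm_mul, norm_mul, RCLike.norm_conj, Complex.norm_real,
        Real.norm_of_nonneg (wt_pos o hq).le] at h1
      linarith
    -- Young's inequality puts the large factor `1 / (2δ)` on the gradient, whose mass in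
    -- `cutRegion` tends to `0`, and the small factor `δ / 2` on the commutator, which is merely
    -- bounded through Hardy's inequality.
    have eo' : ∀ o, c * ‖p.snd o q‖ ^ 2 - (Yo o q).re
        ≤ 1 / (2 * δ) * (cutRegion n R).indicator (fun q => ‖p.snd o q‖ ^ 2) q
          + δ / 2 * (C * (1 / R ^ 2 * hardyDensity p R q + energyDensity p q)) := fun o => by
      refine (eo o).trans ?_
      have hnn : 0 ≤ 1 / R ^ 2 * hardyDensity p R q + energyDensity p q := by
        have : 0 ≤ hardyDensity p R q :=
          mul_nonneg (mul_nonneg (sq_nonneg _) (bumpX_nonneg _)) (by positivity)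
        positivity
      by_cases hqQ : q ∈ cutRegion n R
      · rw [Set.indicator_of_mem hqQ, add_comm]
        refine (mul_le_half_sq_add hδ).trans ?_
        gcongr
        have h1 := mul_le_mul_of_nonneg_right (hC q hq o) (sq_nonneg ‖p.fst q‖)
        have h2 := weighted_le_energyDensity p q
        calc (wt o q.2 * ‖pd (dir o) χ q‖ * ‖p.fst q‖) ^ 2
            = wt o q.2 ^ 2 * ‖pd (dir o) χ q‖ ^ 2 * ‖p.fst q‖ ^ 2 := by ring
          _ ≤ _ := h1
          _ = C * (1 / R ^ 2 * hardyDensity p R q + q.2 * ‖p.fst q‖ ^ 2) := by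
            rw [hardyDensity]
            field_simp
          _ ≤ _ := by gcongr
      · rw [Set.indicator_of_notMem hqQ, pd_mainCut_eq_zero hR hq hqQ]
        simp only [norm_zero, mul_zero, zero_mul, zero_add]
        positivity
    have hsum := Finset.sum_le_sum fun o (_ : o ∈ Finset.univ) => eo' o
    rw [Finset.sum_sub_distrib, ← Finset.mul_sum, Finset.sum_add_distrib, ← Finset.mul_sum,
      Finset.sum_const, Finset.card_univ, Fintype.card_option, Fintype.card_fin, nsmul_eq_mul,
      ← Complex.re_sum] at hsum
    have hind : ∑ o, (cutRegion n R).indicator (fun q => ‖p.snd o q‖ ^ 2) q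
        ≤ (cutRegion n R).indicator (energyDensity p) q := by
      by_cases hqQ : q ∈ cutRegion n R
      · simp only [Set.indicator_of_mem hqQ]
        exact le_add_of_nonneg_left (by positivity)
      · simp [Set.indicator_of_notMem hqQ]
    have hind' := mul_le_mul_of_nonneg_left hind (by positivity : 0 ≤ 1 / (2 * δ))
    rw [Complex.add_re, e0, energyDensity, mul_add]
    rw [energyDensity] at hsum
    push_cast at hsum
    linarith
  have iH : Integrable (fun q => 1 / R ^ 2 * hardyDensity p R q + energyDensity p q) (muO n) :=
    (ih.const_mul _).add ie
  have iR : Integrable (fun q => 1 / (2 * δ) * (cutRegion n R).indicator (energyDensity p) q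
        + δ / 2 * ((n + 1) * C) * (1 / R ^ 2 * hardyDensity p R q + energyDensity p q)) (muO n) :=
    (iQ.const_mul _).add (iH.const_mul _)
  have iY : Integrable (fun q => (Y0 q + ∑ o, Yo o q).re) (muO n) := (i0.add iS).re
  have hint := integral_mono_ae (integrable_cutFun_mul p R) (iY.add iR) hpt
  refine hint.trans (le_of_eq ?_)
  rw [integral_add' iY iR, hY, zero_add, integral_add (iQ.const_mul _) (iH.const_mul _),
    integral_const_mul, integral_const_mul, integral_add (ih.const_mul _) ie, integral_const_mul]

/-- The test functions are dense in the graph of the weak gradient. -/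
theorem EnergyPair.eq_zero_of_orthogonal {p : WithLp 2 (Hsp n × Ksp n)} (hp : EnergyPair p)
    (horth : ∀ φ : 𝓓(Om n, ℂ), inner ℂ p (WithLp.toLp 2 (incl n φ, gradMap n φ)) = 0) :
    p = 0 := by
  obtain ⟨C₁, hC₁0, hC₁⟩ := exists_wt_sq_mul_pd_mainCut_le n
  obtain ⟨C₂, hC₂0, hC₂⟩ := exists_hardy n
  set E := ∫ q, energyDensity p q ∂muO n with hEdef
  have hE0 : 0 ≤ E := integral_nonneg_of_ae <| by
    filter_upwards [ae_muO_mem] with q hq using energyDensity_nonneg p hq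
  set M : ℝ := (n + 1) * C₁ * (C₂ + 1)
  have hM0 : 0 ≤ M := by positivity
  -- Any `δ` with `δ M < 2` would do; this one gives `E ≤ E / 2` after `R → ∞`.
  set δ : ℝ := 1 / (M + 1)
  have hδ : 0 < δ := by positivity
  have hle : E ≤ δ / 2 * M * E := by
    have hlim : Tendsto (fun R : ℕ => 1 / (2 * δ)
        * ∫ q, (cutRegion n R).indicator (energyDensity p) q ∂muO n + δ / 2 * M * E) atTop
        (𝓝 (1 / (2 * δ) * 0 + δ / 2 * M * E)) :=
      ((tendsto_integral_cutRegion p).const_mul _).add_const _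
    rw [mul_zero, zero_add] at hlim
    refine le_of_tendsto_of_tendsto (tendsto_integral_cutFun_mul p) hlim ?_
    filter_upwards [eventually_ge_atTop 1] with R hR
    have hR1 : (1 : ℝ) ≤ R := by exact_mod_cast hR
    have hR0 : (0 : ℝ) < R := by linarith
    refine (integral_cutFun_mul_le hp horth hR0 (hC₁ R hR0 hR1) hC₁0 hδ).trans ?_
    have h1 := hC₂ p hp R hR1
    have h2 : 1 / (R : ℝ) ^ 2 * ∫ q, hardyDensity p R q ∂muO n ≤ C₂ * E := by
      rw [one_div, inv_mul_le_iff₀ (by positivity)]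
      linarith
    have h3 : δ / 2 * ((n + 1) * C₁) * (1 / (R : ℝ) ^ 2 * ∫ q, hardyDensity p R q ∂muO n + E)
        ≤ δ / 2 * ((n + 1) * C₁) * (C₂ * E + E) := by gcongr
    have h4 : δ / 2 * ((n + 1) * C₁) * (C₂ * E + E) = δ / 2 * M * E := by
      simp only [M]
      ring
    linarith
  have hδM : δ / 2 * M ≤ 1 / 2 := by
    have : δ * M ≤ 1 := by
      simp only [δ]
      rw [one_div, inv_mul_le_iff₀ (by positivity)]
      linarith
    linarith
  have hE : E = 0 := by nlinarith
  have hae : energyDensity p =ᵐ[muO n] 0 := by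
    refine (integral_eq_zero_iff_of_nonneg_ae ?_ (integrable_energyDensity p)).1 hE
    filter_upwards [ae_muO_mem] with q hq using energyDensity_nonneg p hq
  have hfst : p.fst = 0 := by
    refine Lp.ext (EventuallyEq.trans ?_ (Lp.coeFn_zero _ _ _).symm)
    rw [EventuallyEq, ae_zMeasure]
    filter_upwards [hae, ae_muO_mem] with q hq hq'
    have h1 := weighted_le_energyDensity p q
    rw [hq] at h1
    have h2 : ‖p.fst q‖ ^ 2 ≤ 0 := by
      by_contra h
      exact absurd h1 (not_le.2 (mul_pos (show (0 : ℝ) < q.2 from hq') (not_le.1 h)))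
    exact norm_eq_zero.1 (pow_eq_zero_iff two_ne_zero |>.1 (le_antisymm h2 (sq_nonneg _)))
  have hsnd : ∀ o, p.snd o = 0 := fun o => by
    refine Lp.ext (EventuallyEq.trans ?_ (Lp.coeFn_zero _ _ _).symm)
    filter_upwards [hae, ae_muO_mem] with q hq hq'
    have h1 := sq_snd_le_energyDensity p hq' o
    rw [hq] at h1
    exact norm_eq_zero.1 (pow_eq_zero_iff two_ne_zero |>.1 (le_antisymm h1 (sq_nonneg _)))
  have h1 : ‖p‖ ^ 2 = 0 := by
    rw [WithLp.prod_norm_sq_eq_of_L2, PiLp.norm_sq_eq_of_L2, hfst]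
    simp [hsnd]
  exact norm_eq_zero.1 (pow_eq_zero_iff two_ne_zero |>.1 h1)

/-- Project a pair onto the closed subspace `formGraph`: the remainder is again an energy pair, is
orthogonal to all test pairs, and so vanishes. -/
theorem energyGraph_eq_formGraph : energyGraph n = UnboundedOp.formGraph (gradOp n) := by
  refine le_antisymm (fun p hp => ?_) formGraph_le_energyGraph
  have hcl : IsClosed (UnboundedOp.formGraph (gradOp n) : Set (WithLp 2 (Hsp n × Ksp n))) :=
    Submodule.isClosed_topologicalClosure _
  have : CompleteSpace (UnboundedOp.formGraph (gradOp n)) := hcl.completeSpace_coe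
  obtain ⟨y, hy, r, hr, rfl⟩ :=
    (UnboundedOp.formGraph (gradOp n)).exists_add_mem_mem_orthogonal p
  have hrE : r ∈ energyGraph n := by
    have := (energyGraph n).sub_mem hp (formGraph_le_energyGraph hy)
    rwa [add_sub_cancel_left] at this
  have hr0 : r = 0 := EnergyPair.eq_zero_of_orthogonal hrE fun φ =>
    Submodule.inner_left_of_mem_orthogonal (toLp_test_mem_formGraph φ) hr
  rwa [hr0, add_zero]

theorem energySpace_eq_formDomain :
    UnboundedOp.formDomain (waveOp n) = energySpace n := by
  refine Set.Subset.antisymm formDomain_subset_energySpace fun u hu => ?_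
  obtain ⟨k, hk⟩ := exists_energyPair hu
  refine (UnboundedOp.mem_formDomain_iff inner_gradOp u).2 ⟨k, ?_⟩
  rw [← energyGraph_eq_formGraph]
  exact hk

theorem testFunctionsDenseInEnergySpace : TestFunctionsDenseInEnergySpace n := by
  refine ⟨fun φ => EnergyPair.mem_energySpace (toLp_test_mem_energyGraph φ), fun u hu ε hε => ?_⟩
  obtain ⟨k, hk⟩ := exists_energyPair hu
  have hmem : WithLp.toLp 2 (u, k) ∈ UnboundedOp.formGraph (gradOp n) := by
    rw [← energyGraph_eq_formGraph]
    exact hk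
  rw [UnboundedOp.formGraph, ← SetLike.mem_coe, Submodule.topologicalClosure_coe,
    mem_closure_iff_seq_limit] at hmem
  obtain ⟨s, hs, hlim⟩ := hmem
  have h1 : Tendsto (fun m => ENNReal.ofReal (‖WithLp.toLp 2 (u, k) - s m‖ ^ 2)) atTop (𝓝 0) := by
    have h2 := ((tendsto_const_nhds (x := WithLp.toLp 2 (u, k))).sub hlim).norm.pow 2
    rw [sub_self, norm_zero, zero_pow two_ne_zero] at h2
    have h3 := (ENNReal.continuous_ofReal.tendsto 0).comp h2
    rw [ENNReal.ofReal_zero] at h3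
    exact h3
  obtain ⟨m, hm⟩ := (h1.eventually (gt_mem_nhds hε)).exists
  obtain ⟨x, hx⟩ := hs m
  obtain ⟨φ, rfl⟩ := waveOp_domain_cases x
  refine ⟨φ, ?_⟩
  have hsm : s m = WithLp.toLp 2 (incl n φ, gradMap n φ) := by
    rw [← hx, ← gradOp_incl]
    rfl
  rw [hsm] at hm
  have hpair : EnergyPair (WithLp.toLp 2 (u, k) - WithLp.toLp 2 (incl n φ, gradMap n φ)) :=
    (energyGraph n).sub_mem hk (toLp_test_mem_energyGraph φ)
  rw [← hpair.energyNormSq_eq] at hm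
  exact hm

end Taub

/-! ### A consequence of essential self-adjointness for the form domain -/

namespace UnboundedOp

variable {H : Type*} [NormedAddCommGroup H] [InnerProductSpace ℂ H] [CompleteSpace H]
  {K : Type*} [NormedAddCommGroup K] [InnerProductSpace ℂ K] [CompleteSpace K]
  {A : H →ₗ.[ℂ] H} {D : A.domain →ₗ[ℂ] K}

/-- If a nonnegative symmetric operator is essentially self-adjoint, then its form domain contains
every `u` for which `x ↦ ⟨u, A x⟩` is bounded in the form norm. -/
theorem IsEssentiallySelfAdjoint.mem_formDomain (hA : IsNonnegSymmetric A)
    (hD : ∀ x y : A.domain, inner ℂ (D x) (D y) = inner ℂ (A x) (y : H))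
    (h : IsEssentiallySelfAdjoint A) {u w : H} {F : K}
    (hu : ∀ x : A.domain, inner ℂ u (A x) = inner ℂ w (x : H) + inner ℂ F (D x)) :
    u ∈ formDomain A := by
  have hcl : IsClosed (formGraph D : Set (WithLp 2 (H × K))) :=
    Submodule.isClosed_topologicalClosure _
  have : CompleteSpace (formGraph D) := hcl.completeSpace_coe
  -- Projecting `(0, F)` to `y` turns `⟨F, D x⟩` into `⟨y.fst, x⟩ + ⟨y.fst, A x⟩`. Hence `u - y.fst`
  -- lies in `D(A†)`, which is contained in the form domain, as is `y.fst`.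
  obtain ⟨y, hy, r, hr, hyr⟩ :=
    (formGraph D).exists_add_mem_mem_orthogonal (WithLp.toLp 2 ((0 : H), F))
  have hmem : u - y.fst ∈ A†.domain := by
    refine LinearPMap.mem_adjoint_domain_of_exists _ ⟨w + y.fst, fun x => ?_⟩
    have h1 := Submodule.inner_left_of_mem_orthogonal (toLp_mem_formGraph x) hr
    rw [← sub_eq_iff_eq_add'.2 hyr, inner_sub_left, WithLp.prod_inner_apply,
      WithLp.prod_inner_apply] at h1
    change inner ℂ (0 : H) (x : H) + inner ℂ F (D x)
      - (inner ℂ y.fst (x : H) + inner ℂ y.snd (D x)) = 0 at h1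
    rw [inner_snd_of_mem_formGraph hA.symmetric hD hy, inner_zero_left] at h1
    rw [inner_add_left, inner_sub_left, hu]
    linear_combination -h1
  obtain ⟨k, hk⟩ := (mem_formDomain_iff hD _).1 (h.adjoint_domain_subset hA hmem)
  refine (mem_formDomain_iff hD u).2 ⟨k + y.snd, ?_⟩
  have h2 := (formGraph D).add_mem hk hy
  have h3 : WithLp.toLp 2 (u - y.fst, k) + y = WithLp.toLp 2 (u, k + y.snd) := by
    refine WithLp.ofLp_injective 2 (Prod.ext ?_ rfl)
    exact sub_add_cancel u y.fst
  rwa [h3] at h2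

end UnboundedOp

/-! ### Failure of essential self-adjointness -/

namespace Taub

variable {n : ℕ}

theorem flux_conj (o : Option (Fin n)) {f : Pt n → ℂ} :
    (fun q => ((wt o q.2 ^ 2 : ℝ) : ℂ) * pd (dir o) (fun p => conj (f p)) q)
      = fun q => conj (((wt o q.2 ^ 2 : ℝ) : ℂ) * pd (dir o) f q) := by
  funext q
  rw [pd_conj, map_mul, Complex.conj_ofReal]

theorem contDiffOn_conj {f : Pt n → ℂ} (hf : ContDiffOn ℝ ∞ f (Om n)) :
    ContDiffOn ℝ ∞ (fun p => conj (f p)) (Om n) :=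
  Complex.conjCLE.contDiff.comp_contDiffOn hf

/-- Green's formula for a smooth function and a test function. -/
theorem integral_mul_waveFun {f : Pt n → ℂ} (hf : ContDiffOn ℝ ∞ f (Om n)) (ψ : 𝓓(Om n, ℂ)) :
    ∫ p, f p * ((p.2 : ℂ) * waveFun ψ p) ∂muO n
      = ∑ o, ∫ p, ((wt o p.2 ^ 2 : ℝ) : ℂ) * pd (dir o) f p * pd (dir o) ψ p ∂muO n := by
  have hψ : ContDiffOn ℝ ∞ (ψ : Pt n → ℂ) (Om n) := ψ.contDiff.contDiffOn
  have hw : ∀ o : Option (Fin n),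
      ContDiffOn ℝ ∞ (fun p : Pt n => ((wt o p.2 ^ 2 : ℝ) : ℂ)) (Om n) := fun o => Complex.ofRealCLM.contDiff.comp_contDiffOn ((contDiffOn_wt o).pow 2)
  have h1 : ∀ o : Option (Fin n),
      ∫ p, ((wt o p.2 ^ 2 : ℝ) : ℂ) * pd (dir o) f p * pd (dir o) ψ p ∂muO n
      = -∫ p, f p * pd (dir o) (mulTest _ (hw o) (pdTest (dir o) ψ)) p ∂muO n := fun o => by
    rw [integral_mul_pd _ hf, neg_neg]
    refine integral_congr_ae (.of_forall fun p => ?_)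
    simp only [coe_mulTest, coe_pdTest]
    ring
  simp only [h1]
  rw [Finset.sum_neg_distrib, ← integral_finsetSum, ← integral_neg]
  · refine integral_congr_ae ?_
    filter_upwards [ae_muO_mem] with p hp
    rw [mul_waveFun hψ hp, mul_neg, Finset.mul_sum]
    rfl
  · intro o _
    exact integrable_mul_test hf.continuousOn
      (pdTest (dir o) (mulTest _ (hw o) (pdTest (dir o) ψ))) _

theorem hasWeakPd_of_contDiffOn (v : Pt n) {f : Pt n → ℂ} (hf : ContDiffOn ℝ ∞ f (Om n)) :
    HasWeakPd v f (pd v f) := by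
  refine ⟨?_, integral_mul_pd v hf⟩
  simpa using isL2loc_one.continuousOn_mul (continuousOn_pd v hf)

/-- If `A` is essentially self-adjoint, `f` is smooth on `Ω` and `f`, `z⁻¹ ∂_z (z ∂_z f)` and
`z^(-1/(2n)) ∇ f` are square integrable, then so is `z^(1/2) ∂_z f`. -/
theorem memLp_wt_mul_pd_of_isEssentiallySelfAdjoint
    (h : UnboundedOp.IsEssentiallySelfAdjoint (waveOp n)) {f : Pt n → ℂ}
    (hf : ContDiffOn ℝ ∞ f (Om n)) (hf2 : MemLp f 2 (zMeasure n))
    (hx : ∀ i : Fin n, MemLp (fun p => (wt (some i) p.2 : ℂ) * pd (ex i) f p) 2 (muO n))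
    (hz : MemLp (fun p => (p.2 : ℂ)⁻¹ * pd ez
      (fun q => ((wt (none : Option (Fin n)) q.2 ^ 2 : ℝ) : ℂ) * pd ez f q) p) 2 (zMeasure n)) :
    MemLp (fun p => (wt (none : Option (Fin n)) p.2 : ℂ) * pd ez f p) 2 (muO n) := by
  -- Only the `z`-part of `A f` is assumed to lie in `H` and goes into `w`. The `x`-part is kept as
  -- a gradient in `F`, because `z^(-1-1/n) Δ f` need not be square integrable.
  let F : Ksp n := WithLp.toLp 2 fun o => o.elim 0 fun i => (hx i).toLp _
  have hmem : hf2.toLp f ∈ UnboundedOp.formDomain (waveOp n) := by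
    refine UnboundedOp.IsEssentiallySelfAdjoint.mem_formDomain isNonnegSymmetric_waveOp
      inner_gradOp h (w := -hz.toLp _) (F := F) fun x => ?_
    obtain ⟨ψ, rfl⟩ := waveOp_domain_cases x
    rw [gradOp_incl, waveOp_incl, inner_neg_left]
    have h1 : inner ℂ (hf2.toLp f) (waveMap n ψ)
        = ∫ p, conj (f p) * ((p.2 : ℂ) * waveFun ψ p) ∂muO n := by
      rw [inner_toLp_left, integral_zMeasure]
      refine integral_congr_ae ?_
      filter_upwards [absolutelyContinuous_zMeasure.ae_le (waveFun_memLp ψ).coeFn_toLp] with p hp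
      change (p.2 : ℂ) * (((waveFun_memLp ψ).toLp _ : Hsp n) p * _) = _
      rw [hp]
      ring
    have h2 : inner ℂ (hz.toLp _) (incl n ψ)
        = ∫ p, conj (pd ez (fun q => ((wt (none : Option (Fin n)) q.2 ^ 2 : ℝ) : ℂ)
          * pd ez f q) p) * ψ p ∂muO n := by
      rw [inner_toLp_left, integral_zMeasure]
      refine integral_congr_ae ?_
      filter_upwards [incl_ae ψ, ae_muO_mem] with p hp hp'
      have := ofReal_snd_ne_zero hp'
      rw [hp, map_mul, map_inv₀, Complex.conj_ofReal]
      field_simp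
    have h3 : ∀ i, inner ℂ (F (some i)) (gradMap n ψ (some i))
        = ∫ p, ((wt (some i) p.2 ^ 2 : ℝ) : ℂ) * pd (dir (some i)) (fun q => conj (f q)) p
          * pd (dir (some i)) ψ p ∂muO n := fun i => by
      change inner ℂ ((hx i).toLp _) _ = _
      rw [inner_toLp_left]
      refine integral_congr_ae ?_
      filter_upwards [gradMap_ae ψ (some i)] with p hp
      rw [hp, pd_conj, map_mul, Complex.conj_ofReal]
      push_cast
      change _ = _ * conj (pd (ex i) f p) * _
      ring
    have h4 := contDiffOn_flux (none : Option (Fin n)) (contDiffOn_conj hf)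
    rw [h1, h2, integral_mul_waveFun (contDiffOn_conj hf), PiLp.inner_apply, Fintype.sum_option,
      Fintype.sum_option, integral_mul_pd _ h4]
    simp only [h3, flux_conj]
    have h5 : F none = 0 := rfl
    rw [h5, inner_zero_left, zero_add]
    congr 2
    refine integral_congr_ae (.of_forall fun p => ?_)
    simp only [pd_conj]
    rfl
  obtain ⟨k, hk⟩ := exists_energyPair (formDomain_subset_energySpace hmem)
  have h1 := hk.hasWeakPd none
  -- The classical derivative of the smooth representative is also a weak derivative, so by
  -- uniqueness it inherits the square integrability of the second component.
  have h2 : HasWeakPd (dir none) (hf2.toLp f) (pd ez f) := by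
    obtain ⟨h3, h4⟩ := hasWeakPd_of_contDiffOn ez hf
    refine ⟨h3, fun ψ => (integral_congr_ae ?_).trans (h4 ψ)⟩
    filter_upwards [absolutelyContinuous_zMeasure.ae_le hf2.coeFn_toLp] with p hp
    rw [hp]
    rfl
  refine (memLp_congr_ae ?_).1 (Lp.memLp (k none))
  filter_upwards [h1.ae_eq h2, ae_muO_mem] with p hp hp'
  have := ofReal_wt_ne_zero none hp'
  rw [← hp]
  field_simp
  rfl

/-! ### A function with a logarithmic singularity on the boundary -/

theorem pd_mul_snd_fst (v p : Pt n) {a : ℝ → ℝ} {b : EuclideanSpace ℝ (Fin n) → ℝ} {a' : ℝ}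
    (ha : HasDerivAt a a' p.2) (hb : DifferentiableAt ℝ b p.1) :
    pd v (fun q => ((a q.2 * b q.1 : ℝ) : ℂ)) p
      = ((a p.2 * fderiv ℝ b p.1 v.1 + b p.1 * (a' * v.2) : ℝ) : ℂ) := by
  have h1 : HasFDerivAt (fun q : Pt n => a q.2)
      (a' • ContinuousLinearMap.snd ℝ (EuclideanSpace ℝ (Fin n)) ℝ) p :=
    ha.comp_hasFDerivAt p (hasFDerivAt_snd (𝕜 := ℝ) (p := p))
  have h2 : HasFDerivAt (fun q : Pt n => b q.1) _ p := hb.hasFDerivAt.comp p hasFDerivAt_fst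
  have h3 := (Complex.ofRealCLM.hasFDerivAt.comp p (h1.mul h2)).fderiv
  rw [pd, show (fun q : Pt n => ((a q.2 * b q.1 : ℝ) : ℂ))
    = Complex.ofRealCLM ∘ ((fun q : Pt n => a q.2) * fun q => b q.1) from rfl, h3]
  simp

theorem muO_eq_prod : muO n = (volume : Measure (EuclideanSpace ℝ (Fin n))).prod
    ((volume : Measure ℝ).restrict (Set.Ioi 0)) := by
  have : (Om n : Set (Pt n)) = Set.univ ×ˢ Set.Ioi 0 := by
    ext p
    simp [Om]
  rw [muO, this, Measure.volume_eq_prod, ← Measure.prod_restrict, Measure.restrict_univ]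

/-- The squared modulus is a product of functions of `x` and `z`, and `z^(-3/4)` is integrable at
`0`. -/
theorem memLp_mul_snd_fst {a : ℝ → ℝ} {b : EuclideanSpace ℝ (Fin n) → ℝ} {C : ℝ}
    (ha : ContinuousOn a (Set.Ioi 0)) (ha0 : ∀ z, 1 ≤ z → a z = 0)
    (haC : ∀ z, 0 < z → z < 1 → a z ^ 2 ≤ C * z ^ (-(3 / 4) : ℝ))
    (hb : Continuous b) (hbc : HasCompactSupport b) :
    MemLp (fun p : Pt n => ((a p.2 * b p.1 : ℝ) : ℂ)) 2 (muO n) := by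
  have hm : AEStronglyMeasurable (fun p : Pt n => ((a p.2 * b p.1 : ℝ) : ℂ)) (muO n) := by
    refine ContinuousOn.aestronglyMeasurable ?_ measurableSet_Om
    exact Complex.continuous_ofReal.comp_continuousOn
      ((ha.comp continuousOn_snd fun p hp => hp).mul (hb.comp continuous_fst).continuousOn)
  have h1 : Integrable fun x => b x ^ 2 :=
    (hb.pow 2).integrable_of_hasCompactSupport
      (hbc.mono fun x hx => fun h => hx (by simp [h]))
  have h2 : IntegrableOn (fun z => a z ^ 2) (Set.Ioi 0) := by
    have h3 : IntegrableOn (fun z : ℝ => C * z ^ (-(3 / 4) : ℝ)) (Set.Ioo 0 1) :=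
      ((intervalIntegral.integrableOn_Ioo_rpow_iff one_pos).2 (by norm_num)).const_mul C
    have h4 : IntegrableOn (fun z => a z ^ 2) (Set.Ioo 0 1) := by
      refine h3.mono' (((ha.mono fun z hz => hz.1).pow 2).aestronglyMeasurable
        measurableSet_Ioo) ?_
      filter_upwards [ae_restrict_mem measurableSet_Ioo] with z hz
      rw [Real.norm_of_nonneg (sq_nonneg _)]
      exact haC z hz.1 hz.2
    refine h4.of_forall_sdiff_eq_zero measurableSet_Ioi fun z hz => ?_
    rw [ha0 z (not_lt.1 fun h => hz.2 ⟨hz.1, h⟩), zero_pow two_ne_zero]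
  have h3 : Integrable (fun p : Pt n => b p.1 ^ 2 * a p.2 ^ 2) (muO n) := by
    rw [muO_eq_prod]
    exact h1.mul_prod h2
  refine (memLp_two_iff_integrable_sq_norm hm).2 (h3.congr (.of_forall fun p => ?_))
  simp only [Complex.norm_real, Real.norm_eq_abs, sq_abs]
  ring

/-- The logarithm, cut off at `z = 1`. -/
def logCut (z : ℝ) : ℝ := Real.log z * Real.smoothTransition (2 - 2 * z)

theorem logCut_eq_zero {z : ℝ} (hz : 1 ≤ z) : logCut z = 0 := by
  rw [logCut, Real.smoothTransition.zero_of_nonpos (by linarith), mul_zero]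

theorem logCut_eq_log {z : ℝ} (hz : z ≤ 1 / 2) : logCut z = Real.log z := by
  rw [logCut, Real.smoothTransition.one_of_one_le (by linarith), mul_one]

theorem contDiffAt_logCut {z : ℝ} (hz : 0 < z) : ContDiffAt ℝ ∞ logCut z := by
  refine ContDiffAt.mul (Real.contDiffAt_log.2 hz.ne') ?_
  exact Real.smoothTransition.contDiff.contDiffAt.comp z
    (contDiffAt_const.sub (contDiffAt_const.mul contDiffAt_id))

/-- The assumption `n ≥ 2` enters here: it gives `wt² ≤ z^(-1/2)`, which leaves room for the
logarithm, `log² z ≤ 64 z^(-1/4)`. The constant is `8²`, from `|log z| z^(1/8) < 8`. -/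
theorem wt_mul_logCut_sq_le (hn : 2 ≤ n) (o : Option (Fin n)) {z : ℝ} (hz : 0 < z) (hz1 : z < 1) :
    (wt o z * logCut z) ^ 2 ≤ 64 * z ^ (-(3 / 4) : ℝ) := by
  have h1 : wt o z ^ 2 ≤ z ^ (-(1 / 2) : ℝ) := by
    cases o with
    | none =>
      rw [wt_none_sq hz]
      nth_rewrite 1 [← Real.rpow_one z]
      exact Real.rpow_le_rpow_of_exponent_ge hz hz1.le (by norm_num)
    | some i =>
      rw [wt_some_sq i hz]
      refine Real.rpow_le_rpow_of_exponent_ge hz hz1.le (neg_le_neg ?_)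
      exact one_div_le_one_div_of_le two_pos (by exact_mod_cast hn)
  have h2 : Real.log z ^ 2 ≤ 64 * z ^ (-(1 / 4) : ℝ) := by
    have h3 := (Real.abs_log_mul_self_rpow_lt z (1 / 8) hz hz1.le (by norm_num)).le
    have h4 : (Real.log z * z ^ (1 / 8 : ℝ)) ^ 2 ≤ 64 := by
      rw [← sq_abs]
      nlinarith [abs_nonneg (Real.log z * z ^ (1 / 8 : ℝ))]
    have h5 : (z ^ (1 / 8 : ℝ)) ^ 2 * z ^ (-(1 / 4) : ℝ) = 1 := by
      rw [← Real.rpow_natCast, ← Real.rpow_mul hz.le, ← Real.rpow_add hz]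
      norm_num
    calc Real.log z ^ 2 = (Real.log z * z ^ (1 / 8 : ℝ)) ^ 2 * z ^ (-(1 / 4) : ℝ) := by
          rw [mul_pow, mul_assoc, h5, mul_one]
      _ ≤ _ := mul_le_mul_of_nonneg_right h4 (Real.rpow_nonneg hz.le _)
  have h3 : logCut z ^ 2 ≤ 64 * z ^ (-(1 / 4) : ℝ) := by
    refine le_trans ?_ h2
    rw [logCut, mul_pow]
    refine mul_le_of_le_one_right (sq_nonneg _) ?_
    exact pow_le_one₀ (Real.smoothTransition.nonneg _) (Real.smoothTransition.le_one _)
  calc (wt o z * logCut z) ^ 2 = wt o z ^ 2 * logCut z ^ 2 := mul_pow _ _ _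
    _ ≤ z ^ (-(1 / 2) : ℝ) * (64 * z ^ (-(1 / 4) : ℝ)) :=
        mul_le_mul h1 h3 (sq_nonneg _) (Real.rpow_nonneg hz.le _)
    _ = _ := by
        rw [mul_left_comm, ← Real.rpow_add hz]
        norm_num

/-- A smooth function on `Ω` that is `log z` near a part of the boundary. -/
def logFun (n : ℕ) (p : Pt n) : ℂ := ((logCut p.2 * bumpX n p.1 : ℝ) : ℂ)

theorem contDiffOn_logFun : ContDiffOn ℝ ∞ (logFun n) (Om n) := fun p hp =>
  (Complex.ofRealCLM.contDiff.contDiffAt.comp p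
    (((contDiffAt_logCut hp).comp p contDiffAt_snd).mul
      ((bumpX n).contDiff.contDiffAt.comp p contDiffAt_fst))).contDiffWithinAt

theorem differentiable_bumpX : Differentiable ℝ (bumpX n) :=
  (bumpX n).contDiff.differentiable (n := ∞) (by simp)

theorem memLp_wt_mul_logCut (hn : 2 ≤ n) (o : Option (Fin n)) {b : EuclideanSpace ℝ (Fin n) → ℝ}
    (hb : Continuous b) (hbc : HasCompactSupport b) :
    MemLp (fun p : Pt n => (((wt o p.2 * logCut p.2) * b p.1 : ℝ) : ℂ)) 2 (muO n) := by
  refine memLp_mul_snd_fst (a := fun z => wt o z * logCut z) (fun z hz => ?_) (fun z hz => ?_)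
    (fun z => wt_mul_logCut_sq_le hn o) hb hbc
  · have hz' : (0 : ℝ) < z := hz
    exact ((Real.continuousAt_rpow_const z _ (Or.inl hz'.ne')).mul
      (contDiffAt_logCut hz').continuousAt).continuousWithinAt
  · simp only [logCut_eq_zero hz, mul_zero]

theorem memLp_logFun (hn : 2 ≤ n) : MemLp (logFun n) 2 (zMeasure n) := by
  rw [memLp_zMeasure_iff]
  refine (memLp_congr_ae (.of_forall fun p => ?_)).1
    (memLp_wt_mul_logCut hn none (bumpX n).continuous (bumpX n).hasCompactSupport)
  simp only [logFun]
  push_cast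
  ring

theorem memLp_wt_mul_pd_logFun (hn : 2 ≤ n) (i : Fin n) :
    MemLp (fun p => (wt (some i) p.2 : ℂ) * pd (ex i) (logFun n) p) 2 (muO n) := by
  have h1 : ContDiff ℝ ∞ (bumpX n) := (bumpX n).contDiff
  refine (memLp_congr_ae ?_).1 (memLp_wt_mul_logCut hn (some i)
    (b := fun x => fderiv ℝ (bumpX n) x (EuclideanSpace.single i 1))
    ((h1.continuous_fderiv (by simp)).clm_apply continuous_const)
    ((bumpX n).hasCompactSupport.fderiv_apply ℝ _))
  filter_upwards [ae_muO_mem] with p hp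
  have h2 : HasDerivAt logCut (deriv logCut p.2) p.2 :=
    ((contDiffAt_logCut hp).differentiableAt (by simp)).hasDerivAt
  unfold logFun
  rw [pd_mul_snd_fst _ p h2 (differentiable_bumpX p.1)]
  simp only [ex]
  push_cast
  ring

theorem pd_ez_logFun {p : Pt n} (hp : p ∈ (Om n : Set (Pt n))) (hp' : p.2 < 1 / 2) :
    pd ez (logFun n) p = ((p.2⁻¹ * bumpX n p.1 : ℝ) : ℂ) := by
  have h2 : HasDerivAt logCut p.2⁻¹ p.2 := by
    refine (Real.hasDerivAt_log (ne_of_gt hp)).congr_of_eventuallyEq ?_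
    filter_upwards [gt_mem_nhds hp'] with z hz using logCut_eq_log hz.le
  unfold logFun
  rw [pd_mul_snd_fst _ p h2 (differentiable_bumpX p.1)]
  simp only [ez]
  push_cast
  simp
  ring

theorem tsupport_logFun_subset :
    tsupport (logFun n) ⊆ Metric.closedBall 0 2 ×ˢ Set.Iic (1 : ℝ) := by
  refine closure_minimal (fun p hp => ?_) (Metric.isClosed_closedBall.prod isClosed_Iic)
  rw [Function.mem_support, logFun, Complex.ofReal_ne_zero, mul_ne_zero_iff] at hp
  refine ⟨?_, ?_⟩
  · by_contra h
    exact hp.2 ((bumpX n).zero_of_le_dist (not_le.1 h).le)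
  · by_contra h
    exact hp.1 (logCut_eq_zero (not_le.1 h).le)

/-- For `z < 1/2` the flux `z ∂_z (b log z) = b` does not depend on `z`, and the function vanishes
for `z ≥ 1`. What remains is continuous on `Ω` and confined to a compact set with `1/2 ≤ z ≤ 1`. -/
theorem memLp_flux_logFun : MemLp (fun p => (p.2 : ℂ)⁻¹ * pd ez
    (fun q => ((wt (none : Option (Fin n)) q.2 ^ 2 : ℝ) : ℂ) * pd ez (logFun n) q) p)
    2 (zMeasure n) := by
  set F : Pt n → ℂ := fun q =>
    ((wt (none : Option (Fin n)) q.2 ^ 2 : ℝ) : ℂ) * pd ez (logFun n) q with hF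
  have hFs : ContDiffOn ℝ ∞ F (Om n) := contDiffOn_flux none contDiffOn_logFun
  let K : Set (Pt n) := Metric.closedBall 0 2 ×ˢ Set.Icc (1 / 2 : ℝ) 1
  have hK : IsCompact K := (isCompact_closedBall _ _).prod isCompact_Icc
  have hKO : K ⊆ Om n := fun p hp => lt_of_lt_of_le (by norm_num) hp.2.1
  have h0 : ∀ p ∈ (Om n : Set (Pt n)), p ∉ K → pd ez F p = 0 := fun p hp hpK => by
    by_cases hz : p.2 < 1 / 2
    · have h1 : F =ᶠ[𝓝 p] fun q => (((fun _ => 1) q.2 * bumpX n q.1 : ℝ) : ℂ) := by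
        filter_upwards [(Om n).isOpen.mem_nhds hp,
          (isOpen_lt continuous_snd continuous_const).mem_nhds hz] with q hq hq'
        have := ofReal_snd_ne_zero hq
        rw [hF]
        simp only
        rw [pd_ez_logFun hq hq', wt_none_sq hq]
        push_cast
        field_simp
      rw [pd, h1.fderiv_eq]
      change pd ez _ p = 0
      rw [pd_mul_snd_fst _ p (hasDerivAt_const p.2 1) (differentiable_bumpX p.1)]
      simp [ez]
    · refine pd_eq_zero _ fun h => hpK ?_
      have h1 := tsupport_logFun_subset (tsupport_pd_subset ez _ (tsupport_mul_subset_right h))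
      exact ⟨h1.1, not_lt.1 hz, h1.2⟩
  rw [memLp_zMeasure_iff]
  have h1 := ((isL2loc_one.continuousOn_mul (continuousOn_pd ez hFs)).continuousOn_mul
    continuousOn_inv_snd).continuousOn_mul (continuousOn_ofReal_wt none) K hK hKO
  rw [← memLp_indicator_iff_restrict hK.measurableSet] at h1
  refine (memLp_congr_ae ?_).1 (h1.restrict (Om n : Set (Pt n)))
  filter_upwards [ae_muO_mem] with p hp
  by_cases hpK : p ∈ K
  · rw [Set.indicator_of_mem hpK, mul_one]
  · rw [Set.indicator_of_notMem hpK, h0 p hp hpK, mul_zero, mul_zero]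

/-- On `|x| < 1`, `0 < z < 1/2` the squared modulus is `1 / z`, whose integral diverges at the
boundary. -/
theorem not_memLp_wt_mul_pd_logFun :
    ¬ MemLp (fun p => (wt (none : Option (Fin n)) p.2 : ℂ) * pd ez (logFun n) p) 2 (muO n) := by
  intro h
  have h1 := (memLp_two_iff_integrable_sq_norm h.1).1 h
  let B : Set (EuclideanSpace ℝ (Fin n)) := Metric.ball 0 1
  have h2 : IntegrableOn (fun p : Pt n => ‖(wt (none : Option (Fin n)) p.2 : ℂ)
      * pd ez (logFun n) p‖ ^ 2) (B ×ˢ Set.Ioo 0 (1 / 2)) :=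
    h1.mono_measure (Measure.restrict_mono (fun p hp => hp.2.1) le_rfl)
  have hS : MeasurableSet (B ×ˢ Set.Ioo (0 : ℝ) (1 / 2)) :=
    measurableSet_ball.prod measurableSet_Ioo
  have h3 : IntegrableOn (fun p : Pt n => p.2 ^ (-1 : ℝ)) (B ×ˢ Set.Ioo 0 (1 / 2)) := by
    refine h2.congr ?_
    filter_upwards [ae_restrict_mem hS] with p hp
    have hz : 0 < p.2 := hp.2.1
    rw [pd_ez_logFun hz hp.2.2,
      (bumpX n).one_of_mem_closedBall (Metric.ball_subset_closedBall hp.1),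
      mul_one, norm_mul, Complex.norm_real, Complex.norm_real, mul_pow, Real.norm_eq_abs,
      Real.norm_eq_abs, sq_abs, sq_abs, wt_none_sq hz, Real.rpow_neg_one]
    field_simp
  rw [IntegrableOn, Measure.volume_eq_prod, ← Measure.prod_restrict] at h3
  have h4 := Integrable.of_comp_snd (f := fun z : ℝ => z ^ (-1 : ℝ)) h3 (by
    rw [Ne, Measure.restrict_eq_zero]
    exact (Metric.measure_ball_pos volume _ one_pos).ne')
  have h5 := (intervalIntegral.integrableOn_Ioo_rpow_iff (by norm_num)).1 h4
  exact lt_irrefl _ h5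

theorem not_isEssentiallySelfAdjoint_waveOp (hn : 2 ≤ n) :
    ¬ UnboundedOp.IsEssentiallySelfAdjoint (waveOp n) := fun h =>
  not_memLp_wt_mul_pd_logFun (memLp_wt_mul_pd_of_isEssentiallySelfAdjoint h contDiffOn_logFun
    (memLp_logFun hn) (memLp_wt_mul_pd_logFun hn) memLp_flux_logFun)

end Taub

end

theorem mainTheorem4 (n : ℕ) (hn : 2 ≤ n) :
    -- `A` is densely defined, symmetric and nonnegative, but not essentially self-adjoint
    UnboundedOp.IsNonnegSymmetric (Taub.waveOp n) ∧
    ¬ UnboundedOp.IsEssentiallySelfAdjoint (Taub.waveOp n) ∧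
    -- the Friedrichs extension is the only self-adjoint extension with domain in the energy space
    (∃ T : Taub.Hsp n →ₗ.[ℂ] Taub.Hsp n,
      (UnboundedOp.IsSelfAdjointExtension (Taub.waveOp n) T ∧
        (T.domain : Set (Taub.Hsp n)) ⊆ Taub.energySpace n) ∧
      UnboundedOp.IsFriedrichsExtension (Taub.waveOp n) T ∧
      ∀ T' : Taub.Hsp n →ₗ.[ℂ] Taub.Hsp n,
        UnboundedOp.IsSelfAdjointExtension (Taub.waveOp n) T' →
        (T'.domain : Set (Taub.Hsp n)) ⊆ Taub.energySpace n → T' = T) ∧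
    -- test functions are dense in the energy space
    Taub.TestFunctionsDenseInEnergySpace n := by
  have hA : UnboundedOp.IsNonnegSymmetric (Taub.waveOp n) := Taub.isNonnegSymmetric_waveOp
  have hD := Taub.inner_gradOp (n := n)
  have hF := UnboundedOp.isFriedrichsExtension_friedrichs hA hD
  refine ⟨hA, Taub.not_isEssentiallySelfAdjoint_waveOp hn,
    ⟨UnboundedOp.friedrichs (Taub.gradOp n),
      ⟨⟨UnboundedOp.le_friedrichs hA, UnboundedOp.isSelfAdjoint_friedrichs hA hD⟩,
        fun u hu => Taub.formDomain_subset_energySpace ((hF.mem_domain_iff u).1 hu).2⟩, hF,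
      fun T' hT' hdom => UnboundedOp.eq_friedrichs_of_domain_subset hA hD hT' ?_⟩,
    Taub.testFunctionsDenseInEnergySpace⟩
  -- Density of the test functions is what turns uniqueness within the form domain into uniqueness
  -- within the energy space.
  rwa [Taub.energySpace_eq_formDomain]
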